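/- **Setting.** Let $X$ be a totally ordered, order complete set (every nonempty subset that is bounded above has a supremum; for instance a compact interval of $\mathbb{R}$) with the order topology, let $\mathcal{B}$ be its Borel $\sigma$-algebra, and let $\mu$ be a regular Borel probability measure on $X$. A function $f:X\to\mathbb{R}$ has bounded variation if $\mathrm{var}(f)=\sup\sum_{i=1}^n|f(x_{i-1})-f(x_i)|<\infty$, the supremum being over all finite ordered sequences in $X$. If $m$ is a $\sigma$-finite measure on $\mathcal B$ for which a measurable map $T$ is nonsingular, the transfer operator of $T$ with respect to $m$ is the operator on $L^1(m)$ that sends $f$ to the unique element of $L^1(m)$ whose integral over each $A\in\mathcal{B}$ is $\int_{T^{-1}(A)}f\,dm$. Let $P$ denote the transfer operator with respect to $\mu$. Let $V\subset X$ be open and dense with $\mu(V)=1$ and let $T:V\to X$ be continuous and nonsingular with respect to $\mu$; extend $T$ to a measurable map $X\to X$ (the values off the null set $X\setminus V$ are arbitrary). $(T,\mu)$ is a *piecewise uniformly expanding map* if 1. there is a countable family $\mathcal{Z}$ of closed intervals with pairwise disjoint interiors such that $V\subset\bigcup_{Z\in\mathcal{Z}}Z$ and, for each $Z\in\mathcal{Z}$,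 the set $Z\cap(X\setminus V)$ consists exactly of the endpoints of $Z$; 2. for each $Z\in\mathcal{Z}$, $T|_{Z\cap V}$ extends to a monotone (increasing or decreasing) homeomorphism of $Z$ onto some interval of $X$; 3. there is a function $g:X\to[0,\infty)$ of bounded variation with $g|_{X\setminus V}=0$ such that, for every $f\in L^1(\mu)$, $Pf(x)=\sum_{z\in T^{-1}(x)}g(z)f(z)$ for $\mu$-a.e. $x$; 4. $\sup_{x\in V}g(x)<1$. An *asymptotically periodic decomposition* of $(T,\mu)$ consists of integers $l\ge0$ and $r_1,\dots,r_l\ge1$, densities $g_{i,j}\in L^1(\mu)$ (that is, $g_{i,j}\ge0$ and $\int g_{i,j}\,d\mu=1$) and bounded linear functionals $\lambda_{i,j}$ on $L^1(\mu)$, $1\le i\le l$, $1\le j\le r_i$, such that the $g_{i,j}$ have mutually disjoint supports, $Pg_{i,j}=g_{i,j+1}$ for $1\le j<r_i$, $Pg_{i,r_i}=g_{i,1}$, and $$\lim_{n\to\infty}\Bigl\|P^n\Bigl(f-\sum_{i=1}^l\sum_{j=1}^{r_i}\lambda_{i,j}(f)g_{i,j}\Bigr)\Bigr\|_{L^1(\mu)}=0\qquad\text{for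 all }f\in L^1(\mu).$$ **Corollary.** Let $(T,\mu)$ be a piecewise uniformly expanding map and let $\nu$ be a $T$-invariant probability measure that is absolutely continuous with respect to $\mu$. Let $\mathcal{P}_T$ be the transfer operator of $T$ with respect to $\nu$, and let $\mathcal{I}$ be the $\sigma$-algebra of all $A\in\mathcal B$ with $T^{-1}(A)=A$. Let $h:X\to\mathbb{R}$ be of bounded variation with $E_\nu(h\mid\mathcal{I})=0$. Then $(T,\mu)$ has an asymptotically periodic decomposition, and for every such decomposition, with $r=\prod_{i=1}^l r_i$, $$\sum_{n=1}^\infty n^{-3/2}\Bigl\|\sum_{k=0}^{n-1}\mathcal{P}_T^{rk}h_r\Bigr\|_{L^2(\nu)}<\infty,\qquad\text{where } h_r=\frac1{\sqrt r}\sum_{k=0}^{r-1}h\circ T^k .$$ -/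

import Mathlib

open MeasureTheory Filter Topology

noncomputable section

/-- The transfer (Perron–Frobenius) operator of `T` with respect to `μ`: `transferOp T μ f` is the
Radon–Nikodym density with respect to `μ` of the image under `T` of the signed measure `f dμ`. -/
def transferOp {X : Type*} [MeasurableSpace X] (T : X → X) (μ : Measure X) (f : X → ℝ) : X → ℝ :=
  SignedMeasure.rnDeriv ((μ.withDensityᵥ f).map T) μ

theorem transferOp_integrable {X : Type*} [MeasurableSpace X] (T : X → X) (μ : Measure X)
    (f : X → ℝ) : Integrable (transferOp T μ f) μ :=
  SignedMeasure.integrable_rnDeriv _ _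

/-- The defining property: `∫_A P f dμ = ∫_{T⁻¹ A} f dμ` for all measurable `A`. -/
theorem setIntegral_transferOp {X : Type*} [MeasurableSpace X] {T : X → X} {μ : Measure X}
    [SigmaFinite μ] (hT : Measure.QuasiMeasurePreserving T μ μ) {f : X → ℝ}
    (hf : Integrable f μ) {A : Set X} (hA : MeasurableSet A) :
    ∫ x in A, transferOp T μ f x ∂μ = ∫ x in T ⁻¹' A, f x ∂μ := by
  have hac : (μ.withDensityᵥ f).map T ≪ᵥ μ.toENNRealVectorMeasure := by
    refine VectorMeasure.AbsolutelyContinuous.mk fun s hs h0 => ?_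
    rw [Measure.toENNRealVectorMeasure_apply_measurable hs] at h0
    rw [VectorMeasure.map_apply _ hT.measurable hs, withDensityᵥ_apply hf (hT.measurable hs)]
    exact setIntegral_measure_zero _ (hT.preimage_null h0)
  have h := SignedMeasure.withDensityᵥ_rnDeriv_eq _ μ hac
  rw [← withDensityᵥ_apply (transferOp_integrable T μ f) hA]
  unfold transferOp
  rw [h, VectorMeasure.map_apply _ hT.measurable hA, withDensityᵥ_apply hf (hT.measurable hA)]

/-- `(T, μ)` is a piecewise uniformly expanding map with domain `V`. The continuous map `V → X` is
represented by a measurable map `X → X`; its values outside the `μ`-null set `X \ V` are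
arbitrary. -/
structure IsPiecewiseUniformlyExpanding {X : Type*} [ConditionallyCompleteLinearOrder X]
    [TopologicalSpace X] [MeasurableSpace X] (T : X → X) (μ : Measure X) (V : Set X) : Prop where
  isOpen_domain : IsOpen V
  dense_domain : Dense V
  measure_domain : μ V = 1
  measurable : Measurable T
  continuousOn : ContinuousOn T V
  nonsingular : Measure.QuasiMeasurePreserving T μ μ
  /-- A countable family of closed intervals (closed order-convex sets) with disjoint interiors
  covers `V`; each interval misses `V` exactly in its endpoints, and on each of them `T` extends
  to a monotone homeomorphism onto some interval. -/
  exists_partition : ∃ 𝒵 : Set (Set X), 𝒵.Countable ∧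
    (∀ Z ∈ 𝒵, IsClosed Z ∧ Z.OrdConnected) ∧
    𝒵.PairwiseDisjoint interior ∧
    V ⊆ ⋃₀ 𝒵 ∧
    (∀ Z ∈ 𝒵, Z ∩ Vᶜ = {x | IsLeast Z x ∨ IsGreatest Z x}) ∧
    ∀ Z ∈ 𝒵, ∃ φ : X → X, Set.EqOn φ T (Z ∩ V) ∧ IsEmbedding (Z.domRestrict φ) ∧
      (φ '' Z).OrdConnected ∧ (MonotoneOn φ Z ∨ AntitoneOn φ Z)
  /-- The transfer operator has a weight of bounded variation that vanishes off `V` and whose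
  supremum over `V` is smaller than `1`. -/
  exists_weight : ∃ g : X → ℝ, (∀ x, 0 ≤ g x) ∧ BoundedVariationOn g Set.univ ∧
    (∀ x ∉ V, g x = 0) ∧
    (∀ f : X → ℝ, Integrable f μ →
      transferOp T μ f =ᵐ[μ] fun x => ∑' z : (T ⁻¹' {x} : Set X), g z * f z) ∧
    ∃ c : ℝ, c < 1 ∧ ∀ x ∈ V, g x ≤ c

/-- Asymptotic periodicity of `(T, μ)` with `l` cycles of lengths `r i`: densities `g i j` with
mutually disjoint supports, permuted cyclically by the transfer operator for each `i`, and bounded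
linear functionals `lam i j` on `L¹(μ)` such that `Pⁿ (f - ∑ lam i j (f) g i j) → 0` in `L¹(μ)`. -/
structure IsAsymptoticallyPeriodicWith {X : Type*} [MeasurableSpace X] (T : X → X) (μ : Measure X)
    {l : ℕ} (r : Fin l → ℕ) (g : (i : Fin l) → Fin (r i) → X → ℝ)
    (lam : (i : Fin l) → Fin (r i) → (Lp ℝ 1 μ →L[ℝ] ℝ)) : Prop where
  length_pos : ∀ i, 0 < r i
  integrable : ∀ i j, Integrable (g i j) μ
  nonneg : ∀ i j, 0 ≤ᵐ[μ] g i j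
  integral_eq_one : ∀ i j, ∫ x, g i j x ∂μ = 1
  disjoint_supports : ∀ p q : (Σ i, Fin (r i)), p ≠ q →
    (fun x => g p.1 p.2 x * g q.1 q.2 x) =ᵐ[μ] 0
  cyclic : ∀ i j, transferOp T μ (g i j) =ᵐ[μ] g i (finRotate (r i) j)
  tendsto : ∀ f : Lp ℝ 1 μ, Tendsto
    (fun n : ℕ => eLpNorm ((transferOp T μ)^[n]
      (fun x => f x - ∑ i, ∑ j, lam i j f * g i j x)) 1 μ) atTop (𝓝 0)

/-- `h_r = r^{-1/2} ∑_{k<r} h ∘ T^k`. -/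
def blockSum {X : Type*} (T : X → X) (h : X → ℝ) (r : ℕ) : X → ℝ :=
  fun x => (1 / Real.sqrt r) * ∑ k ∈ Finset.range r, h (T^[k] x)

/-- `∑_{n ≥ 1} n^{-3/2} ‖∑_{k<n} P_T^{rk} h_r‖₂ < ∞`, where `P_T` is the transfer operator on
`L¹(ν)`; the summation index below is `n - 1`. -/
def BlockSummability {X : Type*} [MeasurableSpace X] (T : X → X) (ν : Measure X) (h : X → ℝ)
    (r : ℕ) : Prop :=
  ∑' n : ℕ, ENNReal.ofReal (((n : ℝ) + 1) ^ (-(3 / 2) : ℝ)) *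
    eLpNorm (∑ k ∈ Finset.range (n + 1), (transferOp T ν)^[r * k] (blockSum T h r)) 2 ν < ⊤

end

/-!
Powers of the transfer operator `P` are again sums over inverse branches, with weights that become
uniformly small, and this gives the Lasota–Yorke inequality `var (Pⁿ f) ≤ ½ var f + K ‖f‖₁` for some
`n`. As `μ` has no atoms, balls of functions of bounded variation are totally bounded in `L¹(μ)`.
The recurrent vectors of the positive contraction `P` therefore form a finite-dimensional
sublattice; it is spanned by finitely many densities with disjoint supports, which `P` permutes, and
a vector of bounded variation whose orbit tends to `0` does so exponentially fast.

Multiplication by `dν/dμ` embeds `L¹(ν)` into `L¹(μ)` and intertwines `P` with the transfer operator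
`Q` of `T` with respect to `ν`. So `h = w + v` in `L¹(ν)` with `Qʳ w = w` and `Qⁿ v → 0`
exponentially fast. The vector `w + Q w + ⋯ + Qʳ⁻¹ w` is fixed by `Q` and has integral `0` over
every invariant set, because `h` and `v` have; hence it vanishes. As `√r Qʳ h_r = Q h + ⋯ + Qʳ h`,
the sequence `Qⁿ h_r` decays exponentially in `L¹(ν)`. Being uniformly bounded, it does so in
`L²(ν)` too, and the sums `∑ Qʳᵏ h_r` stay bounded in `L²(ν)`.
-/

open scoped ENNReal NNReal

noncomputable section

/-! ### Variation with vanishing ends -/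

section ZeroEndVar

open Set

variable {X Y E : Type*} [LinearOrder X] [LinearOrder Y]

theorem eVariationOn_le_of_edist_add_le [PseudoEMetricSpace E] {f : X → E} {s : Set X}
    {D : X → ℝ≥0∞} {M : ℝ≥0∞} (hM : ∀ x ∈ s, D x ≤ M)
    (h : ∀ x ∈ s, ∀ y ∈ s, x ≤ y → edist (f y) (f x) + D x ≤ D y) : eVariationOn f s ≤ M := by
  refine iSup_le fun ⟨n, w, hw, hws⟩ => ?_
  have sum_le (n : ℕ) : ∑ i ∈ Finset.range n, edist (f (w (i + 1))) (f (w i)) ≤ D (w n) := by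
    induction n with
    | zero => simp
    | succ n ih =>
      rw [Finset.sum_range_succ, add_comm]
      exact (add_le_add_right ih _).trans (h _ (hws _) _ (hws _) (hw n.le_succ))
  exact (sum_le n).trans (hM _ (hws n))

theorem edist_add_eVariationOn_Iic_le [PseudoEMetricSpace E] (f : X → E) {x y : X} (hxy : x ≤ y) :
    edist (f y) (f x) + eVariationOn f (Iic x) ≤ eVariationOn f (Iic y) := by
  rw [← Iic_union_Icc_eq_Iic hxy, eVariationOn.union f isGreatest_Iic (isLeast_Icc hxy), add_comm]
  gcongr
  exact eVariationOn.edist_le f (right_mem_Icc.2 hxy) (left_mem_Icc.2 hxy)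

theorem eVariationOn_univ_eq_Iic_add_Icc_add_Ici [PseudoEMetricSpace E] (f : X → E) {a b : X}
    (hab : a ≤ b) :
    eVariationOn f univ = eVariationOn f (Iic a) + eVariationOn f (Icc a b)
      + eVariationOn f (Ici b) := by
  rw [← eVariationOn.union f isGreatest_Iic (isLeast_Icc hab), Iic_union_Icc_eq_Iic hab,
    ← eVariationOn.union f isGreatest_Iic isLeast_Ici, Iic_union_Ici]

theorem sum_eVariationOn_fiber_le [PseudoEMetricSpace E] {ι : Type*} [LinearOrder ι] {N : X → ι}
    (hN : Monotone N) (f : X → E) (s : Finset ι) :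
    ∑ k ∈ s, eVariationOn f (N ⁻¹' {k}) ≤ eVariationOn f (N ⁻¹' s) := by
  induction s using Finset.induction_on_max with
  | empty => simp
  | insert k s hk ih =>
    rw [Finset.sum_insert fun h => (hk k h).false, Finset.coe_insert, insert_eq, union_comm,
      preimage_union, add_comm]
    refine (add_le_add_left ih _).trans (eVariationOn.add_le_union f fun x hx y hy => ?_)
    exact (hN.reflect_lt (by simpa [mem_singleton_iff.1 hy] using hk _ hx)).le

theorem sum_eVariationOn_fiber_le_univ [PseudoEMetricSpace E] {ι : Type*} [LinearOrder ι]
    [Fintype ι] {N : X → ι} (hN : Monotone N) (f : X → E) :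
    ∑ k, eVariationOn f (N ⁻¹' {k}) ≤ eVariationOn f univ :=
  (sum_eVariationOn_fiber_le hN f Finset.univ).trans (eVariationOn.mono f (subset_univ _))

section NormedGroup

variable [NormedAddCommGroup E]

/-- The extension of `u` by `0` to the order with a bottom and a top element adjoined. -/
def zeroExt (u : X → E) : WithBotTop X → E := WithBotTop.rec 0 u 0

omit [LinearOrder X] in
@[simp] theorem zeroExt_bot (u : X → E) : zeroExt u ⊥ = 0 := rfl

omit [LinearOrder X] in
@[simp] theorem zeroExt_top (u : X → E) : zeroExt u ⊤ = 0 := rfl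

omit [LinearOrder X] in
@[simp] theorem zeroExt_coe (u : X → E) (x : X) : zeroExt u x = u x := rfl

/-- The variation of `u` including the jumps from `0` and to `0` at the two ends of `X`. In contrast
to `eVariationOn u univ` it bounds the supremum of `u`, and it does not increase when `u` is
restricted to an order-convex set and extended by `0`. -/
def zeroEndVar (u : X → E) : ℝ≥0∞ := eVariationOn (zeroExt u) univ

theorem enorm_le_zeroEndVar (u : X → E) (x : X) : ‖u x‖ₑ ≤ zeroEndVar u := by
  simpa [zeroEndVar] using
    eVariationOn.edist_le (zeroExt u) (mem_univ (x : WithBotTop X)) (mem_univ ⊥)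

theorem eVariationOn_univ_le_zeroEndVar (u : X → E) : eVariationOn u univ ≤ zeroEndVar u :=
  eVariationOn.comp_le_of_monotoneOn (zeroExt u) WithBotTop.coe
    (WithBotTop.coe_monotone.monotoneOn _) (mapsTo_univ _ _)

theorem zeroEndVar_comp_le_of_monotone (u : X → E) {φ : Y → X} (hφ : Monotone φ) :
    zeroEndVar (u ∘ φ) ≤ zeroEndVar u := by
  have ext_comp : zeroExt (u ∘ φ) = zeroExt u ∘ WithBot.map (WithTop.map φ) := by
    funext y
    induction y using WithBotTop.rec <;> rfl
  rw [zeroEndVar, ext_comp]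
  exact eVariationOn.comp_le_of_monotoneOn _ _ (hφ.withTop_map.withBot_map.monotoneOn _)
    (mapsTo_univ _ _)

theorem zeroEndVar_comp_le_of_antitone (u : X → E) {φ : Y → X} (hφ : Antitone φ) :
    zeroEndVar (u ∘ φ) ≤ zeroEndVar u := by
  let ψ : WithBotTop Y → WithBotTop X := WithBotTop.rec ⊤ (fun y => (φ y : WithBotTop X)) ⊥
  have ext_comp : zeroExt (u ∘ φ) = zeroExt u ∘ ψ := by
    funext y
    induction y using WithBotTop.rec <;> rfl
  have hψ : Antitone ψ := by
    intro y z hyz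
    induction y using WithBotTop.rec <;> induction z using WithBotTop.rec <;> simp_all [ψ, hφ _]
  rw [zeroEndVar, ext_comp]
  exact eVariationOn.comp_le_of_antitoneOn _ _ (hψ.antitoneOn _) (mapsTo_univ _ _)

theorem zeroEndVar_indicator_le_domRestrict {J : Set X} (hJ : J.OrdConnected) (u : X → E) :
    zeroEndVar (J.indicator u) ≤ zeroEndVar (J.domRestrict u) := by
  classical
  -- Collapse the points below `J` to `⊥` and the points above `J` to `⊤`.
  let ψ : WithBotTop X → WithBotTop J := WithBotTop.rec ⊥
    (fun x => if hx : x ∈ J then ((⟨x, hx⟩ : J) : WithBotTop J)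
      else if ∃ j ∈ J, x < j then ⊥ else ⊤) ⊤
  have ext_comp : zeroExt (J.indicator u) = zeroExt (J.domRestrict u) ∘ ψ := by
    funext x
    induction x using WithBotTop.rec with
    | bot => rfl
    | top => rfl
    | coe x =>
      by_cases hx : x ∈ J
      · simp [ψ, hx, Set.domRestrict_apply]
      · by_cases hlt : ∃ j ∈ J, x < j <;> simp [ψ, hx, hlt]
  have hψ : Monotone ψ := by
    intro x y hxy
    induction x using WithBotTop.rec with
    | bot => exact bot_le
    | top => rw [top_le_iff.1 hxy]
    | coe x =>
      induction y using WithBotTop.rec with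
      | bot => simp at hxy
      | top => exact le_top
      | coe y =>
        have hxy : x ≤ y := by simpa using hxy
        simp only [ψ, WithBotTop.rec_coe]
        by_cases hx : x ∈ J <;> by_cases hy : y ∈ J
        · simpa [hx, hy] using hxy
        · have not_below : ¬∃ j ∈ J, y < j := fun ⟨j, hj, hyj⟩ =>
            hy (hJ.out hx hj ⟨hxy, hyj.le⟩)
          simp [hx, hy, not_below]
        · have below : ∃ j ∈ J, x < j := ⟨y, hy, hxy.lt_of_ne fun h => hx (h ▸ hy)⟩
          simp [hx, below]
        · by_cases below : ∃ j ∈ J, y < j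
          · obtain ⟨j, hj, hyj⟩ := below
            have below_x : ∃ j ∈ J, x < j := ⟨j, hj, hxy.trans_lt hyj⟩
            simp [hx, below_x]
          · simp [hy, below]
  rw [zeroEndVar, ext_comp]
  exact eVariationOn.comp_le_of_monotoneOn _ _ (hψ.monotoneOn _) (mapsTo_univ _ _)

theorem zeroEndVar_indicator_comp_le (u : X → E) {J : Set Y} (hJ : J.OrdConnected) {φ : Y → X}
    (hφ : MonotoneOn φ J ∨ AntitoneOn φ J) :
    zeroEndVar (J.indicator (u ∘ φ)) ≤ zeroEndVar u := by
  refine (zeroEndVar_indicator_le_domRestrict hJ _).trans ?_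
  rcases hφ with hφ | hφ
  · exact zeroEndVar_comp_le_of_monotone u (monotoneOn_iff_monotone.1 hφ)
  · exact zeroEndVar_comp_le_of_antitone u (antitoneOn_iff_antitone.1 hφ)

theorem zeroEndVar_indicator_le (u : X → E) {J : Set X} (hJ : J.OrdConnected) :
    zeroEndVar (J.indicator u) ≤ zeroEndVar u :=
  zeroEndVar_indicator_comp_le (φ := id) u hJ (Or.inl monotoneOn_id)

theorem zeroEndVar_le_eVariationOn_univ (f : X → E) (p : X) :
    zeroEndVar f ≤ 3 * eVariationOn f univ + 2 * ‖f p‖ₑ := by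
  set v := eVariationOn f univ
  have enorm_le (x : X) : ‖f x‖ₑ ≤ ‖f p‖ₑ + v := by
    calc ‖f x‖ₑ = ‖f p + (f x - f p)‖ₑ := by rw [add_sub_cancel]
      _ ≤ ‖f p‖ₑ + edist (f x) (f p) := by rw [edist_eq_enorm_sub]; exact enorm_add_le _ _
      _ ≤ ‖f p‖ₑ + v := by gcongr; exact eVariationOn.edist_le f (mem_univ x) (mem_univ p)
  have Iic_le (x : X) : eVariationOn f (Iic x) ≤ v := eVariationOn.mono f (subset_univ _)
  have total : 3 * v + 2 * ‖f p‖ₑ = (‖f p‖ₑ + v) + (‖f p‖ₑ + v) + v := by ring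
  rw [total]
  refine eVariationOn_le_of_edist_add_le
    (D := WithBotTop.rec 0 (fun x => ‖f p‖ₑ + v + eVariationOn f (Iic x))
      (‖f p‖ₑ + v + (‖f p‖ₑ + v) + v)) (fun x _ => ?_) fun x _ y _ hxy => ?_
  · induction x using WithBotTop.rec with
    | bot => exact zero_le
    | coe x => exact add_le_add le_self_add (Iic_le x)
    | top => exact le_rfl
  · induction x using WithBotTop.rec <;> induction y using WithBotTop.rec <;>
      simp only [zeroExt_bot, zeroExt_coe, zeroExt_top, edist_self, edist_zero_left,
        edist_zero_right, WithBotTop.rec_bot, WithBotTop.rec_coe, WithBotTop.rec_top, add_zero,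
        zero_add, zero_le, le_refl, WithBotTop.coe_le_coe, le_bot_iff, top_le_iff,
        WithBotTop.coe_ne_bot, WithBotTop.coe_ne_top, WithBotTop.top_ne_bot] at hxy ⊢
    · exact (enorm_le _).trans le_self_add
    · rw [add_left_comm]
      gcongr
      exact edist_add_eVariationOn_Iic_le f hxy
    · rw [← add_assoc]
      gcongr
      exacts [enorm_le _, Iic_le _]

theorem zeroEndVar_zero : zeroEndVar (0 : X → E) = 0 := by
  refine eVariationOn.constant_on (subsingleton_of_forall_eq 0 ?_)
  rintro _ ⟨x, -, rfl⟩
  induction x using WithBotTop.rec <;> rfl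

theorem zeroEndVar_indicator_le_eVariationOn (f : X → E) {J : Set X} (hJ : J.OrdConnected) {p : X}
    (hp : p ∈ J) : zeroEndVar (J.indicator f) ≤ 3 * eVariationOn f J + 2 * ‖f p‖ₑ := by
  have var_eq : eVariationOn (J.domRestrict f) univ = eVariationOn f J := by
    rw [domRestrict_eq, eVariationOn.comp_eq_of_monotoneOn f _ (Subtype.mono_coe _ |>.monotoneOn _),
      image_univ, Subtype.range_coe]
  rw [← var_eq]
  exact (zeroEndVar_indicator_le_domRestrict hJ f).trans
    (zeroEndVar_le_eVariationOn_univ (J.domRestrict f) ⟨p, hp⟩)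

theorem zeroEndVar_lt_top_iff {f : X → E} :
    zeroEndVar f < ⊤ ↔ BoundedVariationOn f univ := by
  refine ⟨fun hf => ((eVariationOn_univ_le_zeroEndVar f).trans_lt hf).ne, fun hf => ?_⟩
  rcases isEmpty_or_nonempty X with hX | ⟨⟨p⟩⟩
  · simp [Subsingleton.elim f 0, zeroEndVar_zero]
  · refine (zeroEndVar_le_eVariationOn_univ f p).trans_lt ?_
    exact ENNReal.add_lt_top.2 ⟨ENNReal.mul_lt_top (by simp) (lt_top_iff_ne_top.2 hf),
      ENNReal.mul_lt_top (by simp) enorm_lt_top⟩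

theorem zeroEndVar_le_tsum {ι : Type*} {u : X → E} {v : ι → X → E}
    (h : ∀ x, HasSum (fun i => v i x) (u x)) : zeroEndVar u ≤ ∑' i, zeroEndVar (v i) := by
  have hasSum_zeroExt (x : WithBotTop X) : HasSum (fun i => zeroExt (v i) x) (zeroExt u x) := by
    induction x using WithBotTop.rec with
    | bot => exact hasSum_zero
    | coe x => exact h x
    | top => exact hasSum_zero
  have edist_le_tsum (x y : WithBotTop X) :
      edist (zeroExt u x) (zeroExt u y) ≤ ∑' i, edist (zeroExt (v i) x) (zeroExt (v i) y) := by
    simp only [edist_eq_enorm_sub, ← ((hasSum_zeroExt x).sub (hasSum_zeroExt y)).tsum_eq]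
    exact enorm_tsum_le_tsum_enorm
  refine iSup_le fun ⟨n, w, hw, hws⟩ => ?_
  refine (Finset.sum_le_sum fun i _ => edist_le_tsum (w (i + 1)) (w i)).trans ?_
  rw [← Summable.tsum_finsetSum fun _ _ => ENNReal.summable]
  exact ENNReal.tsum_le_tsum fun j => eVariationOn.sum_le hw hws

theorem zeroEndVar_sum_le {ι : Type*} [Fintype ι] (v : ι → X → E) :
    zeroEndVar (∑ i, v i) ≤ ∑ i, zeroEndVar (v i) := by
  have hasSum (x : X) : HasSum (fun i => v i x) ((∑ i, v i) x) := by
    simpa using hasSum_fintype fun i => v i x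
  exact (zeroEndVar_le_tsum hasSum).trans_eq (tsum_fintype _)

theorem zeroEndVar_add_le (u v : X → E) : zeroEndVar (u + v) ≤ zeroEndVar u + zeroEndVar v := by
  simpa [Fin.sum_univ_two] using zeroEndVar_sum_le ![u, v]

section CutOut

variable {u : X → E} {a b : WithBotTop X}

omit [LinearOrder X] in
theorem zeroExt_indicator_preimage_coe (u : X → E) (s : Set (WithBotTop X)) :
    zeroExt ((WithBotTop.coe ⁻¹' s).indicator u) = s.indicator (zeroExt u) := by
  classical
  funext x
  induction x using WithBotTop.rec <;> simp [indicator_apply]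

theorem zeroEndVar_indicator_Ioo (hab : a ≤ b) (ha : zeroExt u a = 0) (hb : zeroExt u b = 0) :
    zeroEndVar ((WithBotTop.coe ⁻¹' Ioo a b).indicator u)
      = eVariationOn (zeroExt u) (Icc a b) := by
  have eqOn : EqOn ((Ioo a b).indicator (zeroExt u)) (zeroExt u) (Icc a b) := by
    intro x hx
    rcases eq_endpoints_or_mem_Ioo_of_mem_Icc hx with rfl | rfl | h <;> simp_all
  have eqOn_Iic : EqOn ((Ioo a b).indicator (zeroExt u)) 0 (Iic a) := fun x hx =>
    indicator_of_notMem (fun h => h.1.not_ge hx) _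
  have eqOn_Ici : EqOn ((Ioo a b).indicator (zeroExt u)) 0 (Ici b) := fun x hx =>
    indicator_of_notMem (fun h => h.2.not_ge hx) _
  have zero_var (s : Set (WithBotTop X)) : eVariationOn (0 : WithBotTop X → E) s = 0 :=
    eVariationOn.constant_on (subsingleton_of_forall_eq 0 (by rintro _ ⟨x, -, rfl⟩; rfl))
  rw [zeroEndVar, zeroExt_indicator_preimage_coe, eVariationOn_univ_eq_Iic_add_Icc_add_Ici _ hab,
    eVariationOn.congr eqOn, eVariationOn.congr eqOn_Iic, eVariationOn.congr eqOn_Ici, zero_var,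
    zero_var, zero_add, add_zero]

theorem zeroEndVar_indicator_compl_Ioo (hab : a ≤ b) (ha : zeroExt u a = 0)
    (hb : zeroExt u b = 0) :
    zeroEndVar ((WithBotTop.coe ⁻¹' Ioo a b)ᶜ.indicator u)
      = eVariationOn (zeroExt u) (Iic a) + eVariationOn (zeroExt u) (Ici b) := by
  have eqOn : EqOn ((Ioo a b)ᶜ.indicator (zeroExt u)) 0 (Icc a b) := by
    intro x hx
    rcases eq_endpoints_or_mem_Ioo_of_mem_Icc hx with rfl | rfl | h <;> simp_all
  have eqOn_Iic : EqOn ((Ioo a b)ᶜ.indicator (zeroExt u)) (zeroExt u) (Iic a) := fun x hx =>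
    indicator_of_mem (fun h => h.1.not_ge hx) _
  have eqOn_Ici : EqOn ((Ioo a b)ᶜ.indicator (zeroExt u)) (zeroExt u) (Ici b) := fun x hx =>
    indicator_of_mem (fun h => h.2.not_ge hx) _
  have zero_var : eVariationOn (0 : WithBotTop X → E) (Icc a b) = 0 :=
    eVariationOn.constant_on (subsingleton_of_forall_eq 0 (by rintro _ ⟨x, -, rfl⟩; rfl))
  rw [zeroEndVar, ← preimage_compl, zeroExt_indicator_preimage_coe,
    eVariationOn_univ_eq_Iic_add_Icc_add_Ici _ hab,
    eVariationOn.congr eqOn, eVariationOn.congr eqOn_Iic, eVariationOn.congr eqOn_Ici, zero_var,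
    add_zero]

theorem zeroEndVar_indicator_Ioo_add_compl (hab : a ≤ b) (ha : zeroExt u a = 0)
    (hb : zeroExt u b = 0) :
    zeroEndVar ((WithBotTop.coe ⁻¹' Ioo a b).indicator u)
      + zeroEndVar ((WithBotTop.coe ⁻¹' Ioo a b)ᶜ.indicator u) = zeroEndVar u := by
  rw [zeroEndVar_indicator_Ioo hab ha hb, zeroEndVar_indicator_compl_Ioo hab ha hb, zeroEndVar,
    eVariationOn_univ_eq_Iic_add_Icc_add_Ici (zeroExt u) hab]
  ring

end CutOut

end NormedGroup

section Real

theorem zeroEndVar_mul_le {u v : X → ℝ} {a b : ℝ≥0∞} (ha : ∀ x, ‖u x‖ₑ ≤ a)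
    (hb : ∀ x, ‖v x‖ₑ ≤ b) :
    zeroEndVar (u * v) ≤ a * zeroEndVar v + b * zeroEndVar u := by
  have enorm_zeroExt_le {w : X → ℝ} {c : ℝ≥0∞} (hc : ∀ x, ‖w x‖ₑ ≤ c) (x : WithBotTop X) :
      ‖zeroExt w x‖ₑ ≤ c := by
    induction x using WithBotTop.rec <;> simp [hc]
  have zeroExt_mul : zeroExt (u * v) = zeroExt u * zeroExt v := by
    funext x
    induction x using WithBotTop.rec <;> simp
  rw [zeroEndVar, zeroExt_mul]
  exact eVariation_mul_le (fun x _ => enorm_zeroExt_le ha x) fun x _ => enorm_zeroExt_le hb x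

theorem zeroEndVar_mul_lt_top {u v : X → ℝ} (hu : zeroEndVar u < ⊤) (hv : zeroEndVar v < ⊤) :
    zeroEndVar (u * v) < ⊤ :=
  (zeroEndVar_mul_le (enorm_le_zeroEndVar u) (enorm_le_zeroEndVar v)).trans_lt
    (ENNReal.add_lt_top.2 ⟨ENNReal.mul_lt_top hu hv, ENNReal.mul_lt_top hv hu⟩)

theorem zeroEndVar_const_lt_top (c : ℝ) : zeroEndVar (fun _ : X => c) < ⊤ :=
  zeroEndVar_lt_top_iff.2 (ne_of_eq_of_ne
    (eVariationOn.constant_on (subsingleton_of_forall_eq c (by simp))) ENNReal.zero_ne_top)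

theorem zeroEndVar_const_smul_le (c : ℝ) (u : X → ℝ) :
    zeroEndVar (c • u) ≤ ‖c‖ₑ * zeroEndVar u := by
  have zeroExt_smul : zeroExt (c • u) = (fun _ => c) * zeroExt u := by
    funext x
    induction x using WithBotTop.rec <;> simp
  have const_var : eVariationOn (fun _ : WithBotTop X => c) univ = 0 :=
    eVariationOn.constant_on (subsingleton_of_forall_eq c (by simp))
  rw [zeroEndVar, zeroExt_smul]
  refine (eVariation_mul_le (fun _ _ => le_rfl) fun _ _ => le_top).trans ?_
  rw [const_var, mul_zero, add_zero, zeroEndVar]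

variable {u : X → ℝ}

theorem exists_monotone_eVariationOn_fiber_le (hu : BoundedVariationOn u univ) {ε : ℝ}
    (hε : 0 < ε) :
    ∃ K, ∃ N : X → Fin K, Monotone N ∧ ∀ k, eVariationOn u (N ⁻¹' {k}) ≤ ENNReal.ofReal ε := by
  let m (x : X) : ℝ := (eVariationOn u (Iic x)).toReal
  have finite (x : X) : eVariationOn u (Iic x) ≠ ⊤ := (hu.mono (subset_univ _) :)
  have edist_le {x y : X} (hxy : x ≤ y) : edist (u y) (u x) ≤ ENNReal.ofReal (m y - m x) := by
    rw [ENNReal.ofReal_sub _ ENNReal.toReal_nonneg, ENNReal.ofReal_toReal (finite _),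
      ENNReal.ofReal_toReal (finite _)]
    exact ENNReal.le_sub_of_add_le_right (finite _) (edist_add_eVariationOn_Iic_le u hxy)
  have m_mono : Monotone m := fun x y hxy =>
    ENNReal.toReal_mono (finite y) (eVariationOn.mono u (Iic_subset_Iic.2 hxy))
  have m_le (x : X) : m x ≤ (eVariationOn u univ).toReal :=
    ENNReal.toReal_mono hu (eVariationOn.mono u (subset_univ _))
  have floor_lt (x : X) : ⌊m x / ε⌋₊ < ⌊(eVariationOn u univ).toReal / ε⌋₊ + 1 :=
    Nat.lt_succ_of_le (Nat.floor_mono (div_le_div_of_nonneg_right (m_le x) hε.le))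
  refine ⟨_, fun x => ⟨⌊m x / ε⌋₊, floor_lt x⟩, fun x y hxy =>
    Nat.floor_mono (div_le_div_of_nonneg_right (m_mono hxy) hε.le), fun k => ?_⟩
  have bounds {x : X} (hx : ⌊m x / ε⌋₊ = k) : k * ε ≤ m x ∧ m x < (k + 1) * ε := by
    rw [← le_div_iff₀ hε, ← div_lt_iff₀ hε, ← hx]
    exact ⟨Nat.floor_le (div_nonneg ENNReal.toReal_nonneg hε.le), Nat.lt_floor_add_one _⟩
  refine eVariationOn_le_of_edist_add_le (D := fun x => ENNReal.ofReal (m x - k * ε))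
    (fun x hx => ENNReal.ofReal_le_ofReal ?_) fun x hx y _ hxy => ?_
  · linarith [(bounds (Fin.ext_iff.1 hx)).2]
  · refine (add_le_add_left (edist_le hxy) _).trans ?_
    rw [← ENNReal.ofReal_add (sub_nonneg.2 (m_mono hxy))
      (sub_nonneg.2 (bounds (Fin.ext_iff.1 hx)).1), sub_add_sub_cancel]

theorem abs_le_toReal_zeroEndVar (hu : zeroEndVar u < ⊤) (x : X) : |u x| ≤ (zeroEndVar u).toReal :=
  (toReal_enorm (u x)).symm.trans_le (ENNReal.toReal_mono hu.ne (enorm_le_zeroEndVar u x))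

variable [TopologicalSpace X] [OrderTopology X] [MeasurableSpace X] [BorelSpace X]

theorem measurable_of_zeroEndVar_lt_top (hu : zeroEndVar u < ⊤) : Measurable u := by
  obtain ⟨p, q, hp, hq, rfl⟩ := (zeroEndVar_lt_top_iff.1
    hu).locallyBoundedVariationOn.exists_monotoneOn_sub_monotoneOn
  exact (monotoneOn_univ.1 hp).measurable.sub (monotoneOn_univ.1 hq).measurable

theorem integrable_of_zeroEndVar_lt_top (hu : zeroEndVar u < ⊤) (μ : Measure X)
    [IsFiniteMeasure μ] : Integrable u μ :=
  Integrable.of_bound (measurable_of_zeroEndVar_lt_top hu).aestronglyMeasurable _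
    (Eventually.of_forall (abs_le_toReal_zeroEndVar hu))

end Real

end ZeroEndVar

/-! ### Branches of a piecewise monotone map -/

section Branches

open Set Function

/-- The branches of a piecewise monotone map `T` with domain `V`: the sets `I i` partition `V`, and
`T` is injective and monotone on each of them with an order-convex image. Each branch is an open
interval whose ends, possibly infinite, are not in `V`. -/
structure IsBranchSystem {X ι : Type*} [LinearOrder X] (T : X → X) (V : Set X) (I : ι → Set X) :
    Prop where
  disjoint : Pairwise fun i j => Disjoint (I i) (I j)
  exists_mem : ∀ x ∈ V, ∃ i, x ∈ I i
  injOn : ∀ i, InjOn T (I i)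
  monotoneOn_or_antitoneOn : ∀ i, MonotoneOn T (I i) ∨ AntitoneOn T (I i)
  ordConnected_image : ∀ i, (T '' I i).OrdConnected
  exists_eq_Ioo : ∀ i, ∃ a b : WithBotTop X, a ≤ b ∧ I i = WithBotTop.coe ⁻¹' Ioo a b ∧
    a ∉ WithBotTop.coe '' V ∧ b ∉ WithBotTop.coe '' V

variable {X ι : Type*} {T : X → X} {V : Set X} {I : ι → Set X}

/-- The sum of `u` over the fibres of `T`, written branch by branch. -/
def branchSum [Nonempty X] (T : X → X) (I : ι → Set X) (u : X → ℝ) (y : X) : ℝ :=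
  ∑' i, (T '' I i).indicator (u ∘ invFunOn T (I i)) y

/-- The weight `g · (g ∘ T) ⋯ (g ∘ T^(n-1))` of the `n`-th power of the weighted operator
`u ↦ branchSum T I (g * u)`. -/
def iterWeight (T : X → X) (g : X → ℝ) : ℕ → X → ℝ
  | 0 => 1
  | n + 1 => g * (iterWeight T g n ∘ T)

theorem abs_iterWeight_le {g : X → ℝ} {c : ℝ} (hc : ∀ x, |g x| ≤ c) (n : ℕ) (x : X) :
    |iterWeight T g n x| ≤ c ^ n := by
  induction n generalizing x with
  | zero => simp [iterWeight]
  | succ n ih =>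
    rw [iterWeight, Pi.mul_apply, abs_mul, pow_succ']
    exact mul_le_mul (hc x) (ih (T x)) (abs_nonneg _) ((abs_nonneg _).trans (hc x))

theorem mul_branchSum [Nonempty X] (T : X → X) (I : ι → Set X) (w u : X → ℝ) :
    w * branchSum T I u = branchSum T I ((w ∘ T) * u) := by
  funext y
  rw [Pi.mul_apply, branchSum, branchSum, ← tsum_mul_left]
  refine tsum_congr fun i => ?_
  by_cases hy : y ∈ T '' I i
  · simp [indicator_of_mem hy, invFunOn_eq hy]
  · simp [indicator_of_notMem hy]

theorem branchSum_iterate_succ [Nonempty X] (T : X → X) (I : ι → Set X) (g u : X → ℝ) (n : ℕ) :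
    (branchSum T I)^[n + 1] (iterWeight T g (n + 1) * u)
      = (branchSum T I)^[n] (iterWeight T g n * branchSum T I (g * u)) := by
  rw [iterate_succ_apply, mul_branchSum, iterWeight, ← mul_assoc, mul_comm (_ ∘ T) g]

theorem zeroExt_eq_zero {u : X → ℝ} (hu : ∀ x ∉ V, u x = 0) {a : WithBotTop X}
    (ha : a ∉ WithBotTop.coe '' V) : zeroExt u a = 0 := by
  induction a using WithBotTop.rec with
  | bot => rfl
  | coe x => exact hu x fun hx => ha ⟨x, hx, rfl⟩
  | top => rfl

variable [LinearOrder X]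

namespace IsBranchSystem

theorem ordConnected (hI : IsBranchSystem T V I) (i : ι) : (I i).OrdConnected := by
  obtain ⟨a, b, -, hi, -⟩ := hI.exists_eq_Ioo i
  exact hi ▸ ordConnected_Ioo.preimage_mono WithBotTop.coe_monotone

theorem tsum_zeroEndVar_indicator_le (hI : IsBranchSystem T V I) {u : X → ℝ}
    (hu : ∀ x ∉ V, u x = 0) : ∑' i, zeroEndVar ((I i).indicator u) ≤ zeroEndVar u := by
  classical
  rw [ENNReal.tsum_eq_iSup_sum]
  refine iSup_le fun F => ?_
  induction F using Finset.induction_on generalizing u with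
  | empty => simp
  | insert i F hi ih =>
    obtain ⟨a, b, hab, hIi, ha, hb⟩ := hI.exists_eq_Ioo i
    have split := zeroEndVar_indicator_Ioo_add_compl hab (zeroExt_eq_zero hu ha)
      (zeroExt_eq_zero hu hb)
    rw [← hIi] at split
    have restrict_compl {j : ι} (hj : j ∈ F) :
        (I j).indicator ((I i)ᶜ.indicator u) = (I j).indicator u := by
      have hji : j ≠ i := fun h => hi (h ▸ hj)
      rw [indicator_indicator, inter_eq_left.2]
      exact subset_compl_iff_disjoint_right.2 (hI.disjoint hji)
    have sum_le := ih (u := (I i)ᶜ.indicator u) fun x hx => by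
      rw [indicator_apply, hu x hx, ite_self]
    rw [Finset.sum_congr rfl fun j hj => by rw [restrict_compl hj]] at sum_le
    rw [Finset.sum_insert hi, ← split]
    gcongr

theorem hasSum_indicator (hI : IsBranchSystem T V I) {u : X → ℝ} (hu : ∀ x ∉ V, u x = 0) (x : X) :
    HasSum (fun i => (I i).indicator u x) (u x) := by
  classical
  by_cases hx : x ∈ V
  · obtain ⟨i, hi⟩ := hI.exists_mem x hx
    simpa only [indicator_of_mem hi] using hasSum_single (f := fun i => (I i).indicator u x) i
      fun j hj => indicator_of_notMem (disjoint_right.1 (hI.disjoint hj) hi) _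
  · simp only [indicator_apply, hu x hx, ite_self, hasSum_zero]

theorem zeroEndVar_mul_comp_lt_top (hI : IsBranchSystem T V I) {g w : X → ℝ}
    (hg : ∀ x ∉ V, g x = 0) (hgv : zeroEndVar g < ⊤) (hw : zeroEndVar w < ⊤) :
    zeroEndVar (g * (w ∘ T)) < ⊤ := by
  have branch_le (i : ι) : zeroEndVar ((I i).indicator (g * (w ∘ T)))
      ≤ 2 * zeroEndVar w * zeroEndVar ((I i).indicator g) := by
    have comp_le : zeroEndVar ((I i).indicator (w ∘ T)) ≤ zeroEndVar w :=
      zeroEndVar_indicator_comp_le w (hI.ordConnected i) (hI.monotoneOn_or_antitoneOn i)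
    rw [show (I i).indicator (g * (w ∘ T)) = (I i).indicator g * (I i).indicator (w ∘ T) from
      indicator_mul _ _ _]
    calc _ ≤ zeroEndVar ((I i).indicator g) * zeroEndVar ((I i).indicator (w ∘ T))
          + zeroEndVar ((I i).indicator (w ∘ T)) * zeroEndVar ((I i).indicator g) :=
          zeroEndVar_mul_le (enorm_le_zeroEndVar _) (enorm_le_zeroEndVar _)
      _ = 2 * zeroEndVar ((I i).indicator (w ∘ T)) * zeroEndVar ((I i).indicator g) := by ring
      _ ≤ _ := by gcongr
  calc zeroEndVar (g * (w ∘ T)) ≤ ∑' i, zeroEndVar ((I i).indicator (g * (w ∘ T))) :=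
        zeroEndVar_le_tsum (hI.hasSum_indicator fun x hx => by simp [hg x hx])
    _ ≤ ∑' i, 2 * zeroEndVar w * zeroEndVar ((I i).indicator g) := ENNReal.tsum_le_tsum branch_le
    _ = 2 * zeroEndVar w * ∑' i, zeroEndVar ((I i).indicator g) := ENNReal.tsum_mul_left
    _ ≤ 2 * zeroEndVar w * zeroEndVar g := by gcongr; exact hI.tsum_zeroEndVar_indicator_le hg
    _ < ⊤ := ENNReal.mul_lt_top (ENNReal.mul_lt_top (by simp) hw) hgv

theorem zeroEndVar_iterWeight_lt_top (hI : IsBranchSystem T V I) {g : X → ℝ}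
    (hg : ∀ x ∉ V, g x = 0) (hgv : zeroEndVar g < ⊤) (n : ℕ) :
    zeroEndVar (iterWeight T g n) < ⊤ := by
  induction n with
  | zero => exact zeroEndVar_const_lt_top 1
  | succ n ih => exact hI.zeroEndVar_mul_comp_lt_top hg hgv ih

variable [Nonempty X]

theorem tsum_fiber (hI : IsBranchSystem T V I) {u : X → ℝ} (hu : ∀ x ∉ V, u x = 0) (y : X) :
    ∑' z : (T ⁻¹' {y} : Set X), u z = branchSum T I u y := by
  have mem_image (i : support fun i => (T '' I i).indicator (u ∘ invFunOn T (I i)) y) :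
      y ∈ T '' I i := mem_of_indicator_ne_zero i.2
  refine tsum_eq_tsum_of_ne_zero_bij
    (fun i => ⟨invFunOn T (I i) y, invFunOn_eq (mem_image i)⟩) ?_ ?_ fun i => ?_
  · intro i j hij
    have inv_eq : invFunOn T (I i) y = invFunOn T (I j) y := congrArg Subtype.val hij
    by_contra hne
    refine disjoint_left.1 (hI.disjoint fun h => hne (Subtype.ext h))
      (invFunOn_mem (mem_image i)) ?_
    rw [inv_eq]
    exact invFunOn_mem (mem_image j)
  · rintro ⟨z, rfl : T z = y⟩ hne
    obtain ⟨i, hi⟩ := hI.exists_mem z (not_imp_comm.1 (hu z) hne)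
    have hy : T z ∈ T '' I i := mem_image_of_mem T hi
    have inv_eq : invFunOn T (I i) (T z) = z :=
      hI.injOn i (invFunOn_mem hy) hi (invFunOn_eq hy)
    refine ⟨⟨i, ?_⟩, Subtype.ext inv_eq⟩
    rwa [mem_support, indicator_of_mem hy, comp_apply, inv_eq]
  · rw [indicator_of_mem (mem_image i), comp_apply]

theorem monotoneOn_or_antitoneOn_invFunOn (hI : IsBranchSystem T V I) (i : ι) :
    MonotoneOn (invFunOn T (I i)) (T '' I i) ∨ AntitoneOn (invFunOn T (I i)) (T '' I i) := by
  refine (hI.monotoneOn_or_antitoneOn i).imp (fun hm y hy z hz hyz => ?_)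
    fun hm y hy z hz hyz => ?_
  · refine ((hm.strictMonoOn_of_injOn (hI.injOn i)).le_iff_le (invFunOn_mem hy)
      (invFunOn_mem hz)).1 ?_
    rwa [invFunOn_eq hy, invFunOn_eq hz]
  · refine ((hm.strictAntiOn_of_injOn (hI.injOn i)).le_iff_ge (invFunOn_mem hy)
      (invFunOn_mem hz)).1 ?_
    rwa [invFunOn_eq hy, invFunOn_eq hz]

theorem zeroEndVar_branch_le (hI : IsBranchSystem T V I) (u : X → ℝ) (i : ι) :
    zeroEndVar ((T '' I i).indicator (u ∘ invFunOn T (I i))) ≤ zeroEndVar ((I i).indicator u) := by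
  have restrict_eq : (T '' I i).indicator (u ∘ invFunOn T (I i))
      = (T '' I i).indicator ((I i).indicator u ∘ invFunOn T (I i)) := by
    refine indicator_congr fun y hy => ?_
    rw [comp_apply, comp_apply, indicator_of_mem (invFunOn_mem hy)]
  rw [restrict_eq]
  exact zeroEndVar_indicator_comp_le _ (hI.ordConnected_image i)
    (hI.monotoneOn_or_antitoneOn_invFunOn i)

theorem zeroEndVar_branchSum_le (hI : IsBranchSystem T V I) {u : X → ℝ} (hu : ∀ x ∉ V, u x = 0) :
    zeroEndVar (branchSum T I u) ≤ zeroEndVar u := by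
  rcases eq_or_ne (zeroEndVar u) ⊤ with htop | htop
  · exact htop ▸ le_top
  have tsum_le : ∑' i, zeroEndVar ((T '' I i).indicator (u ∘ invFunOn T (I i))) ≤ zeroEndVar u :=
    (ENNReal.tsum_le_tsum (hI.zeroEndVar_branch_le u)).trans (hI.tsum_zeroEndVar_indicator_le hu)
  have summable (y : X) :
      Summable fun i => (T '' I i).indicator (u ∘ invFunOn T (I i)) y := Summable.of_enorm <|
    ne_top_of_le_ne_top htop ((ENNReal.tsum_le_tsum fun i => enorm_le_zeroEndVar
      ((T '' I i).indicator (u ∘ invFunOn T (I i))) y).trans tsum_le)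
  exact (zeroEndVar_le_tsum fun y => (summable y).hasSum).trans tsum_le

theorem zeroEndVar_iterate_branchSum_le (hI : IsBranchSystem T V I) {g : X → ℝ}
    (hg : ∀ x ∉ V, g x = 0) (n : ℕ) (u : X → ℝ) :
    zeroEndVar ((branchSum T I)^[n] (iterWeight T g n * u)) ≤
      zeroEndVar (iterWeight T g n * u) := by
  induction n generalizing u with
  | zero => exact le_rfl
  | succ n ih =>
    rw [branchSum_iterate_succ]
    refine (ih _).trans ?_
    rw [mul_branchSum, ← mul_assoc, mul_comm (_ ∘ T) g]
    exact hI.zeroEndVar_branchSum_le fun x hx => by simp [hg x hx]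

end IsBranchSystem

theorem ordConnected_image_of_injOn {φ : X → X} {Z J : Set X}
    (hm : MonotoneOn φ Z ∨ AntitoneOn φ Z) (hφ : InjOn φ Z) (hZ : (φ '' Z).OrdConnected)
    (hJ : J.OrdConnected) (hJZ : J ⊆ Z) : (φ '' J).OrdConnected := by
  refine ⟨?_⟩
  rintro _ ⟨x, hx, rfl⟩ _ ⟨y, hy, rfl⟩ w hw
  obtain ⟨z, hz, rfl⟩ := hZ.out (mem_image_of_mem φ (hJZ hx)) (mem_image_of_mem φ (hJZ hy)) hw
  refine mem_image_of_mem φ ?_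
  rcases hm with hm | hm
  · have strict := hm.strictMonoOn_of_injOn hφ
    exact hJ.out hx hy ⟨(strict.le_iff_le (hJZ hx) hz).1 hw.1,
      (strict.le_iff_le hz (hJZ hy)).1 hw.2⟩
  · have strict := hm.strictAntiOn_of_injOn hφ
    exact hJ.out hy hx ⟨(strict.le_iff_ge hz (hJZ hy)).1 hw.2,
      (strict.le_iff_ge (hJZ hx) hz).1 hw.1⟩

section StrictlyBetween

/-- The points lying strictly between two points of `Z`. For a closed order-convex set `Z` this is
`Z` without its endpoints. -/
def strictlyBetween (Z : Set X) : Set X := {x | (∃ a ∈ Z, a < x) ∧ ∃ b ∈ Z, x < b}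

theorem ordConnected_strictlyBetween (Z : Set X) : (strictlyBetween Z).OrdConnected :=
  ⟨fun _ ⟨⟨a, ha, hax⟩, _⟩ _ ⟨_, b, hb, hyb⟩ _ hz =>
    ⟨⟨a, ha, hax.trans_le hz.1⟩, b, hb, hz.2.trans_lt hyb⟩⟩

theorem inter_eq_strictlyBetween {Z : Set X} (hZ : Z.OrdConnected)
    (hV : Z ∩ Vᶜ = {x | IsLeast Z x ∨ IsGreatest Z x}) : Z ∩ V = strictlyBetween Z := by
  have mem_iff (x : X) : x ∈ Z ∧ x ∉ V ↔ IsLeast Z x ∨ IsGreatest Z x := Set.ext_iff.1 hV x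
  ext x
  constructor
  · rintro ⟨hxZ, hxV⟩
    have not_end := fun h => ((mem_iff x).2 h).2 hxV
    constructor <;> by_contra! h
    exacts [not_end (Or.inl ⟨hxZ, h⟩), not_end (Or.inr ⟨hxZ, h⟩)]
  · rintro ⟨⟨a, ha, hax⟩, b, hb, hxb⟩
    have hxZ : x ∈ Z := hZ.out ha hb ⟨hax.le, hxb.le⟩
    refine ⟨hxZ, not_not.1 fun hxV => ?_⟩
    rcases (mem_iff x).1 ⟨hxZ, hxV⟩ with h | h
    exacts [(h.2 ha).not_gt hax, (h.2 hb).not_gt hxb]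

theorem strictlyBetween_subset_interior [TopologicalSpace X] [OrderTopology X] {Z : Set X}
    (hZ : Z.OrdConnected) : strictlyBetween Z ⊆ interior Z :=
  fun _ ⟨⟨_, ha, hax⟩, _, hb, hxb⟩ => mem_interior.2
    ⟨_, Ioo_subset_Icc_self.trans (hZ.out ha hb), isOpen_Ioo, hax, hxb⟩

end StrictlyBetween

section Partition

variable {X : Type*} [ConditionallyCompleteLinearOrder X] [TopologicalSpace X] [OrderTopology X]
  {V : Set X}

theorem exists_lower_end {Z : Set X} (hZ : IsClosed Z) (hne : Z.Nonempty) :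
    ∃ a : WithBotTop X, (∀ x : X, a < x ↔ ∃ z ∈ Z, z < x) ∧ ∀ p : X, a = p → IsLeast Z p := by
  by_cases h : ∃ p, IsLeast Z p
  · obtain ⟨p, hp⟩ := h
    refine ⟨p, fun x => ?_, fun q hq => WithBotTop.coe_injective hq ▸ hp⟩
    rw [WithBotTop.coe_lt_coe]
    exact ⟨fun hx => ⟨p, hp.1, hx⟩, fun ⟨_, hz, hzx⟩ => (hp.2 hz).trans_lt hzx⟩
  · have not_bddBelow : ¬BddBelow Z := fun hb => h ⟨_, hZ.isLeast_csInf hne hb⟩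
    exact ⟨⊥, fun x => iff_of_true (bot_lt_iff_ne_bot.2 (by simp))
      (not_bddBelow_iff.1 not_bddBelow x),
      fun p hp => (WithBotTop.coe_ne_bot p hp.symm).elim⟩

theorem exists_upper_end {Z : Set X} (hZ : IsClosed Z) (hne : Z.Nonempty) :
    ∃ b : WithBotTop X, (∀ x : X, x < b ↔ ∃ z ∈ Z, x < z) ∧ ∀ p : X, b = p → IsGreatest Z p := by
  by_cases h : ∃ p, IsGreatest Z p
  · obtain ⟨p, hp⟩ := h
    refine ⟨p, fun x => ?_, fun q hq => WithBotTop.coe_injective hq ▸ hp⟩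
    rw [WithBotTop.coe_lt_coe]
    exact ⟨fun hx => ⟨p, hp.1, hx⟩, fun ⟨_, hz, hxz⟩ => hxz.trans_le (hp.2 hz)⟩
  · have not_bddAbove : ¬BddAbove Z := fun hb => h ⟨_, hZ.isGreatest_csSup hne hb⟩
    exact ⟨⊤, fun x => iff_of_true (lt_top_iff_ne_top.2 (by simp))
      (not_bddAbove_iff.1 not_bddAbove x),
      fun p hp => (WithBotTop.coe_ne_top p hp.symm).elim⟩

theorem exists_strictlyBetween_eq_Ioo {Z : Set X} (hZ : IsClosed Z)
    (hV : Z ∩ Vᶜ = {x | IsLeast Z x ∨ IsGreatest Z x}) :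
    ∃ a b : WithBotTop X, a ≤ b ∧ strictlyBetween Z = WithBotTop.coe ⁻¹' Ioo a b ∧
      a ∉ WithBotTop.coe '' V ∧ b ∉ WithBotTop.coe '' V := by
  rcases (strictlyBetween Z).eq_empty_or_nonempty with hempty | ⟨z, hz⟩
  · exact ⟨⊥, ⊥, le_rfl, by simp [hempty], by simp⟩
  · have hne : Z.Nonempty := hz.1.imp fun _ h => h.1
    obtain ⟨a, lt_iff, ha⟩ := exists_lower_end hZ hne
    obtain ⟨b, gt_iff, hb⟩ := exists_upper_end hZ hne
    refine ⟨a, b, (((lt_iff z).2 hz.1).trans ((gt_iff z).2 hz.2)).le,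
      Set.ext fun x => and_congr (lt_iff x).symm (gt_iff x).symm, ?_, ?_⟩
    · rintro ⟨p, hp, rfl⟩
      exact (hV.ge (Or.inl (ha p rfl))).2 hp
    · rintro ⟨p, hp, rfl⟩
      exact (hV.ge (Or.inr (hb p rfl))).2 hp

theorem IsPiecewiseUniformlyExpanding.exists_branchSystem [MeasurableSpace X] {T : X → X}
    {μ : Measure X} (hT : IsPiecewiseUniformlyExpanding T μ V) :
    ∃ 𝒵 : Set (Set X), IsBranchSystem T V (fun Z : 𝒵 => (Z : Set X) ∩ V) := by
  obtain ⟨𝒵, -, hZ, disjoint_interior, cover, ends, exists_ext⟩ := hT.exists_partition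
  have eq_between (Z : 𝒵) : (Z : Set X) ∩ V = strictlyBetween Z :=
    inter_eq_strictlyBetween (hZ Z Z.2).2 (ends Z Z.2)
  have subset_interior (Z : 𝒵) : (Z : Set X) ∩ V ⊆ interior Z :=
    (eq_between Z).trans_subset (strictlyBetween_subset_interior (hZ Z Z.2).2)
  have extension (Z : 𝒵) : ∃ φ, EqOn φ T (Z ∩ V) ∧ InjOn φ Z ∧ (φ '' Z).OrdConnected ∧
      (MonotoneOn φ Z ∨ AntitoneOn φ Z) := by
    obtain ⟨φ, heq, embedding, image, hm⟩ := exists_ext Z Z.2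
    exact ⟨φ, heq, injOn_iff_injective.2 embedding.injective, image, hm⟩
  refine ⟨𝒵, fun Z Z' hne => ?_, fun x hx => ?_, fun Z => ?_, fun Z => ?_, fun Z => ?_, fun Z => ?_⟩
  · exact (disjoint_interior Z.2 Z'.2 fun h => hne (Subtype.ext h)).mono (subset_interior Z)
      (subset_interior Z')
  · obtain ⟨Z, hZ, hxZ⟩ := cover hx
    exact ⟨⟨Z, hZ⟩, hxZ, hx⟩
  · obtain ⟨φ, heq, hinj, -⟩ := extension Z
    exact (hinj.mono inter_subset_left).congr heq
  · obtain ⟨φ, heq, -, -, hm⟩ := extension Z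
    exact hm.imp (fun h => (h.mono inter_subset_left).congr heq)
      fun h => (h.mono inter_subset_left).congr heq
  · obtain ⟨φ, heq, hinj, himage, hm⟩ := extension Z
    rw [← heq.image_eq]
    exact ordConnected_image_of_injOn hm hinj himage
      (eq_between Z ▸ ordConnected_strictlyBetween _) inter_subset_left
  · rw [eq_between Z]
    exact exists_strictlyBetween_eq_Ioo (hZ Z Z.2).1 (ends Z Z.2)

end Partition

/-- A branch system of `T` together with a weight `g` of bounded variation, bounded by `c < 1`,
which represents the transfer operator of `T` with respect to `μ`. -/
structure IsWeightedBranchSystem {X ι : Type*} [LinearOrder X] [MeasurableSpace X] (T : X → X)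
    (μ : Measure X) (V : Set X) (I : ι → Set X) (g : X → ℝ) (c : ℝ) : Prop
    extends IsBranchSystem T V I where
  eq_zero : ∀ x ∉ V, g x = 0
  zeroEndVar_lt_top : zeroEndVar g < ⊤
  lt_one : c < 1
  abs_le : ∀ x, |g x| ≤ c
  transferOp_eq : ∀ f : X → ℝ, Integrable f μ →
    transferOp T μ f =ᵐ[μ] fun x => ∑' z : (T ⁻¹' {x} : Set X), g z * f z

theorem IsPiecewiseUniformlyExpanding.exists_weightedBranchSystem {X : Type*}
    [ConditionallyCompleteLinearOrder X] [TopologicalSpace X] [OrderTopology X] [MeasurableSpace X]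
    {T : X → X} {μ : Measure X} {V : Set X} (hT : IsPiecewiseUniformlyExpanding T μ V) :
    ∃ (𝒵 : Set (Set X)) (g : X → ℝ) (c : ℝ),
      IsWeightedBranchSystem T μ V (fun Z : 𝒵 => (Z : Set X) ∩ V) g c := by
  obtain ⟨𝒵, branches⟩ := hT.exists_branchSystem
  obtain ⟨g, nonneg, bv, eq_zero, transferOp_eq, c, hc, le_c⟩ := hT.exists_weight
  refine ⟨𝒵, g, max c 0, branches, eq_zero, zeroEndVar_lt_top_iff.2 bv, max_lt hc one_pos,
    fun x => ?_, transferOp_eq⟩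
  rw [abs_of_nonneg (nonneg x)]
  by_cases hx : x ∈ V
  · exact (le_c x hx).trans (le_max_left _ _)
  · exact (eq_zero x hx).trans_le (le_max_right _ _)

end Branches

/-! ### The transfer operator and the Lasota–Yorke inequality -/

theorem L1_norm_eq_integral_of_nonneg {X : Type*} [MeasurableSpace X] {μ : Measure X}
    {f : Lp ℝ 1 μ} (hf : 0 ≤ f) : ‖f‖ = ∫ x, f x ∂μ := by
  rw [L1.norm_eq_integral_norm]
  refine integral_congr_ae ?_
  filter_upwards [(Lp.coeFn_nonneg f).2 hf] with x hx using Real.norm_of_nonneg hx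

theorem L1_norm_add_of_nonneg {X : Type*} [MeasurableSpace X] {μ : Measure X} {f g : Lp ℝ 1 μ}
    (hf : 0 ≤ f) (hg : 0 ≤ g) : ‖f + g‖ = ‖f‖ + ‖g‖ := by
  rw [L1_norm_eq_integral_of_nonneg hf, L1_norm_eq_integral_of_nonneg hg,
    L1_norm_eq_integral_of_nonneg (add_nonneg hf hg),
    ← integral_add (L1.integrable_coeFn f) (L1.integrable_coeFn g)]
  exact integral_congr_ae (Lp.coeFn_add f g)

theorem L1_enorm_eq_lintegral {X : Type*} [MeasurableSpace X] {μ : Measure X} {f : Lp ℝ 1 μ}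
    {u : X → ℝ} (hf : f =ᵐ[μ] u) : ‖f‖ₑ = ∫⁻ x, ‖u x‖ₑ ∂μ := by
  rw [Lp.enorm_def, eLpNorm_congr_ae hf, eLpNorm_one_eq_lintegral_enorm]

theorem L1_enorm_sub_eq_lintegral {X : Type*} [MeasurableSpace X] {μ : Measure X}
    {f g : Lp ℝ 1 μ} {u v : X → ℝ} (hf : f =ᵐ[μ] u) (hg : g =ᵐ[μ] v) :
    ‖f - g‖ₑ = ∫⁻ x, ‖u x - v x‖ₑ ∂μ :=
  L1_enorm_eq_lintegral ((Lp.coeFn_sub f g).trans (hf.sub hg))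

section TransferOperator

variable {X : Type*} [MeasurableSpace X] {μ : Measure X}

theorem transferOp_congr (T : X → X) {f f' : X → ℝ} (h : f =ᵐ[μ] f') :
    transferOp T μ f = transferOp T μ f' := by
  unfold transferOp
  rw [WithDensityᵥEq.congr_ae h]

theorem transferOp_iterate_congr (T : X → X) {f f' : X → ℝ} (h : f =ᵐ[μ] f') (n : ℕ) :
    (transferOp T μ)^[n] f =ᵐ[μ] (transferOp T μ)^[n] f' := by
  cases n with
  | zero => exact h
  | succ n => rw [Function.iterate_succ_apply, Function.iterate_succ_apply, transferOp_congr T h]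

variable {T : X → X} [SigmaFinite μ]

theorem transferOp_ae_eq_of_setIntegral (hT : Measure.QuasiMeasurePreserving T μ μ) {f q : X → ℝ}
    (hf : Integrable f μ) (hq : Integrable q μ)
    (h : ∀ A, MeasurableSet A → ∫ x in A, q x ∂μ = ∫ x in T ⁻¹' A, f x ∂μ) :
    transferOp T μ f =ᵐ[μ] q :=
  Integrable.ae_eq_of_forall_setIntegral_eq _ _ (transferOp_integrable T μ f) hq fun A hA _ => by
    rw [setIntegral_transferOp hT hf hA, h A hA]

theorem transferOp_add (hT : Measure.QuasiMeasurePreserving T μ μ) {f g : X → ℝ}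
    (hf : Integrable f μ) (hg : Integrable g μ) :
    transferOp T μ (f + g) =ᵐ[μ] transferOp T μ f + transferOp T μ g := by
  have hPf := transferOp_integrable T μ f
  have hPg := transferOp_integrable T μ g
  refine transferOp_ae_eq_of_setIntegral hT (hf.add hg) (hPf.add hPg) fun A hA => ?_
  simp only [Pi.add_apply]
  rw [integral_add hPf.integrableOn hPg.integrableOn, integral_add hf.integrableOn hg.integrableOn,
    setIntegral_transferOp hT hf hA, setIntegral_transferOp hT hg hA]

theorem transferOp_smul (hT : Measure.QuasiMeasurePreserving T μ μ) {f : X → ℝ}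
    (hf : Integrable f μ) (c : ℝ) : transferOp T μ (c • f) =ᵐ[μ] c • transferOp T μ f := by
  refine transferOp_ae_eq_of_setIntegral hT (hf.smul c) ((transferOp_integrable T μ f).smul c)
    fun A hA => ?_
  simp only [Pi.smul_apply]
  rw [integral_smul, integral_smul, setIntegral_transferOp hT hf hA]

theorem transferOp_nonneg (hT : Measure.QuasiMeasurePreserving T μ μ) {f : X → ℝ}
    (hf : Integrable f μ) (hf0 : 0 ≤ᵐ[μ] f) : 0 ≤ᵐ[μ] transferOp T μ f :=
  ae_nonneg_of_forall_setIntegral_nonneg (transferOp_integrable T μ f) fun A hA _ => by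
    rw [setIntegral_transferOp hT hf hA]
    exact integral_nonneg_of_ae (ae_restrict_of_ae hf0)

theorem transferOp_mono (hT : Measure.QuasiMeasurePreserving T μ μ) {f g : X → ℝ}
    (hf : Integrable f μ) (hg : Integrable g μ) (hfg : f ≤ᵐ[μ] g) :
    transferOp T μ f ≤ᵐ[μ] transferOp T μ g := by
  have nonneg := transferOp_nonneg hT (hg.sub hf) (hfg.mono fun x hx => sub_nonneg.2 hx)
  have add := transferOp_add hT hf (hg.sub hf)
  rw [add_sub_cancel] at add
  filter_upwards [nonneg, add] with x hx add
  rw [add]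
  exact le_add_of_nonneg_right hx

theorem abs_transferOp_le (hT : Measure.QuasiMeasurePreserving T μ μ) {f : X → ℝ}
    (hf : Integrable f μ) : ∀ᵐ x ∂μ, |transferOp T μ f x| ≤ transferOp T μ |f| x := by
  filter_upwards [transferOp_mono hT hf hf.abs (Eventually.of_forall fun x => le_abs_self (f x)),
    transferOp_mono hT (hf.smul (-1 : ℝ)) hf.abs
      (Eventually.of_forall fun x => by simpa using neg_le_abs (f x)),
    transferOp_smul hT hf (-1)] with x le neg_le smul
  rw [smul, Pi.smul_apply, neg_one_smul] at neg_le
  exact abs_le'.2 ⟨le, neg_le⟩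

theorem integral_transferOp (hT : Measure.QuasiMeasurePreserving T μ μ) {f : X → ℝ}
    (hf : Integrable f μ) : ∫ x, transferOp T μ f x ∂μ = ∫ x, f x ∂μ := by
  simpa using setIntegral_transferOp hT hf MeasurableSet.univ

theorem integral_abs_transferOp_le (hT : Measure.QuasiMeasurePreserving T μ μ) {f : X → ℝ}
    (hf : Integrable f μ) : ∫ x, |transferOp T μ f x| ∂μ ≤ ∫ x, |f x| ∂μ := by
  refine (integral_mono_ae (transferOp_integrable T μ f).abs (transferOp_integrable T μ _)
    (abs_transferOp_le hT hf)).trans_eq ?_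
  exact integral_transferOp hT hf.abs

/-- The transfer operator as a bounded operator on `L¹(μ)`. -/
def transferCLM (hT : Measure.QuasiMeasurePreserving T μ μ) : Lp ℝ 1 μ →L[ℝ] Lp ℝ 1 μ :=
  LinearMap.mkContinuous
    { toFun := fun f => (transferOp_integrable T μ f).toL1 _
      map_add' := fun f g => by
        rw [← Integrable.toL1_add, Integrable.toL1_eq_toL1_iff,
          transferOp_congr T (Lp.coeFn_add f g)]
        exact transferOp_add hT (L1.integrable_coeFn f) (L1.integrable_coeFn g)
      map_smul' := fun c f => by
        rw [RingHom.id_apply, ← Integrable.toL1_smul, Integrable.toL1_eq_toL1_iff,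
          transferOp_congr T (Lp.coeFn_smul c f)]
        exact transferOp_smul hT (L1.integrable_coeFn f) c } 1 fun f => by
    rw [one_mul, L1.norm_eq_integral_norm, L1.norm_eq_integral_norm]
    refine (integral_congr_ae ?_).trans_le
      (integral_abs_transferOp_le hT (L1.integrable_coeFn f))
    filter_upwards [(transferOp_integrable T μ f).coeFn_toL1] with x hx
    exact congrArg norm hx

theorem coeFn_transferCLM (hT : Measure.QuasiMeasurePreserving T μ μ) (f : Lp ℝ 1 μ) :
    transferCLM hT f =ᵐ[μ] transferOp T μ f :=
  (transferOp_integrable T μ f).coeFn_toL1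

theorem coeFn_transferCLM_pow (hT : Measure.QuasiMeasurePreserving T μ μ) (n : ℕ)
    {f : Lp ℝ 1 μ} {u : X → ℝ} (hfu : f =ᵐ[μ] u) :
    (transferCLM hT ^ n) f =ᵐ[μ] (transferOp T μ)^[n] u := by
  induction n generalizing f u with
  | zero => exact hfu
  | succ n ih =>
    rw [pow_succ, Function.iterate_succ_apply, ← transferOp_congr T hfu]
    exact ih (coeFn_transferCLM hT f)

theorem transferCLM_nonneg (hT : Measure.QuasiMeasurePreserving T μ μ) {f : Lp ℝ 1 μ}
    (hf : 0 ≤ f) : 0 ≤ transferCLM hT f := by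
  rw [← Lp.coeFn_nonneg] at hf ⊢
  exact (transferOp_nonneg hT (L1.integrable_coeFn f) hf).trans_eq (coeFn_transferCLM hT f).symm

theorem norm_transferCLM_of_nonneg (hT : Measure.QuasiMeasurePreserving T μ μ) {f : Lp ℝ 1 μ}
    (hf : 0 ≤ f) : ‖transferCLM hT f‖ = ‖f‖ := by
  rw [L1_norm_eq_integral_of_nonneg hf, L1_norm_eq_integral_of_nonneg (transferCLM_nonneg hT hf),
    ← integral_transferOp hT (L1.integrable_coeFn f)]
  exact integral_congr_ae (coeFn_transferCLM hT f)

theorem setIntegral_transferCLM (hT : Measure.QuasiMeasurePreserving T μ μ) (f : Lp ℝ 1 μ)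
    {A : Set X} (hA : MeasurableSet A) :
    ∫ x in A, transferCLM hT f x ∂μ = ∫ x in T ⁻¹' A, f x ∂μ := by
  rw [← setIntegral_transferOp hT (L1.integrable_coeFn f) hA]
  exact integral_congr_ae (ae_restrict_of_ae (coeFn_transferCLM hT f))

end TransferOperator

section LasotaYorke

theorem ae_eq_sum_indicator_fiber {X κ E : Type*} [MeasurableSpace X] {μ : Measure X} [Countable κ]
    [AddCommMonoid E] (N : X → κ) [Fintype {k // μ (N ⁻¹' {k}) ≠ 0}] (u : X → E) :
    u =ᵐ[μ] ∑ k : {k // μ (N ⁻¹' {k}) ≠ 0}, (N ⁻¹' {k.1}).indicator u := by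
  classical
  have charged : ∀ᵐ x ∂μ, μ (N ⁻¹' {N x}) ≠ 0 := by
    have null : μ (⋃ k : {k // μ (N ⁻¹' {k}) = 0}, N ⁻¹' {k.1}) = 0 :=
      measure_iUnion_null fun k => k.2
    filter_upwards [measure_eq_zero_iff_ae_notMem.1 null] with x hx hN
    exact hx (Set.mem_iUnion.2 ⟨⟨N x, hN⟩, rfl⟩)
  filter_upwards [charged] with x hx
  rw [Finset.sum_apply, Finset.sum_eq_single ⟨N x, hx⟩]
  · exact (Set.indicator_of_mem (Set.mem_preimage.2 rfl) u).symm
  · exact fun k _ hk => Set.indicator_of_notMem (fun h => hk (Subtype.ext h.symm)) u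
  · simp

theorem zeroEndVar_indicator_mul_le {X : Type*} [LinearOrder X] {w u : X → ℝ} {J : Set X}
    (hJ : J.OrdConnected) {p : X} (hp : p ∈ J) {s ε : ℝ≥0∞} (hs : ∀ x, ‖w x‖ₑ ≤ s)
    (hε : eVariationOn w J ≤ ε) :
    zeroEndVar (J.indicator (w * u)) ≤ 3 * (s + ε) * (eVariationOn u J + ‖u p‖ₑ) := by
  have enorm_le : ∀ x ∈ J, ‖u x‖ₑ ≤ eVariationOn u J + ‖u p‖ₑ := fun x hx => by
    calc ‖u x‖ₑ = ‖u x - u p + u p‖ₑ := by rw [sub_add_cancel]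
      _ ≤ ‖u x - u p‖ₑ + ‖u p‖ₑ := enorm_add_le _ _
      _ ≤ eVariationOn u J + ‖u p‖ₑ := by
        gcongr
        rw [← edist_eq_enorm_sub]
        exact eVariationOn.edist_le u hx hp
  have mul_le : eVariationOn (w * u) J ≤
      s * eVariationOn u J + (eVariationOn u J + ‖u p‖ₑ) * ε :=
    (eVariation_mul_le (fun x _ => hs x) enorm_le).trans (by gcongr)
  calc zeroEndVar (J.indicator (w * u)) ≤ 3 * eVariationOn (w * u) J + 2 * ‖w p * u p‖ₑ :=
        zeroEndVar_indicator_le_eVariationOn _ hJ hp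
    _ ≤ 3 * (s * eVariationOn u J + (eVariationOn u J + ‖u p‖ₑ) * ε) + 3 * (s * ‖u p‖ₑ) := by
        rw [enorm_mul]
        gcongr
        · norm_num
        · exact hs p
    _ = 3 * (s + ε) * (eVariationOn u J + ‖u p‖ₑ) := by ring

theorem zeroEndVar_indicator_mul_le_lintegral {X : Type*} [LinearOrder X] [MeasurableSpace X]
    {μ : Measure X} [IsFiniteMeasure μ] {w u : X → ℝ} (hu : AEMeasurable u μ) {J : Set X}
    (hJ : J.OrdConnected) (hμJ : μ J ≠ 0) {s ε : ℝ≥0∞} (hs : ∀ x, ‖w x‖ₑ ≤ s)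
    (hε : eVariationOn w J ≤ ε) :
    zeroEndVar (J.indicator (w * u)) ≤
      3 * (s + ε) * (eVariationOn u J + (μ J)⁻¹ * ∫⁻ x, ‖u x‖ₑ ∂μ) := by
  obtain ⟨p, hp, le_average⟩ := exists_le_setLAverage hμJ (measure_ne_top μ J) hu.enorm.restrict
  refine (zeroEndVar_indicator_mul_le hJ hp hs hε).trans ?_
  rw [setLAverage_eq, ENNReal.div_eq_inv_mul] at le_average
  gcongr
  exact le_average.trans (by gcongr; exact Measure.restrict_le_self)

variable {X ι : Type*} [LinearOrder X] [TopologicalSpace X] [OrderTopology X] [MeasurableSpace X]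
  [BorelSpace X] {T : X → X} {μ : Measure X}

/- Cutting `X` into order-convex pieces on which `w` oscillates by at most `ε`, the `μ`-null pieces
have to be discarded before `u` can be compared with its averages. -/
theorem exists_zeroEndVar_mul_le [IsFiniteMeasure μ] {w : X → ℝ} (hw : zeroEndVar w < ⊤)
    {s ε : ℝ≥0} (hs : ∀ x, ‖w x‖ₑ ≤ s) (hε : 0 < ε) :
    ∃ K : ℝ≥0, ∀ u : X → ℝ, zeroEndVar u < ⊤ → ∃ u', u =ᵐ[μ] u' ∧ zeroEndVar u' < ⊤ ∧
      zeroEndVar (w * u') ≤ 3 * (s + ε) * zeroEndVar u + K * ∫⁻ x, ‖u x‖ₑ ∂μ := by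
  classical
  obtain ⟨n, N, N_mono, eVariationOn_le⟩ :=
    exists_monotone_eVariationOn_fiber_le (zeroEndVar_lt_top_iff.1 hw) (NNReal.coe_pos.2 hε)
  simp only [ENNReal.ofReal_coe_nnreal] at eVariationOn_le
  have ordConnected k : (N ⁻¹' {k}).OrdConnected :=
    Set.ordConnected_singleton.preimage_mono N_mono
  let S := {k // μ (N ⁻¹' {k}) ≠ 0}
  let K := 3 * (s + ε) * ∑ k : S, (μ (N ⁻¹' {k.1}))⁻¹
  have K_ne_top : K ≠ ⊤ := ENNReal.mul_ne_top (by finiteness)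
    (ENNReal.sum_ne_top.2 fun k _ => ENNReal.inv_ne_top.2 k.2)
  refine ⟨K.toNNReal, fun u hu => ⟨∑ k : S, (N ⁻¹' {k.1}).indicator u,
    ae_eq_sum_indicator_fiber N u, ?_, ?_⟩⟩
  · exact (zeroEndVar_sum_le _).trans_lt (ENNReal.sum_lt_top.2 fun k _ =>
      (zeroEndVar_indicator_le u (ordConnected k)).trans_lt hu)
  have mul_sum : w * ∑ k : S, (N ⁻¹' {k.1}).indicator u =
      ∑ k : S, (N ⁻¹' {k.1}).indicator (w * u) := by
    simp_rw [Finset.mul_sum]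
    exact Finset.sum_congr rfl fun k _ => funext fun x => (Set.indicator_mul_right _ w u).symm
  rw [mul_sum, ENNReal.coe_toNNReal K_ne_top]
  calc zeroEndVar (∑ k : S, (N ⁻¹' {k.1}).indicator (w * u))
      ≤ ∑ k : S, zeroEndVar ((N ⁻¹' {k.1}).indicator (w * u)) := zeroEndVar_sum_le _
    _ ≤ ∑ k : S, 3 * (s + ε) * (eVariationOn u (N ⁻¹' {k.1}) +
          (μ (N ⁻¹' {k.1}))⁻¹ * ∫⁻ x, ‖u x‖ₑ ∂μ) :=
        Finset.sum_le_sum fun k _ => zeroEndVar_indicator_mul_le_lintegral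
          (measurable_of_zeroEndVar_lt_top hu).aemeasurable (ordConnected k) k.2 hs
          (eVariationOn_le k)
    _ = 3 * (s + ε) * ∑ k : S, eVariationOn u (N ⁻¹' {k.1}) + K * ∫⁻ x, ‖u x‖ₑ ∂μ := by
        rw [← Finset.mul_sum, Finset.sum_add_distrib, ← Finset.sum_mul, mul_add, ← mul_assoc]
    _ ≤ 3 * (s + ε) * zeroEndVar u + K * ∫⁻ x, ‖u x‖ₑ ∂μ := by
        gcongr
        calc ∑ k : S, eVariationOn u (N ⁻¹' {k.1}) ≤ ∑ k, eVariationOn u (N ⁻¹' {k}) := by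
              rw [← Finset.sum_subtype {k | μ (N ⁻¹' {k}) ≠ 0} (by simp)
                fun k => eVariationOn u (N ⁻¹' {k})]
              exact Finset.sum_le_sum_of_subset (Finset.subset_univ _)
          _ ≤ zeroEndVar u :=
              (sum_eVariationOn_fiber_le_univ N_mono u).trans (eVariationOn_univ_le_zeroEndVar u)

namespace IsWeightedBranchSystem

variable {V : Set X} {I : ι → Set X} {g : X → ℝ} {c : ℝ}

theorem transferOp_ae_eq [IsFiniteMeasure μ] [Nonempty X]
    (hI : IsWeightedBranchSystem T μ V I g c) {u : X → ℝ} (hu : zeroEndVar u < ⊤) :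
    transferOp T μ u =ᵐ[μ] branchSum T I (g * u) :=
  (hI.transferOp_eq u (integrable_of_zeroEndVar_lt_top hu μ)).trans <| Eventually.of_forall <|
    hI.toIsBranchSystem.tsum_fiber fun x hx => mul_eq_zero_of_left (hI.eq_zero x hx) _

omit [TopologicalSpace X] [OrderTopology X] [BorelSpace X] in
theorem zeroEndVar_branchSum_mul_le [Nonempty X] (hI : IsWeightedBranchSystem T μ V I g c)
    (u : X → ℝ) : zeroEndVar (branchSum T I (g * u)) ≤ zeroEndVar (g * u) :=
  hI.toIsBranchSystem.zeroEndVar_branchSum_le fun x hx =>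
    mul_eq_zero_of_left (hI.eq_zero x hx) _

theorem exists_transferOp_iterate_ae_eq [IsFiniteMeasure μ] [Nonempty X]
    (hI : IsWeightedBranchSystem T μ V I g c) (n : ℕ) {u : X → ℝ} (hu : zeroEndVar u < ⊤) :
    ∃ v, (transferOp T μ)^[n] u =ᵐ[μ] v ∧ zeroEndVar v ≤ zeroEndVar (iterWeight T g n * u) := by
  refine ⟨(branchSum T I)^[n] (iterWeight T g n * u), ?_,
    hI.toIsBranchSystem.zeroEndVar_iterate_branchSum_le hI.eq_zero n u⟩
  induction n generalizing u with
  | zero => simp [iterWeight]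
  | succ n ih =>
    rw [branchSum_iterate_succ, Function.iterate_succ_apply]
    refine (transferOp_iterate_congr T (hI.transferOp_ae_eq hu) n).trans (ih ?_)
    exact (hI.zeroEndVar_branchSum_mul_le u).trans_lt
      (zeroEndVar_mul_lt_top hI.zeroEndVar_lt_top hu)

theorem exists_lasotaYorke [IsProbabilityMeasure μ] (hI : IsWeightedBranchSystem T μ V I g c) :
    ∃ (N : ℕ) (K : ℝ≥0), 0 < N ∧ ∀ u : X → ℝ, zeroEndVar u < ⊤ →
      ∃ v, (transferOp T μ)^[N] u =ᵐ[μ] v ∧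
        zeroEndVar v ≤ zeroEndVar u / 2 + K * ∫⁻ x, ‖u x‖ₑ ∂μ := by
  have : Nonempty X := nonempty_of_isProbabilityMeasure μ
  obtain ⟨N, hN⟩ := exists_pow_lt_of_lt_one (show (0 : ℝ) < 12⁻¹ by norm_num) hI.lt_one
  have N_ne_zero : N ≠ 0 := by
    rintro rfl
    norm_num at hN
  have weight_le (x : X) : ‖iterWeight T g N x‖ₑ ≤ (12⁻¹ : ℝ≥0) := by
    rw [enorm_le_coe, ← NNReal.coe_le_coe]
    exact (abs_iterWeight_le hI.abs_le N x).trans (hN.le.trans_eq (by simp))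
  obtain ⟨K, hK⟩ := exists_zeroEndVar_mul_le (μ := μ)
    (hI.toIsBranchSystem.zeroEndVar_iterWeight_lt_top hI.eq_zero hI.zeroEndVar_lt_top N)
    weight_le (ε := 12⁻¹) (by positivity)
  refine ⟨N, K, N_ne_zero.bot_lt, fun u hu => ?_⟩
  obtain ⟨u', u_ae_eq, hu', mul_le⟩ := hK u hu
  obtain ⟨v, ae_eq_v, hv⟩ := hI.exists_transferOp_iterate_ae_eq N hu'
  refine ⟨v, (transferOp_iterate_congr T u_ae_eq N).trans ae_eq_v,
    (hv.trans mul_le).trans_eq ?_⟩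
  have half : (3 * ((12⁻¹ : ℝ≥0) + (12⁻¹ : ℝ≥0)) : ℝ≥0) = 2⁻¹ := by
    rw [← NNReal.coe_inj]
    norm_num
  rw [ENNReal.div_eq_inv_mul, ← ENNReal.coe_two, ← ENNReal.coe_inv two_ne_zero, ← half]
  norm_cast

theorem exists_zeroEndVar_transferOp_le [IsFiniteMeasure μ] [Nonempty X]
    (hI : IsWeightedBranchSystem T μ V I g c) {u : X → ℝ} (hu : zeroEndVar u < ⊤) :
    ∃ v, transferOp T μ u =ᵐ[μ] v ∧ zeroEndVar v ≤ 2 * zeroEndVar g * zeroEndVar u := by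
  refine ⟨_, hI.transferOp_ae_eq hu, (hI.zeroEndVar_branchSum_mul_le u).trans ?_⟩
  refine (zeroEndVar_mul_le (enorm_le_zeroEndVar g) (enorm_le_zeroEndVar u)).trans_eq ?_
  ring

theorem measureReal_singleton_le [IsFiniteMeasure μ] (hI : IsWeightedBranchSystem T μ V I g c)
    (hT : Measure.QuasiMeasurePreserving T μ μ) (x : X) :
    μ.real {x} ≤ c * μ.real {T x} := by
  classical
  let δ := Set.indicator {x} (1 : X → ℝ)
  have hδ : Integrable δ μ :=
    (integrable_const (1 : ℝ)).indicator (measurableSet_singleton x)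
  have fiber_sum : ∑' z : (T ⁻¹' {T x} : Set X), g z * δ z = g x := by
    rw [tsum_eq_single ⟨x, rfl⟩]
    · simp [δ]
    · rintro ⟨z, hz⟩ hzx
      simp [δ, show z ≠ x from fun h => hzx (Subtype.ext h)]
  have eq_mul : μ.real {x} = μ.real {T x} * g x := by
    calc μ.real {x} = ∫ z in T ⁻¹' {T x}, δ z ∂μ := by
          rw [setIntegral_indicator (measurableSet_singleton x),
            Set.inter_eq_right.2 (by simp : {x} ⊆ T ⁻¹' {T x})]
          simp [Measure.real]
      _ = ∫ y in {T x}, transferOp T μ δ y ∂μ :=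
          (setIntegral_transferOp hT hδ (measurableSet_singleton _)).symm
      _ = μ.real {T x} * g x := by
          rw [setIntegral_congr_ae (measurableSet_singleton _)
            ((hI.transferOp_eq δ hδ).mono fun y hy _ => hy), integral_singleton, fiber_sum,
            smul_eq_mul]
  rw [eq_mul, mul_comm]
  exact mul_le_mul_of_nonneg_right ((le_abs_self _).trans (hI.abs_le x)) measureReal_nonneg

theorem measure_singleton [IsProbabilityMeasure μ] (hI : IsWeightedBranchSystem T μ V I g c)
    (hT : Measure.QuasiMeasurePreserving T μ μ) (x : X) : μ {x} = 0 := by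
  have hc : 0 ≤ c := (abs_nonneg _).trans (hI.abs_le x)
  have le_pow (n : ℕ) (y : X) : μ.real {y} ≤ c ^ n := by
    induction n generalizing y with
    | zero => exact measureReal_le_one.trans_eq (pow_zero c).symm
    | succ n ih =>
      rw [pow_succ']
      exact (hI.measureReal_singleton_le hT y).trans (mul_le_mul_of_nonneg_left (ih _) hc)
  have le_zero : μ.real {x} ≤ 0 :=
    ge_of_tendsto' (tendsto_pow_atTop_nhds_zero_of_lt_one hc hI.lt_one) fun n => le_pow n x
  exact (measureReal_eq_zero_iff (measure_ne_top μ _)).1 (le_zero.antisymm measureReal_nonneg)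

end IsWeightedBranchSystem

end LasotaYorke

/-! ### Compactness of variation balls in `L¹` -/

/-- A scale of closed, totally bounded sets `D c` (the balls of a stronger norm) on which the
operator `P` satisfies a Lasota–Yorke inequality. -/
structure IsLasotaYorke {B : Type*} [NormedAddCommGroup B] [NormedSpace ℝ B] (P : B →L[ℝ] B)
    (D : ℝ≥0 → Set B) : Prop where
  isClosed : ∀ c, IsClosed (D c)
  mono : ∀ {c d}, c ≤ d → D c ⊆ D d
  add_mem : ∀ {c d f g}, f ∈ D c → g ∈ D d → f + g ∈ D (c + d)
  smul_mem : ∀ {c f} (t : ℝ), f ∈ D c → t • f ∈ D (‖t‖₊ * c)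
  nnnorm_le : ∀ {c f}, f ∈ D c → ‖f‖₊ ≤ c
  totallyBounded : ∀ c, TotallyBounded (D c)
  dense : Dense (⋃ c, D c)
  exists_map_mem : ∃ K : ℝ≥0, ∀ c, ∀ f ∈ D c, P f ∈ D (K * c)
  exists_pow_mem : ∃ (N : ℕ) (K : ℝ≥0), 0 < N ∧ ∀ c, ∀ f ∈ D c, (P ^ N) f ∈ D (c / 2 + K * ‖f‖₊)

theorem totallyBounded_of_approx {B : Type*} [PseudoMetricSpace B] {s : Set B}
    (h : ∀ ε > 0, ∃ t : Set B, TotallyBounded t ∧ ∀ x ∈ s, ∃ y ∈ t, dist x y ≤ ε) :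
    TotallyBounded s := by
  rw [Metric.totallyBounded_iff]
  intro ε hε
  obtain ⟨t, ht, approx⟩ := h (ε / 2) (half_pos hε)
  obtain ⟨F, hF, cover⟩ := Metric.totallyBounded_iff.1 ht (ε / 2) (half_pos hε)
  refine ⟨F, hF, fun x hx => ?_⟩
  obtain ⟨y, hy, hxy⟩ := approx x hx
  obtain ⟨z, hz, hyz⟩ := Set.mem_iUnion₂.1 (cover hy)
  refine Set.mem_iUnion₂.2 ⟨z, hz, ?_⟩
  rw [Metric.mem_ball] at hyz ⊢
  linarith [dist_triangle x y z]

section Indicators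

variable {X : Type*} [LinearOrder X]

theorem zeroEndVar_indicator_union_lt_top {A B : Set X}
    (hA : zeroEndVar (A.indicator (1 : X → ℝ)) < ⊤)
    (hB : zeroEndVar (B.indicator (1 : X → ℝ)) < ⊤) :
    zeroEndVar ((A ∪ B).indicator (1 : X → ℝ)) < ⊤ := by
  have inclusion_exclusion : (A ∪ B).indicator (1 : X → ℝ) =
      A.indicator 1 + (B.indicator 1 + (-1 : ℝ) • (A.indicator 1 * B.indicator 1)) := by
    funext x
    by_cases hxA : x ∈ A <;> by_cases hxB : x ∈ B <;> simp [hxA, hxB]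
  rw [inclusion_exclusion]
  refine (zeroEndVar_add_le _ _).trans_lt (ENNReal.add_lt_top.2 ⟨hA, ?_⟩)
  refine (zeroEndVar_add_le _ _).trans_lt (ENNReal.add_lt_top.2 ⟨hB, ?_⟩)
  exact (zeroEndVar_const_smul_le _ _).trans_lt
    (ENNReal.mul_lt_top enorm_lt_top (zeroEndVar_mul_lt_top hA hB))

theorem zeroEndVar_indicator_biUnion_lt_top {κ : Type*} (t : Finset κ) {A : κ → Set X}
    (hA : ∀ i, (A i).OrdConnected) :
    zeroEndVar ((⋃ i ∈ t, A i).indicator (1 : X → ℝ)) < ⊤ := by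
  classical
  induction t using Finset.induction_on with
  | empty =>
    simp only [Finset.notMem_empty, Set.iUnion_of_empty, Set.iUnion_empty, Set.indicator_empty']
    exact zeroEndVar_zero.trans_lt ENNReal.zero_lt_top
  | insert i t _ ih =>
    rw [Finset.set_biUnion_insert]
    exact zeroEndVar_indicator_union_lt_top
      ((zeroEndVar_indicator_le _ (hA i)).trans_lt (zeroEndVar_const_lt_top 1)) ih

variable [TopologicalSpace X] [OrderTopology X]

theorem exists_zeroEndVar_indicator_lt_top_between {K U : Set X} (hK : IsCompact K)
    (hU : IsOpen U) (hKU : K ⊆ U) :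
    ∃ O, K ⊆ O ∧ O ⊆ U ∧ zeroEndVar (O.indicator (1 : X → ℝ)) < ⊤ := by
  obtain ⟨t, -, cover⟩ := hK.elim_nhds_subcover (fun x => U.ordConnectedComponent x) fun x hx =>
    Set.ordConnectedComponent_mem_nhds.2 (hU.mem_nhds (hKU hx))
  exact ⟨_, cover, Set.iUnion₂_subset fun x _ => Set.ordConnectedComponent_subset,
    zeroEndVar_indicator_biUnion_lt_top t fun _ => inferInstance⟩

variable [MeasurableSpace X] [BorelSpace X] {μ : Measure X} [IsFiniteMeasure μ] [μ.Regular]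

open scoped symmDiff in
theorem exists_zeroEndVar_indicator_lt_top_symmDiff_lt {s : Set X} (hs : MeasurableSet s)
    {ε : ℝ≥0∞} (hε : ε ≠ 0) :
    ∃ O, zeroEndVar (O.indicator (1 : X → ℝ)) < ⊤ ∧ μ (s ∆ O) < ε := by
  have hε2 : ε / 2 ≠ 0 := (ENNReal.half_pos hε).ne'
  obtain ⟨K, hKs, hK, μs_lt⟩ := hs.exists_isCompact_lt_add (measure_ne_top μ s) hε2
  obtain ⟨U, hsU, hU, μU_lt⟩ := s.exists_isOpen_lt_add (measure_ne_top μ s) hε2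
  have hKU := hKs.trans hsU
  obtain ⟨O, hKO, hOU, hO⟩ := exists_zeroEndVar_indicator_lt_top_between hK hU hKU
  refine ⟨O, hO, ?_⟩
  have symmDiff_subset : s ∆ O ⊆ U \ K := by
    rintro x (⟨hxs, hxO⟩ | ⟨hxO, hxs⟩)
    · exact ⟨hsU hxs, fun hxK => hxO (hKO hxK)⟩
    · exact ⟨hOU hxO, fun hxK => hxs (hKs hxK)⟩
  calc μ (s ∆ O) ≤ μ (U \ K) := measure_mono symmDiff_subset
    _ = μ U - μ K := measure_sdiff hKU hK.isClosed.measurableSet.nullMeasurableSet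
        (measure_ne_top _ _)
    _ < ε := by
        refine ENNReal.sub_lt_of_lt_add (measure_mono hKU) (μU_lt.trans_le ?_)
        calc μ s + ε / 2 ≤ μ K + ε / 2 + ε / 2 := by gcongr
          _ = ε + μ K := by rw [add_assoc, ENNReal.add_halves, add_comm]

end Indicators

section BVSet

variable {X : Type*} [LinearOrder X] [MeasurableSpace X]

/-- The classes in `L¹(μ)` that have a representative `u` with `zeroEndVar u ≤ c`. -/
def bvSet (μ : Measure X) (c : ℝ≥0) : Set (Lp ℝ 1 μ) := {f | ∃ u, zeroEndVar u ≤ c ∧ f =ᵐ[μ] u}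

variable {μ : Measure X}

theorem bvSet_mono {c d : ℝ≥0} (h : c ≤ d) : bvSet μ c ⊆ bvSet μ d :=
  fun _ ⟨u, hu, hfu⟩ => ⟨u, hu.trans (ENNReal.coe_le_coe.2 h), hfu⟩

theorem mem_iUnion_bvSet {f : Lp ℝ 1 μ} :
    f ∈ ⋃ c, bvSet μ c ↔ ∃ u, zeroEndVar u < ⊤ ∧ f =ᵐ[μ] u := by
  refine ⟨fun hf => ?_, fun ⟨u, hu, hfu⟩ => ?_⟩
  · obtain ⟨c, u, hu, hfu⟩ := Set.mem_iUnion.1 hf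
    exact ⟨u, hu.trans_lt ENNReal.coe_lt_top, hfu⟩
  · exact Set.mem_iUnion.2
      ⟨(zeroEndVar u).toNNReal, u, (ENNReal.coe_toNNReal hu.ne).ge, hfu⟩

theorem add_mem_bvSet {c d : ℝ≥0} {f g : Lp ℝ 1 μ} (hf : f ∈ bvSet μ c) (hg : g ∈ bvSet μ d) :
    f + g ∈ bvSet μ (c + d) := by
  obtain ⟨u, hu, hfu⟩ := hf
  obtain ⟨v, hv, hgv⟩ := hg
  refine ⟨u + v, (zeroEndVar_add_le u v).trans ?_, (Lp.coeFn_add f g).trans (hfu.add hgv)⟩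
  rw [ENNReal.coe_add]
  exact add_le_add hu hv

theorem smul_mem_bvSet {c : ℝ≥0} {f : Lp ℝ 1 μ} (t : ℝ) (hf : f ∈ bvSet μ c) :
    t • f ∈ bvSet μ (‖t‖₊ * c) := by
  obtain ⟨u, hu, hfu⟩ := hf
  refine ⟨t • u, (zeroEndVar_const_smul_le t u).trans ?_,
    (Lp.coeFn_smul t f).trans (hfu.const_smul t)⟩
  rw [ENNReal.coe_mul, ← enorm_eq_nnnorm]
  gcongr

theorem nnnorm_le_of_mem_bvSet [IsProbabilityMeasure μ] {c : ℝ≥0} {f : Lp ℝ 1 μ}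
    (hf : f ∈ bvSet μ c) : ‖f‖₊ ≤ c := by
  obtain ⟨u, hu, hfu⟩ := hf
  rw [← enorm_le_coe, L1_enorm_eq_lintegral hfu]
  calc ∫⁻ x, ‖u x‖ₑ ∂μ ≤ ∫⁻ _, (c : ℝ≥0∞) ∂μ :=
        lintegral_mono fun x => (enorm_le_zeroEndVar u x).trans hu
    _ = c := by simp

variable [TopologicalSpace X] [OrderTopology X] [BorelSpace X]

theorem indicatorConstLp_mem_closure_iUnion_bvSet [IsFiniteMeasure μ] [μ.Regular] {s : Set X}
    (hs : MeasurableSet s) :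
    indicatorConstLp 1 hs (measure_ne_top μ s) (1 : ℝ) ∈ closure (⋃ c, bvSet μ c) := by
  rw [EMetric.mem_closure_iff]
  intro ε hε
  obtain ⟨O, hO, symmDiff_lt⟩ :=
    exists_zeroEndVar_indicator_lt_top_symmDiff_lt (μ := μ) hs hε.ne'
  have hOm : MeasurableSet O :=
    (measurable_indicator_const_iff (1 : ℝ)).1 (measurable_of_zeroEndVar_lt_top hO)
  refine ⟨indicatorConstLp 1 hOm (measure_ne_top μ O) (1 : ℝ),
    mem_iUnion_bvSet.2 ⟨_, hO, indicatorConstLp_coeFn⟩, ?_⟩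
  rw [edist_indicatorConstLp_eq_enorm]
  exact enorm_indicatorConstLp_le.trans_lt (by simpa using symmDiff_lt)

theorem dense_iUnion_bvSet [IsFiniteMeasure μ] [μ.Regular] : Dense (⋃ c, bvSet μ c) := by
  refine Lp.induction ENNReal.one_ne_top (fun f => f ∈ closure (⋃ c, bvSet μ c)) ?_ ?_
    isClosed_closure
  · intro t s hs hμs
    have smul_eq : ((Lp.simpleFunc.indicatorConst 1 hs hμs.ne t : Lp.simpleFunc ℝ 1 μ) :
        Lp ℝ 1 μ) = t • indicatorConstLp 1 hs (measure_ne_top μ s) (1 : ℝ) := by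
      rw [Lp.simpleFunc.coe_indicatorConst, indicatorConstLp, indicatorConstLp,
        ← MemLp.toLp_const_smul]
      congr 1
      ext x
      by_cases hx : x ∈ s <;> simp [hx]
    rw [smul_eq]
    refine map_mem_closure (continuous_const_smul t)
      (indicatorConstLp_mem_closure_iUnion_bvSet hs) fun f hf => ?_
    obtain ⟨c, hc⟩ := Set.mem_iUnion.1 hf
    exact Set.mem_iUnion.2 ⟨_, smul_mem_bvSet t hc⟩
  · intro f g hf hg _ f_mem g_mem
    refine map_mem_closure₂ continuous_add f_mem g_mem fun a ha b hb => ?_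
    obtain ⟨c, hc⟩ := Set.mem_iUnion.1 ha
    obtain ⟨d, hd⟩ := Set.mem_iUnion.1 hb
    exact Set.mem_iUnion.2 ⟨c + d, add_mem_bvSet hc hd⟩

omit [OrderTopology X] in
theorem measure_le_eVariationOn_cdf [OrderClosedTopology X] [IsFiniteMeasure μ] [μ.Regular]
    (no_atoms : ∀ x, μ {x} = 0) {J : Set X} (hJ : MeasurableSet J) :
    μ J ≤ eVariationOn (fun x => μ.real (Set.Iic x)) J := by
  refine le_of_forall_lt fun r hr => ?_
  obtain ⟨K, hKJ, hK, hrK⟩ := hJ.exists_lt_isCompact_of_ne_top (measure_ne_top _ _) hr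
  refine hrK.trans_le ?_
  rcases K.eq_empty_or_nonempty with rfl | hne
  · simp
  obtain ⟨a, ha, a_le⟩ := hK.exists_isLeast hne
  obtain ⟨b, hb, le_b⟩ := hK.exists_isGreatest hne
  have subset : K ⊆ {a} ∪ (Set.Iic b \ Set.Iic a) := fun x hx =>
    (a_le hx).eq_or_lt.imp Eq.symm fun hax => ⟨le_b hx, hax.not_ge⟩
  calc μ K ≤ μ {a} + μ (Set.Iic b \ Set.Iic a) :=
        (measure_mono subset).trans (measure_union_le _ _)
    _ = μ (Set.Iic b) - μ (Set.Iic a) := by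
        rw [no_atoms, zero_add, measure_sdiff (Set.Iic_subset_Iic.2 (le_b ha))
          measurableSet_Iic.nullMeasurableSet (measure_ne_top _ _)]
    _ = ENNReal.ofReal (μ.real (Set.Iic b) - μ.real (Set.Iic a)) := by
        rw [ENNReal.ofReal_sub _ measureReal_nonneg, ofReal_measureReal, ofReal_measureReal]
    _ ≤ edist (μ.real (Set.Iic b)) (μ.real (Set.Iic a)) := by
        rw [edist_dist, Real.dist_eq]
        exact ENNReal.ofReal_le_ofReal (le_abs_self _)
    _ ≤ _ := eVariationOn.edist_le (fun x => μ.real (Set.Iic x)) (hKJ hb) (hKJ ha)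

omit [TopologicalSpace X] [OrderTopology X] [BorelSpace X] in
theorem boundedVariationOn_cdf [IsFiniteMeasure μ] :
    BoundedVariationOn (fun x => μ.real (Set.Iic x)) Set.univ := by
  refine ((eVariationOn_le_of_edist_add_le (M := μ Set.univ) (D := fun x => μ (Set.Iic x))
    (fun x _ => measure_mono (Set.subset_univ _)) fun x _ y _ hxy => ?_).trans_lt
    (measure_lt_top μ _)).ne
  have measureReal_le : μ.real (Set.Iic x) ≤ μ.real (Set.Iic y) :=
    measureReal_mono (Set.Iic_subset_Iic.2 hxy)
  rw [edist_dist, Real.dist_eq, abs_of_nonneg (sub_nonneg.2 measureReal_le), ← ofReal_measureReal,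
    ← ENNReal.ofReal_add (sub_nonneg.2 measureReal_le) measureReal_nonneg, sub_add_cancel,
    ofReal_measureReal]

theorem measurable_of_monotone_fin {K : ℕ} {N : X → Fin K} (hN : Monotone N) : Measurable N :=
  measurable_to_countable' fun _ =>
    (Set.ordConnected_singleton.preimage_mono hN).measurableSet

theorem exists_lintegral_enorm_sub_comp_le {K : ℕ} {N : X → Fin K} (hN : Monotone N) {ε : ℝ≥0∞}
    (measure_fiber_le : ∀ k, μ (N ⁻¹' {k}) ≤ ε) {u : X → ℝ} {c : ℝ≥0} (hu : zeroEndVar u ≤ c) :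
    ∃ a : Fin K → ℝ, (∀ k, |a k| ≤ c) ∧ ∫⁻ x, ‖u x - a (N x)‖ₑ ∂μ ≤ c * ε := by
  classical
  have abs_le : ∀ x, |u x| ≤ c := fun x => by
    simpa [enorm_le_coe, ← NNReal.coe_le_coe] using (enorm_le_zeroEndVar u x).trans hu
  let a : Fin K → ℝ := fun k => if h : ∃ x, N x = k then u h.choose else 0
  have a_spec : ∀ x, ∃ y, N y = N x ∧ a (N x) = u y := fun x =>
    have h : ∃ y, N y = N x := ⟨x, rfl⟩
    ⟨h.choose, h.choose_spec, dif_pos h⟩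
  have pointwise : ∀ x, ‖u x - a (N x)‖ₑ ≤ eVariationOn u (N ⁻¹' {N x}) := fun x => by
    obtain ⟨y, hy, a_eq⟩ := a_spec x
    rw [a_eq, ← edist_eq_enorm_sub]
    exact eVariationOn.edist_le u rfl hy
  refine ⟨a, fun k => ?_, ?_⟩
  · by_cases h : ∃ x, N x = k
    · exact (congrArg abs (dif_pos h)).trans_le (abs_le _)
    · simp [a, h]
  calc ∫⁻ x, ‖u x - a (N x)‖ₑ ∂μ ≤ ∫⁻ x, eVariationOn u (N ⁻¹' {N x}) ∂μ :=
        lintegral_mono pointwise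
    _ = ∑ k, eVariationOn u (N ⁻¹' {k}) * μ (N ⁻¹' {k}) := by
        rw [← lintegral_map (f := fun k => eVariationOn u (N ⁻¹' {k})) (measurable_of_finite _)
          (measurable_of_monotone_fin hN), lintegral_fintype]
        simp only [Measure.map_apply (measurable_of_monotone_fin hN) (measurableSet_singleton _)]
    _ ≤ (∑ k, eVariationOn u (N ⁻¹' {k})) * ε := by
        rw [Finset.sum_mul]
        gcongr
        exact measure_fiber_le _
    _ ≤ c * ε := by
        gcongr
        exact (sum_eVariationOn_fiber_le_univ hN u).trans
          ((eVariationOn_univ_le_zeroEndVar u).trans hu)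

theorem integrable_comp_fin [IsFiniteMeasure μ] {K : ℕ} {N : X → Fin K} (hN : Monotone N)
    (a : Fin K → ℝ) : Integrable (fun x => a (N x)) μ :=
  Integrable.of_finite.comp_measurable (measurable_of_monotone_fin hN)

theorem totallyBounded_image_toL1_comp [IsProbabilityMeasure μ] {K : ℕ} {N : X → Fin K}
    (hN : Monotone N) (c : ℝ) :
    TotallyBounded ((fun a => (integrable_comp_fin hN a).toL1 (μ := μ)) ''
      Set.univ.pi fun _ : Fin K => Set.Icc (-c) c) := by
  have lipschitz : LipschitzWith 1 fun a => (integrable_comp_fin hN a).toL1 (μ := μ) :=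
    fun a b => by
      rw [edist_eq_enorm_sub,
        L1_enorm_sub_eq_lintegral (Integrable.coeFn_toL1 _) (Integrable.coeFn_toL1 _)]
      calc ∫⁻ x, ‖a (N x) - b (N x)‖ₑ ∂μ ≤ ∫⁻ _, edist a b ∂μ := lintegral_mono fun x => by
            rw [← edist_eq_enorm_sub]
            exact edist_le_pi_edist a b (N x)
        _ = (1 : ℝ≥0) * edist a b := by simp
  exact ((isCompact_univ_pi fun _ => isCompact_Icc).image lipschitz.continuous).totallyBounded

theorem totallyBounded_bvSet [IsProbabilityMeasure μ] [μ.Regular] (no_atoms : ∀ x, μ {x} = 0)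
    (c : ℝ≥0) : TotallyBounded (bvSet μ c) := by
  refine totallyBounded_of_approx fun δ hδ => ?_
  have hε : 0 < δ / (c + 1) := by positivity
  obtain ⟨K, N, hN, var_le⟩ := 
    exists_monotone_eVariationOn_fiber_le (boundedVariationOn_cdf (μ := μ)) hε
  refine ⟨_, totallyBounded_image_toL1_comp hN c, ?_⟩
  rintro f ⟨u, hu, hfu⟩
  obtain ⟨a, abs_a_le, lintegral_le⟩ := exists_lintegral_enorm_sub_comp_le hN (fun k =>
    (measure_le_eVariationOn_cdf no_atoms
      (Set.ordConnected_singleton.preimage_mono hN).measurableSet).trans (var_le k)) hu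
  refine ⟨_, ⟨a, fun k _ => abs_le.1 (abs_a_le k), rfl⟩, ?_⟩
  rw [dist_eq_norm, ← ENNReal.ofReal_le_ofReal_iff hδ.le, ofReal_norm,
    L1_enorm_sub_eq_lintegral hfu (Integrable.coeFn_toL1 _)]
  refine lintegral_le.trans ?_
  rw [← ENNReal.ofReal_coe_nnreal, ← ENNReal.ofReal_mul c.coe_nonneg]
  refine ENNReal.ofReal_le_ofReal ?_
  rw [← mul_div_assoc, div_le_iff₀ (by positivity)]
  nlinarith [c.coe_nonneg]

end BVSet

section

variable {X ι : Type*} [LinearOrder X] [TopologicalSpace X] [OrderTopology X] [MeasurableSpace X]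
  [BorelSpace X] {T : X → X} {μ : Measure X} [IsProbabilityMeasure μ] {V : Set X}
  {I : ι → Set X} {g : X → ℝ} {c : ℝ}

namespace IsWeightedBranchSystem

theorem transferCLM_mem_closure_bvSet (hI : IsWeightedBranchSystem T μ V I g c)
    (hT : Measure.QuasiMeasurePreserving T μ μ) {d : ℝ≥0} {f : Lp ℝ 1 μ}
    (hf : f ∈ closure (bvSet μ d)) :
    transferCLM hT f ∈ closure (bvSet μ ((2 * zeroEndVar g).toNNReal * d)) := by
  have : Nonempty X := nonempty_of_isProbabilityMeasure μ
  refine map_mem_closure (transferCLM hT).continuous hf fun f ⟨u, hu, hfu⟩ => ?_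
  obtain ⟨v, hv, hvle⟩ := hI.exists_zeroEndVar_transferOp_le (hu.trans_lt ENNReal.coe_lt_top)
  refine ⟨v, hvle.trans ?_, (coeFn_transferCLM hT f).trans (by rwa [transferOp_congr T hfu])⟩
  rw [ENNReal.coe_mul,
    ENNReal.coe_toNNReal (ENNReal.mul_lt_top (by simp) hI.zeroEndVar_lt_top).ne]
  gcongr

theorem exists_transferCLM_pow_mem_closure_bvSet (hI : IsWeightedBranchSystem T μ V I g c)
    (hT : Measure.QuasiMeasurePreserving T μ μ) :
    ∃ (N : ℕ) (K : ℝ≥0), 0 < N ∧ ∀ d, ∀ f ∈ closure (bvSet μ d),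
      (transferCLM hT ^ N) f ∈ closure (bvSet μ (d / 2 + K * ‖f‖₊)) := by
  obtain ⟨N, K, hN, lasotaYorke⟩ := hI.exists_lasotaYorke
  refine ⟨N, K * 2, hN, fun d f hf => ?_⟩
  rcases eq_or_ne f 0 with rfl | hf0
  · rw [map_zero]
    exact subset_closure ⟨0, zeroEndVar_zero.trans_le zero_le, Lp.coeFn_zero ℝ 1 μ⟩
  -- The norm is only approximated along the closure; a factor `2` leaves room for this.
  have norm_lt : ‖f‖₊ < 2 * ‖f‖₊ := lt_two_mul_self (nnnorm_pos.2 hf0)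
  have mem_closure : f ∈ closure ({h | ‖h‖₊ < 2 * ‖f‖₊} ∩ bvSet μ d) :=
    (isOpen_lt continuous_nnnorm continuous_const).inter_closure ⟨norm_lt, hf⟩
  refine map_mem_closure (transferCLM hT ^ N).continuous mem_closure fun h ⟨hh, u, hu, hhu⟩ => ?_
  obtain ⟨v, hv, hvle⟩ := lasotaYorke u (hu.trans_lt ENNReal.coe_lt_top)
  refine ⟨v, hvle.trans ?_, (coeFn_transferCLM_pow hT N hhu).trans hv⟩
  rw [← L1_enorm_eq_lintegral hhu]
  calc zeroEndVar u / 2 + K * ‖h‖ₑ ≤ d / 2 + K * ((2 * ‖f‖₊ : ℝ≥0) : ℝ≥0∞) := by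
        gcongr
        exact enorm_le_coe.2 (le_of_lt hh)
    _ = (d / 2 + K * 2 * ‖f‖₊ : ℝ≥0) := by
        rw [ENNReal.coe_add, ENNReal.coe_div two_ne_zero, mul_assoc, ← ENNReal.coe_mul]
        simp

theorem isLasotaYorke [μ.Regular] (hI : IsWeightedBranchSystem T μ V I g c)
    (hT : Measure.QuasiMeasurePreserving T μ μ) :
    IsLasotaYorke (transferCLM hT) fun c => closure (bvSet μ c) where
  isClosed _ := isClosed_closure
  mono h := closure_mono (bvSet_mono h)
  add_mem hf hg := map_mem_closure₂ continuous_add hf hg fun _ ha _ hb => add_mem_bvSet ha hb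
  smul_mem t hf := map_mem_closure (continuous_const_smul t) hf fun _ ha => smul_mem_bvSet t ha
  nnnorm_le {c _} hf := closure_minimal (t := {f | ‖f‖₊ ≤ c}) (fun _ => nnnorm_le_of_mem_bvSet)
    (isClosed_le continuous_nnnorm continuous_const) hf
  totallyBounded c := (totallyBounded_bvSet (hI.measure_singleton hT) c).closure
  dense := dense_iUnion_bvSet.mono (Set.iUnion_mono fun _ => subset_closure)
  exists_map_mem := ⟨_, fun _ _ hf => hI.transferCLM_mem_closure_bvSet hT hf⟩
  exists_pow_mem := hI.exists_transferCLM_pow_mem_closure_bvSet hT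

end IsWeightedBranchSystem

omit [IsProbabilityMeasure μ] in
theorem mem_closure_bvSet_of_ae_eq_mul {h : X → ℝ} (hh : zeroEndVar h < ⊤) {c : ℝ≥0}
    {f q : Lp ℝ 1 μ} (hf : f ∈ closure (bvSet μ c)) (hq : q =ᵐ[μ] fun x => h x * f x) :
    q ∈ closure (bvSet μ ((2 * zeroEndVar h).toNNReal * c)) := by
  have memLp_top : MemLp h ⊤ μ :=
    memLp_top_of_bound (measurable_of_zeroEndVar_lt_top hh).aestronglyMeasurable _
      (Eventually.of_forall (abs_le_toReal_zeroEndVar hh))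
  have coeFn_mul (f : Lp ℝ 1 μ) :
      (ContinuousLinearMap.mul ℝ ℝ).holder 1 memLp_top.toLp f =ᵐ[μ] fun x => h x * f x := by
    filter_upwards [ContinuousLinearMap.coeFn_holder (r := 1) (ContinuousLinearMap.mul ℝ ℝ)
      memLp_top.toLp f, memLp_top.coeFn_toLp] with x hx h_eq
    rw [hx, h_eq, ContinuousLinearMap.mul_apply']
  rw [Lp.ext (hq.trans (coeFn_mul f).symm)]
  refine map_mem_closure (((ContinuousLinearMap.mul ℝ ℝ).holderL μ ⊤ 1 1 memLp_top.toLp).continuous)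
    hf fun f ⟨u, hu, hfu⟩ => ⟨h * u, ?_, (coeFn_mul f).trans (hfu.mono fun x hx =>
      congrArg (h x * ·) hx)⟩
  rw [ENNReal.coe_mul, ENNReal.coe_toNNReal (ENNReal.mul_lt_top (by simp) hh).ne]
  calc zeroEndVar (h * u) ≤ zeroEndVar h * zeroEndVar u + zeroEndVar u * zeroEndVar h :=
        zeroEndVar_mul_le (enorm_le_zeroEndVar h) (enorm_le_zeroEndVar u)
    _ = 2 * zeroEndVar h * zeroEndVar u := by ring
    _ ≤ 2 * zeroEndVar h * c := by gcongr

end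

/-! ### Recurrent vectors of a contraction -/

section Contraction

variable {B : Type*} [NormedAddCommGroup B] [NormedSpace ℝ B] {P : B →L[ℝ] B}

theorem pow_add_apply (P : B →L[ℝ] B) (m n : ℕ) (f : B) :
    (P ^ (m + n)) f = (P ^ m) ((P ^ n) f) := by
  rw [pow_add, mul_apply_eq_comp]

theorem norm_pow_apply_le (hP : ∀ f, ‖P f‖ ≤ ‖f‖) (n : ℕ) (f : B) : ‖(P ^ n) f‖ ≤ ‖f‖ := by
  induction n with
  | zero => rw [pow_zero, one_apply_eq_self]
  | succ n ih =>
    rw [pow_succ', mul_apply_eq_comp]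
    exact (hP _).trans ih

theorem antitone_norm_pow_apply (hP : ∀ f, ‖P f‖ ≤ ‖f‖) (f : B) :
    Antitone fun n => ‖(P ^ n) f‖ := by
  intro m n h
  obtain ⟨k, rfl⟩ := Nat.exists_eq_add_of_le' h
  simpa only [pow_add_apply] using norm_pow_apply_le hP k _

theorem exists_norm_pow_apply_le_of_totallyBounded (hP : ∀ f, ‖P f‖ ≤ ‖f‖) {s : Set B}
    (hs : TotallyBounded s) (hlim : ∀ f ∈ s, Tendsto (fun n => (P ^ n) f) atTop (𝓝 0))
    {ε : ℝ} (hε : 0 < ε) : ∃ m, ∀ f ∈ s, ‖(P ^ m) f‖ ≤ ε := by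
  obtain ⟨t, hts, ht, cover⟩ := Metric.finite_approx_of_totallyBounded hs (ε / 2) (half_pos hε)
  have eventually_lt : ∀ᶠ n in atTop, ∀ g ∈ t, ‖(P ^ n) g‖ < ε / 2 :=
    (eventually_all_finite ht).2 fun g hg =>
      (hlim g (hts hg)).norm.eventually (gt_mem_nhds (by simpa using half_pos hε))
  obtain ⟨m, hm⟩ := eventually_lt.exists
  refine ⟨m, fun f hf => ?_⟩
  obtain ⟨g, hg, hfg⟩ := Set.mem_iUnion₂.1 (cover hf)
  rw [Metric.mem_ball, dist_eq_norm] at hfg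
  calc ‖(P ^ m) f‖ = ‖(P ^ m) (f - g) + (P ^ m) g‖ := by rw [map_sub, sub_add_cancel]
    _ ≤ ‖f - g‖ + ‖(P ^ m) g‖ := (norm_add_le _ _).trans (by gcongr; exact norm_pow_apply_le hP m _)
    _ ≤ ε := by linarith [hm g hg]

/-- The recurrent vectors of `P`: those that are cluster points of their own orbit. -/
def recurrentSet (P : B →L[ℝ] B) : Set B := {f | MapClusterPt f atTop fun n => (P ^ n) f}

theorem mem_recurrentSet_iff {f : B} :
    f ∈ recurrentSet P ↔ ∀ ε > 0, ∀ n₀, ∃ n ≥ n₀, ‖(P ^ n) f - f‖ < ε := by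
  simp only [recurrentSet, Set.mem_ofPred_eq, Metric.nhds_basis_ball.mapClusterPt_iff_frequently,
    frequently_atTop, Metric.mem_ball, dist_eq_norm]

theorem map_mem_recurrentSet {Q : B →L[ℝ] B} (hQ : Commute Q P) {f : B}
    (hf : f ∈ recurrentSet P) : Q f ∈ recurrentSet P := by
  have cluster := MapClusterPt.continuousAt_comp (Q.continuous.continuousAt (x := f)) hf
  have apply_comm : (Q ∘ fun n => (P ^ n) f) = fun n => (P ^ n) (Q f) :=
    funext fun n => DFunLike.congr_fun (hQ.pow_right n).eq f
  rwa [apply_comm] at cluster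

theorem norm_pow_apply_of_recurrent (hP : ∀ f, ‖P f‖ ≤ ‖f‖) {f : B} (hf : f ∈ recurrentSet P)
    (m : ℕ) : ‖(P ^ m) f‖ = ‖f‖ := by
  refine (norm_pow_apply_le hP m f).antisymm (le_of_not_gt fun hlt => ?_)
  obtain ⟨n, hn, hmn⟩ := ((MapClusterPt.frequently hf
    (continuous_norm.continuousAt.eventually (lt_mem_nhds hlt))).and_eventually
      (eventually_ge_atTop m)).exists
  exact hn.not_ge (antitone_norm_pow_apply hP f hmn)

theorem eq_zero_of_recurrent_of_tendsto {f : B} (hf : f ∈ recurrentSet P)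
    (h : Tendsto (fun n => (P ^ n) f) atTop (𝓝 0)) : f = 0 :=
  have : (𝓝 f ⊓ 𝓝 0).NeBot := ClusterPt.mono hf h
  eq_of_nhds_neBot this

theorem isClosed_recurrentSet (hP : ∀ f, ‖P f‖ ≤ ‖f‖) : IsClosed (recurrentSet P) := by
  refine isClosed_of_closure_subset fun f hf => mem_recurrentSet_iff.2 fun ε hε n₀ => ?_
  obtain ⟨g, hg, hfg⟩ := Metric.mem_closure_iff.1 hf (ε / 3) (by positivity)
  obtain ⟨n, hn, h⟩ := mem_recurrentSet_iff.1 hg (ε / 3) (by positivity) n₀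
  rw [dist_eq_norm] at hfg
  refine ⟨n, hn, ?_⟩
  calc ‖(P ^ n) f - f‖ = ‖(P ^ n) (f - g) + ((P ^ n) g - g) - (f - g)‖ := by
        rw [map_sub]
        congr 1
        abel
    _ ≤ ‖f - g‖ + ‖(P ^ n) g - g‖ + ‖f - g‖ :=
        (norm_sub_le _ _).trans (by gcongr; exact (norm_add_le _ _).trans (by
          gcongr; exact norm_pow_apply_le hP n _))
    _ < ε := by linarith

theorem mem_recurrentSet_of_mapClusterPt (hP : ∀ f, ‖P f‖ ≤ ‖f‖) {f a : B}
    (ha : MapClusterPt a atTop fun n => (P ^ n) f) : a ∈ recurrentSet P := by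
  refine mem_recurrentSet_iff.2 fun ε hε n₀ => ?_
  have frequently_lt : ∃ᶠ n in atTop, ‖(P ^ n) f - a‖ < ε / 2 := by
    simpa only [dist_eq_norm] using ha.frequently (Metric.ball_mem_nhds a (half_pos hε))
  obtain ⟨m, hm⟩ := frequently_lt.exists
  obtain ⟨k, hk, hmk⟩ := (frequently_lt.and_eventually (eventually_ge_atTop (n₀ + m))).exists
  obtain ⟨d, rfl⟩ := Nat.exists_eq_add_of_le hmk
  refine ⟨n₀ + d, Nat.le_add_right _ _, ?_⟩
  rw [add_right_comm, pow_add_apply] at hk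
  calc ‖(P ^ (n₀ + d)) a - a‖
      = ‖((P ^ (n₀ + d)) ((P ^ m) f) - a) - (P ^ (n₀ + d)) ((P ^ m) f - a)‖ := by
        rw [map_sub]
        congr 1
        abel
    _ ≤ ‖(P ^ (n₀ + d)) ((P ^ m) f) - a‖ + ‖(P ^ m) f - a‖ :=
        (norm_sub_le _ _).trans (by gcongr; exact norm_pow_apply_le hP _ _)
    _ < ε := by linarith

namespace IsLasotaYorke

variable {D : ℝ≥0 → Set B}

theorem exists_norm_sub_lt (hD : IsLasotaYorke P D) (f : B) {ε : ℝ} (hε : 0 < ε) :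
    ∃ c, ∃ g ∈ D c, ‖f - g‖ < ε := by
  obtain ⟨g, hg, hfg⟩ := hD.dense.exists_dist_lt f hε
  obtain ⟨c, hc⟩ := Set.mem_iUnion.1 hg
  exact ⟨c, g, hc, by rwa [← dist_eq_norm]⟩

theorem exists_pow_mul_apply_mem (hD : IsLasotaYorke P D) (hP : ∀ f, ‖P f‖ ≤ ‖f‖) :
    ∃ (N : ℕ) (K : ℝ≥0), 0 < N ∧ ∀ c, ∀ f ∈ D c, ∀ k,
      (P ^ (N * k)) f ∈ D (c / 2 ^ k + K * ‖f‖₊) := by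
  obtain ⟨N, K, hN, pow_mem⟩ := hD.exists_pow_mem
  refine ⟨N, 2 * K, hN, fun c f hf k => ?_⟩
  induction k with
  | zero => exact hD.mono (c := c) (by simp) (by simpa using hf)
  | succ k ih =>
    rw [mul_add_one, add_comm (N * k) N, pow_add_apply]
    refine hD.mono ?_ (pow_mem _ _ ih)
    calc (c / 2 ^ k + 2 * K * ‖f‖₊) / 2 + K * ‖(P ^ (N * k)) f‖₊
        ≤ (c / 2 ^ k + 2 * K * ‖f‖₊) / 2 + K * ‖f‖₊ := by
          gcongr
          exact norm_pow_apply_le hP _ f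
      _ = c / 2 ^ (k + 1) + 2 * K * ‖f‖₊ := by
        rw [pow_succ]
        field_simp
        ring

theorem exists_orbit_bound (hD : IsLasotaYorke P D) (hP : ∀ f, ‖P f‖ ≤ ‖f‖) :
    ∃ (N : ℕ) (L K : ℝ≥0), 0 < N ∧ ∀ c, ∀ f ∈ D c, ∀ n,
      (P ^ n) f ∈ D (L * c / 2 ^ (n / N) + K * ‖f‖₊) := by
  obtain ⟨K₁, map_mem⟩ := hD.exists_map_mem
  obtain ⟨N, K, hN, pow_mul_mem⟩ := hD.exists_pow_mul_apply_mem hP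
  have pow_mem : ∀ c, ∀ f ∈ D c, ∀ j, (P ^ j) f ∈ D (K₁ ^ j * c) := by
    intro c f hf j
    induction j with
    | zero => simpa using hf
    | succ j ih =>
      rw [pow_succ', pow_succ', mul_assoc]
      exact map_mem _ _ ih
  refine ⟨N, (1 + K₁) ^ N, K, hN, fun c f hf n => ?_⟩
  have div_add_mod := pow_mul_mem _ _ (pow_mem c f hf (n % N)) (n / N)
  rw [← pow_add_apply, Nat.div_add_mod] at div_add_mod
  refine hD.mono ?_ div_add_mod
  have norm_le : ‖(P ^ (n % N)) f‖₊ ≤ ‖f‖₊ := norm_pow_apply_le hP _ f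
  have pow_le : K₁ ^ (n % N) ≤ (1 + K₁) ^ N :=
    (pow_le_pow_left₀ zero_le le_add_self _).trans
      (pow_le_pow_right₀ le_self_add (Nat.mod_lt _ hN).le)
  gcongr

theorem exists_orbit_subset (hD : IsLasotaYorke P D) (hP : ∀ f, ‖P f‖ ≤ ‖f‖) :
    ∃ K : ℝ≥0, ∀ c, ∀ f ∈ D c, ∀ n, (P ^ n) f ∈ D (K * c) := by
  obtain ⟨N, L, K, -, orbit_mem⟩ := hD.exists_orbit_bound hP
  refine ⟨L + K, fun c f hf n => hD.mono ?_ (orbit_mem c f hf n)⟩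
  rw [add_mul]
  gcongr
  · exact div_le_self zero_le (one_le_pow₀ one_le_two)
  · exact hD.nnnorm_le hf

theorem totallyBounded_orbit (hD : IsLasotaYorke P D) (hP : ∀ f, ‖P f‖ ≤ ‖f‖) (f : B) :
    TotallyBounded (Set.range fun n => (P ^ n) f) := by
  obtain ⟨K, orbit_mem⟩ := hD.exists_orbit_subset hP
  refine totallyBounded_of_approx fun ε hε => ?_
  obtain ⟨c, g, hg, hfg⟩ := hD.exists_norm_sub_lt f hε
  refine ⟨D (K * c), hD.totallyBounded _, ?_⟩
  rintro _ ⟨n, rfl⟩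
  refine ⟨(P ^ n) g, orbit_mem c g hg n, ?_⟩
  rw [dist_eq_norm, ← map_sub]
  exact (norm_pow_apply_le hP n _).trans hfg.le

theorem exists_recurrent_ball_subset (hD : IsLasotaYorke P D) (hP : ∀ f, ‖P f‖ ≤ ‖f‖) :
    ∃ c, ∀ f ∈ recurrentSet P, ‖f‖ ≤ 1 → f ∈ D c := by
  obtain ⟨N, L, K, hN, orbit_mem⟩ := hD.exists_orbit_bound hP
  refine ⟨1 + K * 2, fun f hf norm_f => ?_⟩
  rw [← (hD.isClosed (1 + K * 2)).closure_eq, Metric.mem_closure_iff]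
  intro ε hε
  obtain ⟨c, g, hg, hfg⟩ := hD.exists_norm_sub_lt f (lt_min (half_pos hε) one_pos)
  obtain ⟨hfg, hfg_one⟩ := lt_min_iff.1 hfg
  obtain ⟨k, hk⟩ := pow_unbounded_of_one_lt (L * c) (one_lt_two : (1 : ℝ≥0) < 2)
  obtain ⟨n, hn, hnf⟩ := mem_recurrentSet_iff.1 hf (ε / 2) (half_pos hε) (N * k)
  have decayed : L * c / 2 ^ (n / N) ≤ 1 :=
    div_le_one_of_le₀ (hk.le.trans (pow_le_pow_right₀ one_le_two
      ((Nat.le_div_iff_mul_le hN).2 (by rwa [mul_comm])))) zero_le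
  have norm_g : ‖g‖₊ ≤ 2 := by
    rw [← NNReal.coe_le_coe, coe_nnnorm, NNReal.coe_ofNat]
    linarith [norm_sub_norm_le g f, norm_sub_rev g f]
  refine ⟨(P ^ n) g, hD.mono (by gcongr) (orbit_mem c g hg n), ?_⟩
  calc dist f ((P ^ n) g) = ‖(P ^ n) (f - g) - ((P ^ n) f - f)‖ := by
        rw [dist_eq_norm, map_sub]
        congr 1
        abel
    _ ≤ ‖f - g‖ + ‖(P ^ n) f - f‖ :=
        (norm_sub_le _ _).trans (by gcongr; exact norm_pow_apply_le hP n _)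
    _ < ε := by linarith

theorem exists_pow_apply_mem_half_of_mem_one (hD : IsLasotaYorke P D) (hP : ∀ f, ‖P f‖ ≤ ‖f‖) :
    ∃ n₀, 0 < n₀ ∧ ∀ f ∈ D 1, Tendsto (fun n => (P ^ n) f) atTop (𝓝 0) →
      (P ^ n₀) f ∈ D (1 / 2) := by
  obtain ⟨N, L, K, hN, orbit_bound⟩ := hD.exists_orbit_bound hP
  obtain ⟨M, orbit_mem⟩ := hD.exists_orbit_subset hP
  obtain ⟨m, norm_le⟩ := exists_norm_pow_apply_le_of_totallyBounded hP
    ((hD.totallyBounded 1).subset Set.inter_subset_left)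
    (fun f (hf : f ∈ D 1 ∩ {f | Tendsto (fun n => (P ^ n) f) atTop (𝓝 0)}) => hf.2)
    (show (0 : ℝ) < 1 / (4 * (K + 1)) by positivity)
  obtain ⟨k, hk⟩ := pow_unbounded_of_one_lt (4 * (L * M)) (one_lt_two : (1 : ℝ≥0) < 2)
  refine ⟨N * (k + 1) + m, by positivity, fun f hf hlim => ?_⟩
  rw [pow_add_apply]
  refine hD.mono ?_ (orbit_bound _ _ (orbit_mem 1 f hf m) (N * (k + 1)))
  rw [Nat.mul_div_cancel_left _ hN, mul_one]
  have variation_le : L * M / 2 ^ (k + 1) ≤ 1 / 4 := by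
    rw [div_le_div_iff₀ (by positivity) (by norm_num), one_mul, mul_comm]
    exact hk.le.trans (pow_le_pow_right₀ one_le_two k.le_succ)
  have norm_term_le : K * ‖(P ^ m) f‖₊ ≤ 1 / 4 := by
    rw [← NNReal.coe_le_coe, NNReal.coe_mul, coe_nnnorm]
    calc (K : ℝ) * ‖(P ^ m) f‖ ≤ K * (1 / (4 * (K + 1))) := by gcongr; exact norm_le f ⟨hf, hlim⟩
      _ ≤ ((1 / 4 : ℝ≥0) : ℝ) := by
        push_cast
        rw [mul_one_div, div_le_div_iff₀ (by positivity) (by norm_num)]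
        linarith
  calc L * M / 2 ^ (k + 1) + K * ‖(P ^ m) f‖₊
      ≤ 1 / 4 + 1 / 4 := add_le_add variation_le norm_term_le
    _ = 1 / 2 := by
      rw [← NNReal.coe_inj]
      push_cast
      norm_num

theorem exists_pow_apply_mem_half (hD : IsLasotaYorke P D) (hP : ∀ f, ‖P f‖ ≤ ‖f‖) :
    ∃ n₀, 0 < n₀ ∧ ∀ c, ∀ f ∈ D c, Tendsto (fun n => (P ^ n) f) atTop (𝓝 0) →
      (P ^ n₀) f ∈ D (c / 2) := by
  obtain ⟨n₀, hn₀, mem_half⟩ := hD.exists_pow_apply_mem_half_of_mem_one hP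
  refine ⟨n₀, hn₀, fun c f hf hlim => ?_⟩
  rcases eq_or_ne c 0 with rfl | hc
  · have f_eq_zero : f = 0 := nnnorm_eq_zero.1 (le_zero_iff.1 (hD.nnnorm_le hf))
    simpa [f_eq_zero] using hf
  · have normalized : (c : ℝ)⁻¹ • f ∈ D 1 := by
      simpa [inv_mul_cancel₀ hc] using hD.smul_mem (c : ℝ)⁻¹ hf
    have scaled := hD.smul_mem (c : ℝ)
      (mem_half _ normalized (by simpa using hlim.const_smul (c : ℝ)⁻¹))
    rwa [← map_smul, smul_inv_smul₀ (NNReal.coe_ne_zero.2 hc), NNReal.nnnorm_eq,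
      mul_one_div] at scaled

variable [CompleteSpace B]

theorem isCompact_closure_orbit (hD : IsLasotaYorke P D) (hP : ∀ f, ‖P f‖ ≤ ‖f‖) (f : B) :
    IsCompact (closure (Set.range fun n => (P ^ n) f)) :=
  (hD.totallyBounded_orbit hP f).closure.isCompact_of_isClosed isClosed_closure

theorem exists_common_return (hD : IsLasotaYorke P D) (hP : ∀ f, ‖P f‖ ≤ ‖f‖)
    {f g : B} (hf : f ∈ recurrentSet P) (hg : g ∈ recurrentSet P) {ε : ℝ} (hε : 0 < ε) (n₀ : ℕ) :
    ∃ n ≥ n₀, ‖(P ^ n) f - f‖ < ε ∧ ‖(P ^ n) g - g‖ < ε := by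
  obtain ⟨⟨a, b⟩, -, cluster⟩ := ((hD.isCompact_closure_orbit hP f).prod
    (hD.isCompact_closure_orbit hP g)).exists_mapClusterPt_of_frequently (l := atTop)
      (f := fun n => ((P ^ n) f, (P ^ n) g)) (Frequently.of_forall fun n =>
        ⟨subset_closure ⟨n, rfl⟩, subset_closure ⟨n, rfl⟩⟩)
  have frequently_lt : ∃ᶠ n in atTop, ‖(P ^ n) f - a‖ < ε / 2 ∧ ‖(P ^ n) g - b‖ < ε / 2 :=
    (cluster.frequently (prod_mem_nhds (Metric.ball_mem_nhds a (half_pos hε))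
      (Metric.ball_mem_nhds b (half_pos hε)))).mono fun n hn =>
        ⟨mem_ball_iff_norm.1 hn.1, mem_ball_iff_norm.1 hn.2⟩
  obtain ⟨m, hmf, hmg⟩ := frequently_lt.exists
  obtain ⟨k, ⟨hkf, hkg⟩, hmk⟩ :=
    (frequently_lt.and_eventually (eventually_ge_atTop (m + n₀))).exists
  obtain ⟨d, rfl⟩ := Nat.exists_eq_add_of_le hmk
  -- `P ^ m` is isometric on recurrent vectors, so closeness at time `m` pulls back to time `0`.
  have return_lt : ∀ {h c : B}, h ∈ recurrentSet P → ‖(P ^ m) h - c‖ < ε / 2 →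
      ‖(P ^ (m + n₀ + d)) h - c‖ < ε / 2 → ‖(P ^ (n₀ + d)) h - h‖ < ε := by
    intro h c hh hm hk
    have sub_mem : (P ^ (n₀ + d)) h - h ∈ recurrentSet P :=
      map_mem_recurrentSet (Q := P ^ (n₀ + d) - 1)
        (((Commute.refl P).pow_left _).sub_left (Commute.one_left P)) hh
    rw [← norm_pow_apply_of_recurrent hP sub_mem m, map_sub, ← pow_add_apply, ← add_assoc,
      ← sub_sub_sub_cancel_right _ _ c]
    linarith [norm_sub_le ((P ^ (m + n₀ + d)) h - c) ((P ^ m) h - c)]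
  exact ⟨n₀ + d, Nat.le_add_right _ _, return_lt hf hmf hkf, return_lt hg hmg hkg⟩

/-- The recurrent vectors of a contraction with a Lasota–Yorke inequality, as a subspace: the sum
of two of them is recurrent because they return simultaneously. -/
def recurrent (hD : IsLasotaYorke P D) (hP : ∀ f, ‖P f‖ ≤ ‖f‖) : Submodule ℝ B where
  carrier := recurrentSet P
  zero_mem' := mem_recurrentSet_iff.2 fun ε hε n₀ => ⟨n₀, le_rfl, by simpa using hε⟩
  add_mem' {f g} hf hg := mem_recurrentSet_iff.2 fun ε hε n₀ => by
    obtain ⟨n, hn, hf_lt, hg_lt⟩ := hD.exists_common_return hP hf hg (half_pos hε) n₀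
    refine ⟨n, hn, ?_⟩
    rw [map_add, add_sub_add_comm]
    linarith [norm_add_le ((P ^ n) f - f) ((P ^ n) g - g)]
  smul_mem' t _ hf := map_mem_recurrentSet (Q := t • 1) ((Commute.one_left P).smul_left t) hf

theorem isCompact_recurrentSet_inter_closedBall (hD : IsLasotaYorke P D)
    (hP : ∀ f, ‖P f‖ ≤ ‖f‖) : IsCompact (recurrentSet P ∩ Metric.closedBall 0 1) := by
  obtain ⟨c, ball_subset⟩ := hD.exists_recurrent_ball_subset hP
  exact ((hD.totallyBounded c).isCompact_of_isClosed (hD.isClosed c)).of_isClosed_subset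
    ((isClosed_recurrentSet hP).inter Metric.isClosed_closedBall)
    fun f hf => ball_subset f hf.1 (by simpa using hf.2)

theorem finiteDimensional_recurrent (hD : IsLasotaYorke P D) (hP : ∀ f, ‖P f‖ ≤ ‖f‖) :
    FiniteDimensional ℝ (hD.recurrent hP) := by
  refine FiniteDimensional.of_isCompact_closedBall₀ ℝ one_pos ?_
  rw [Topology.IsEmbedding.subtypeVal.isCompact_iff]
  convert hD.isCompact_recurrentSet_inter_closedBall hP using 1
  ext f
  constructor
  · rintro ⟨⟨g, hg⟩, norm_le, rfl⟩
    exact ⟨hg, by simpa using norm_le⟩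
  · rintro ⟨hf, norm_le⟩
    exact ⟨⟨f, hf⟩, by simpa using norm_le, rfl⟩

theorem injOn_recurrentSet (hD : IsLasotaYorke P D) (hP : ∀ f, ‖P f‖ ≤ ‖f‖) :
    Set.InjOn P (recurrentSet P) := by
  intro f hf g hg h
  have norm_eq := norm_pow_apply_of_recurrent hP ((hD.recurrent hP).sub_mem hf hg) 1
  rw [pow_one, map_sub, h, sub_self, norm_zero] at norm_eq
  exact sub_eq_zero.1 (norm_eq_zero.1 norm_eq.symm)

theorem surjOn_recurrentSet (hD : IsLasotaYorke P D) (hP : ∀ f, ‖P f‖ ≤ ‖f‖) :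
    Set.SurjOn P (recurrentSet P) (recurrentSet P) := by
  intro y hy
  have := hD.finiteDimensional_recurrent hP
  let Q : hD.recurrent hP →ₗ[ℝ] hD.recurrent hP :=
    (P : B →ₗ[ℝ] B).restrict fun f hf => map_mem_recurrentSet (Commute.refl P) hf
  have injective : Function.Injective Q := fun f g h =>
    Subtype.ext (hD.injOn_recurrentSet hP f.2 g.2 (congrArg Subtype.val h))
  obtain ⟨x, hx⟩ := LinearMap.surjective_of_injective injective ⟨y, hy⟩
  exact ⟨x, x.2, congrArg Subtype.val hx⟩

theorem exists_recurrent_pow_apply_eq (hD : IsLasotaYorke P D) (hP : ∀ f, ‖P f‖ ≤ ‖f‖) {y : B}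
    (hy : y ∈ recurrentSet P) (n : ℕ) : ∃ x ∈ recurrentSet P, (P ^ n) x = y := by
  simp only [pow_apply_eq_iterate]
  exact (hD.surjOn_recurrentSet hP).iterate n hy

theorem exists_recurrent_asymptotic (hD : IsLasotaYorke P D) (hP : ∀ f, ‖P f‖ ≤ ‖f‖) (f : B) :
    ∃ x ∈ recurrentSet P, Tendsto (fun n => (P ^ n) (f - x)) atTop (𝓝 0) := by
  have := hD.finiteDimensional_recurrent hP
  have := FiniteDimensional.proper ℝ (hD.recurrent hP)
  obtain ⟨y, -, cluster⟩ := (hD.isCompact_closure_orbit hP f).exists_mapClusterPt_of_frequently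
    (l := atTop) (f := fun n => (P ^ n) f) (Frequently.of_forall fun n => subset_closure ⟨n, rfl⟩)
  choose x hx hxy using
    hD.exists_recurrent_pow_apply_eq hP (mem_recurrentSet_of_mapClusterPt hP cluster)
  let l : Filter ℕ := comap (fun n => (P ^ n) f) (𝓝 y) ⊓ atTop
  have : l.NeBot := neBot_inf_comap_iff_map'.2 cluster
  obtain ⟨z, -, hz⟩ :=
    (isCompact_closedBall (0 : hD.recurrent hP) ‖y‖).exists_mapClusterPt_of_frequently (l := l)
      (f := fun n => (⟨x n, hx n⟩ : hD.recurrent hP)) <| Frequently.of_forall fun n => by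
        rw [mem_closedBall_zero_iff, ← hxy n, norm_pow_apply_of_recurrent hP (hx n)]
        exact le_rfl
  refine ⟨z, z.2, tendsto_zero_iff_norm_tendsto_zero.2 ?_⟩
  refine Metric.tendsto_atTop.2 fun ε hε => ?_
  have orbit_near : ∀ᶠ n in l, ‖(P ^ n) f - y‖ < ε / 2 :=
    (eventually_of_mem (mem_inf_of_left (preimage_mem_comap (Metric.ball_mem_nhds y
      (half_pos hε)))) fun _ => mem_ball_iff_norm.1)
  have preimage_near : ∃ᶠ n in l, ‖x n - z‖ < ε / 2 :=
    (hz.frequently (Metric.ball_mem_nhds z (half_pos hε))).mono fun _ => mem_ball_iff_norm.1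
  obtain ⟨n, hxz, hfy⟩ := (preimage_near.and_eventually orbit_near).exists
  refine ⟨n, fun k hk => ?_⟩
  rw [dist_zero_right, norm_norm]
  calc ‖(P ^ k) (f - z)‖ ≤ ‖(P ^ n) (f - z)‖ := antitone_norm_pow_apply hP _ hk
    _ = ‖((P ^ n) f - y) + (P ^ n) (x n - z)‖ := by rw [map_sub, map_sub, hxy, sub_add_sub_cancel]
    _ ≤ ‖(P ^ n) f - y‖ + ‖x n - z‖ :=
        (norm_add_le _ _).trans (by gcongr; exact norm_pow_apply_le hP _ _)
    _ < ε := by linarith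

theorem exists_projection (hD : IsLasotaYorke P D) (hP : ∀ f, ‖P f‖ ≤ ‖f‖) :
    ∃ π : B →L[ℝ] hD.recurrent hP, ∀ f, Tendsto (fun n => (P ^ n) (f - π f)) atTop (𝓝 0) := by
  choose p hp hlim using hD.exists_recurrent_asymptotic hP
  have unique : ∀ {f x}, x ∈ recurrentSet P → Tendsto (fun n => (P ^ n) (f - x)) atTop (𝓝 0) →
      p f = x := fun {f x} hx h =>
    sub_eq_zero.1 <| eq_zero_of_recurrent_of_tendsto ((hD.recurrent hP).sub_mem (hp f) hx) <| by
      simpa [← map_sub] using h.sub (hlim f)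
  let π₀ : B →ₗ[ℝ] hD.recurrent hP :=
    { toFun := fun f => ⟨p f, hp f⟩
      map_add' := fun f g => Subtype.ext <| unique ((hD.recurrent hP).add_mem (hp f) (hp g)) <| by
        simpa only [← map_add, add_zero, sub_add_sub_comm] using! (hlim f).add (hlim g)
      map_smul' := fun t f => Subtype.ext <| unique ((hD.recurrent hP).smul_mem t (hp f)) <| by
        simpa only [← map_smul, smul_zero, smul_sub] using! (hlim f).const_smul t }
  have norm_le : ∀ f, ‖p f‖ ≤ ‖f‖ := fun f => by
    have bound_tendsto : Tendsto (fun n => ‖f‖ + ‖(P ^ n) (f - p f)‖) atTop (𝓝 ‖f‖) := by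
      simpa only [norm_zero, add_zero] using (hlim f).norm.const_add ‖f‖
    refine ge_of_tendsto' bound_tendsto fun n => ?_
    calc ‖p f‖ = ‖(P ^ n) f - (P ^ n) (f - p f)‖ := by
          rw [map_sub, sub_sub_cancel, norm_pow_apply_of_recurrent hP (hp f)]
      _ ≤ ‖f‖ + ‖(P ^ n) (f - p f)‖ :=
          (norm_sub_le _ _).trans (by gcongr; exact norm_pow_apply_le hP n f)
  exact ⟨π₀.mkContinuous 1 fun f => (norm_le f).trans_eq (one_mul _).symm, hlim⟩

end IsLasotaYorke

end Contraction

/-! ### Recurrent densities of a Markov operator -/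

section Markov

variable {B : Type*} [NormedAddCommGroup B] [NormedSpace ℝ B] [Lattice B]

/-- `P` is a Markov operator on an abstract `L¹` space: it is positive and preserves the norm of
positive vectors. The first two fields make the norm additive on the positive cone and the cone
stable under nonnegative scalars; they are properties of the space alone, bundled here because
Mathlib has neither a class of such spaces nor the second property as an instance for `Lp`. -/
structure IsMarkov (P : B →L[ℝ] B) : Prop where
  norm_add : ∀ {f g : B}, 0 ≤ f → 0 ≤ g → ‖f + g‖ = ‖f‖ + ‖g‖
  smul_nonneg : ∀ {t : ℝ} {f : B}, 0 ≤ t → 0 ≤ f → 0 ≤ t • f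
  map_nonneg : ∀ {f : B}, 0 ≤ f → 0 ≤ P f
  norm_map : ∀ {f : B}, 0 ≤ f → ‖P f‖ = ‖f‖

/-- The recurrent densities of `P`: the positive recurrent vectors of norm one. -/
def recurrentDensities (P : B →L[ℝ] B) : Set B := {f | f ∈ recurrentSet P ∧ 0 ≤ f ∧ ‖f‖ = 1}

/-- The extreme points of the convex set of recurrent densities. They turn out to be finitely many
disjoint densities that span the recurrent vectors and are permuted by `P`. -/
def extremeDensities (P : B →L[ℝ] B) : Set B := (recurrentDensities P).extremePoints ℝ

namespace IsMarkov

variable {P : B →L[ℝ] B} {D : ℝ≥0 → Set B}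

theorem abs_map_le [IsOrderedAddMonoid B] (hM : IsMarkov P) (f : B) : |P f| ≤ P |f| := by
  refine sup_le ?_ ?_
  · have map_sub_nonneg := hM.map_nonneg (sub_nonneg.2 (le_abs_self f))
    rwa [map_sub, sub_nonneg] at map_sub_nonneg
  · have map_sub_nonneg := hM.map_nonneg (sub_nonneg.2 (neg_le_abs f))
    rwa [map_sub, sub_nonneg, map_neg] at map_sub_nonneg

variable [HasSolidNorm B] [IsOrderedAddMonoid B]

theorem norm_map_le (hM : IsMarkov P) (f : B) : ‖P f‖ ≤ ‖f‖ := by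
  rw [← norm_abs_eq_norm f, ← hM.norm_map (abs_nonneg f)]
  exact norm_le_norm_of_abs_le_abs ((hM.abs_map_le f).trans (le_abs_self _))

theorem map_abs_of_norm_map_eq (hM : IsMarkov P) {f : B} (hf : ‖P f‖ = ‖f‖) :
    P |f| = |P f| := by
  have norm_eq := hM.norm_add (sub_nonneg.2 (hM.abs_map_le f)) (abs_nonneg (P f))
  rw [sub_add_cancel, hM.norm_map (abs_nonneg f), norm_abs_eq_norm, norm_abs_eq_norm, hf] at norm_eq
  exact sub_eq_zero.1 (norm_eq_zero.1 (by linarith))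

theorem map_abs_of_recurrent (hM : IsMarkov P) {f : B} (hf : f ∈ recurrentSet P) :
    P |f| = |P f| :=
  hM.map_abs_of_norm_map_eq (by
    simpa only [pow_one] using norm_pow_apply_of_recurrent hM.norm_map_le hf 1)

theorem pow_apply_abs_of_recurrent (hM : IsMarkov P) {f : B} (hf : f ∈ recurrentSet P) (n : ℕ) :
    (P ^ n) |f| = |(P ^ n) f| := by
  induction n generalizing f with
  | zero => simp only [pow_zero, one_apply_eq_self]
  | succ n ih =>
    rw [pow_succ, mul_apply_eq_comp, mul_apply_eq_comp, hM.map_abs_of_recurrent hf,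
      ih (map_mem_recurrentSet (Commute.refl P) hf)]

theorem abs_mem_recurrentSet (hM : IsMarkov P) {f : B} (hf : f ∈ recurrentSet P) :
    |f| ∈ recurrentSet P := by
  refine mem_recurrentSet_iff.2 fun ε hε n₀ => ?_
  obtain ⟨n, hn, h⟩ := mem_recurrentSet_iff.1 hf ε hε n₀
  refine ⟨n, hn, ?_⟩
  rw [hM.pow_apply_abs_of_recurrent hf]
  exact (norm_abs_sub_abs _ _).trans_lt h

variable [CompleteSpace B]

theorem inf_mem_recurrentSet (hM : IsMarkov P) (hD : IsLasotaYorke P D) {f g : B}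
    (hf : f ∈ recurrentSet P) (hg : g ∈ recurrentSet P) : f ⊓ g ∈ recurrentSet P := by
  let R := hD.recurrent hM.norm_map_le
  rw [inf_eq_half_smul_add_sub_abs_sub ℝ]
  exact R.smul_mem _ (R.sub_mem (R.add_mem hf hg) (hM.abs_mem_recurrentSet (R.sub_mem hg hf)))

theorem isCompact_recurrentDensities (hM : IsMarkov P) (hD : IsLasotaYorke P D) :
    IsCompact (recurrentDensities P) := by
  refine (hD.isCompact_recurrentSet_inter_closedBall hM.norm_map_le).of_isClosed_subset ?_ ?_
  · exact (isClosed_recurrentSet hM.norm_map_le).inter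
      ((isClosed_le continuous_const continuous_id).inter
        (isClosed_eq continuous_norm continuous_const))
  · rintro f ⟨hf, -, norm_f⟩
    exact ⟨hf, mem_closedBall_zero_iff.2 norm_f.le⟩

theorem convex_recurrentDensities (hM : IsMarkov P) (hD : IsLasotaYorke P D) :
    Convex ℝ (recurrentDensities P) := by
  rintro f ⟨hf, f_nonneg, norm_f⟩ g ⟨hg, g_nonneg, norm_g⟩ a b ha hb hab
  let R := hD.recurrent hM.norm_map_le
  have af_nonneg := hM.smul_nonneg ha f_nonneg
  have bg_nonneg := hM.smul_nonneg hb g_nonneg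
  refine ⟨R.add_mem (R.smul_mem a hf) (R.smul_mem b hg), add_nonneg af_nonneg bg_nonneg, ?_⟩
  rw [hM.norm_add af_nonneg bg_nonneg, norm_smul, norm_smul, norm_f, norm_g,
    Real.norm_of_nonneg ha, Real.norm_of_nonneg hb, mul_one, mul_one, hab]

theorem normalize_mem_recurrentDensities (hM : IsMarkov P) (hD : IsLasotaYorke P D) {f : B}
    (hf : f ∈ recurrentSet P) (f_nonneg : 0 ≤ f) (hne : f ≠ 0) :
    ‖f‖⁻¹ • f ∈ recurrentDensities P := by
  refine ⟨(hD.recurrent hM.norm_map_le).smul_mem _ hf,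
    hM.smul_nonneg (inv_nonneg.2 (norm_nonneg f)) f_nonneg, ?_⟩
  rw [norm_smul, norm_inv, norm_norm, inv_mul_cancel₀ (norm_ne_zero_iff.2 hne)]

theorem eq_norm_smul_of_le_extreme (hM : IsMarkov P) (hD : IsLasotaYorke P D) {e a : B}
    (he : e ∈ extremeDensities P) (ha : a ∈ recurrentSet P) (a_nonneg : 0 ≤ a) (hae : a ≤ e) :
    a = ‖a‖ • e := by
  obtain ⟨⟨e_recurrent, -, norm_e⟩, extreme⟩ := he
  rcases eq_or_ne a 0 with rfl | ha_ne
  · rw [norm_zero, zero_smul]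
  rcases eq_or_ne (e - a) 0 with h | hea_ne
  · rw [← sub_eq_zero.1 h, norm_e, one_smul]
  have mem_openSegment : e ∈ openSegment ℝ (‖a‖⁻¹ • a) (‖e - a‖⁻¹ • (e - a)) := by
    refine ⟨‖a‖, ‖e - a‖, norm_pos_iff.2 ha_ne, norm_pos_iff.2 hea_ne, ?_, ?_⟩
    · rw [← hM.norm_add a_nonneg (sub_nonneg.2 hae), add_sub_cancel, norm_e]
    · rw [smul_inv_smul₀ (norm_ne_zero_iff.2 ha_ne), smul_inv_smul₀ (norm_ne_zero_iff.2 hea_ne),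
        add_sub_cancel]
  have normalize_eq : ‖a‖⁻¹ • a = e := extreme
    (hM.normalize_mem_recurrentDensities hD ha a_nonneg ha_ne)
    (hM.normalize_mem_recurrentDensities hD
      ((hD.recurrent hM.norm_map_le).sub_mem e_recurrent ha) (sub_nonneg.2 hae) hea_ne)
    mem_openSegment
  exact (inv_smul_eq_iff₀ (norm_ne_zero_iff.2 ha_ne)).1 normalize_eq

theorem inf_eq_zero_of_extreme (hM : IsMarkov P) (hD : IsLasotaYorke P D) {e e' : B}
    (he : e ∈ extremeDensities P) (he' : e' ∈ extremeDensities P) (hne : e ≠ e') :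
    e ⊓ e' = 0 := by
  have inf_recurrent := hM.inf_mem_recurrentSet hD he.1.1 he'.1.1
  have inf_nonneg : 0 ≤ e ⊓ e' := le_inf he.1.2.1 he'.1.2.1
  by_contra h
  refine hne (smul_right_injective B (norm_ne_zero_iff.2 h) ?_)
  calc ‖e ⊓ e'‖ • e = e ⊓ e' :=
        (hM.eq_norm_smul_of_le_extreme hD he inf_recurrent inf_nonneg inf_le_left).symm
    _ = ‖e ⊓ e'‖ • e' := hM.eq_norm_smul_of_le_extreme hD he' inf_recurrent inf_nonneg inf_le_right

theorem norm_sub_eq_two_of_extreme (hM : IsMarkov P) (hD : IsLasotaYorke P D) {e e' : B}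
    (he : e ∈ extremeDensities P) (he' : e' ∈ extremeDensities P) (hne : e ≠ e') :
    ‖e - e'‖ = 2 := by
  have abs_sub_eq : |e - e'| = e' + e := by
    have two_inf := two_nsmul_inf_eq_add_sub_abs_sub e' e
    rw [inf_comm, hM.inf_eq_zero_of_extreme hD he he' hne, smul_zero] at two_inf
    exact (sub_eq_zero.1 two_inf.symm).symm
  rw [← norm_abs_eq_norm, abs_sub_eq, hM.norm_add he'.1.2.1 he.1.2.1, he.1.2.2, he'.1.2.2]
  exact one_add_one_eq_two

theorem finite_extremeDensities (hM : IsMarkov P) (hD : IsLasotaYorke P D) :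
    (extremeDensities P).Finite := by
  obtain ⟨t, ht, cover⟩ :=
    Metric.totallyBounded_iff.1 (hM.isCompact_recurrentDensities hD).totallyBounded 1 one_pos
  have exists_center : ∀ e ∈ extremeDensities P, ∃ y ∈ t, dist e y < 1 := fun e he => by
    simpa only [Set.mem_iUnion, Metric.mem_ball, exists_prop] using cover he.1
  choose! center center_mem dist_center using exists_center
  refine Set.Finite.of_injOn (fun e he => center_mem e he) (fun e he e' he' h => ?_) ht
  by_contra hne
  have dist_eq := hM.norm_sub_eq_two_of_extreme hD he he' hne
  rw [← dist_eq_norm] at dist_eq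
  have dist_center' := dist_center e' he'
  rw [← h] at dist_center'
  linarith [dist_triangle_right e e' (center e), dist_center e he]

theorem surjOn_recurrentDensities (hM : IsMarkov P) (hD : IsLasotaYorke P D) :
    Set.SurjOn P (recurrentDensities P) (recurrentDensities P) := by
  rintro x ⟨hx, x_nonneg, norm_x⟩
  obtain ⟨y, hy, rfl⟩ := hD.surjOn_recurrentSet hM.norm_map_le hx
  have abs_y : |y| = y := by
    refine hD.injOn_recurrentSet hM.norm_map_le (hM.abs_mem_recurrentSet hy) hy ?_
    rw [hM.map_abs_of_recurrent hy, abs_of_nonneg x_nonneg]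
  have y_nonneg : 0 ≤ y := abs_y ▸ abs_nonneg y
  exact ⟨y, ⟨hy, y_nonneg, by rw [← hM.norm_map y_nonneg, norm_x]⟩, rfl⟩

theorem mapsTo_extremeDensities (hM : IsMarkov P) (hD : IsLasotaYorke P D) :
    Set.MapsTo P (extremeDensities P) (extremeDensities P) := by
  rintro e ⟨⟨e_recurrent, e_nonneg, norm_e⟩, extreme⟩
  have hP := hM.norm_map_le
  refine ⟨⟨map_mem_recurrentSet (Commute.refl P) e_recurrent, hM.map_nonneg e_nonneg, ?_⟩, ?_⟩
  · rw [hM.norm_map e_nonneg, norm_e]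
  intro x hx z hz mem_openSegment
  obtain ⟨x, hx', rfl⟩ := hM.surjOn_recurrentDensities hD hx
  obtain ⟨z, hz', rfl⟩ := hM.surjOn_recurrentDensities hD hz
  obtain ⟨a, b, ha, hb, hab, h⟩ := mem_openSegment
  let R := hD.recurrent hP
  rw [← map_smul, ← map_smul, ← map_add] at h
  have combination_eq : a • x + b • z = e := hD.injOn_recurrentSet hP
    (R.add_mem (R.smul_mem a hx'.1) (R.smul_mem b hz'.1)) e_recurrent h
  rw [extreme hx' hz' ⟨a, b, ha, hb, hab, combination_eq⟩]

theorem recurrentDensities_subset_span (hM : IsMarkov P) (hD : IsLasotaYorke P D) :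
    recurrentDensities P ⊆ Submodule.span ℝ (extremeDensities P) := by
  have : FiniteDimensional ℝ (Submodule.span ℝ (extremeDensities P)) :=
    FiniteDimensional.span_of_finite ℝ (hM.finite_extremeDensities hD)
  rw [← closure_convexHull_extremePoints (hM.isCompact_recurrentDensities hD)
    (hM.convex_recurrentDensities hD)]
  exact closure_minimal (convexHull_min Submodule.subset_span (Submodule.convex _))
    (Submodule.closed_of_finiteDimensional _)

theorem recurrentSet_subset_span (hM : IsMarkov P) (hD : IsLasotaYorke P D) :
    recurrentSet P ⊆ Submodule.span ℝ (extremeDensities P) := by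
  intro f hf
  set S := Submodule.span ℝ (extremeDensities P)
  have mem_of_nonneg : ∀ {g}, g ∈ recurrentSet P → 0 ≤ g → g ∈ S := by
    intro g hg g_nonneg
    rcases eq_or_ne g 0 with rfl | hne
    · exact S.zero_mem
    · have normalize_mem := hM.recurrentDensities_subset_span hD
        (hM.normalize_mem_recurrentDensities hD hg g_nonneg hne)
      simpa only [smul_inv_smul₀ (norm_ne_zero_iff.2 hne)] using S.smul_mem ‖g‖ normalize_mem
  have abs_recurrent := hM.abs_mem_recurrentSet hf
  have abs_sub_mem := mem_of_nonneg ((hD.recurrent hM.norm_map_le).sub_mem abs_recurrent hf)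
    (sub_nonneg.2 (le_abs_self f))
  simpa only [S, sub_sub_cancel, SetLike.mem_coe] using
    S.sub_mem (mem_of_nonneg abs_recurrent (abs_nonneg f)) abs_sub_mem

theorem exists_functionals (hM : IsMarkov P) (hD : IsLasotaYorke P D)
    [Fintype (extremeDensities P)] :
    ∃ lam : extremeDensities P → (B →L[ℝ] ℝ), ∀ f,
      Tendsto (fun n => (P ^ n) (f - ∑ e, lam e f • (e : B))) atTop (𝓝 0) := by
  have hP := hM.norm_map_le
  let R := hD.recurrent hP
  have : FiniteDimensional ℝ R := hD.finiteDimensional_recurrent hP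
  obtain ⟨π, hπ⟩ := hD.exists_projection hP
  let combination : (extremeDensities P → ℝ) →ₗ[ℝ] R :=
    Fintype.linearCombination ℝ fun e => (⟨e, e.2.1.1⟩ : R)
  have coe_combination : ∀ a, (combination a : B) = ∑ e, a e • (e : B) := fun a => by
    simp [combination, Fintype.linearCombination_apply]
  have range_combination : LinearMap.range combination = ⊤ := by
    refine LinearMap.range_eq_top.2 fun f => ?_
    have mem_span := hM.recurrentSet_subset_span hD f.2
    rw [← Subtype.range_coe (s := extremeDensities P)] at mem_span
    obtain ⟨a, ha⟩ := (Submodule.mem_span_range_iff_exists_fun ℝ).1 mem_span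
    exact ⟨a, Subtype.ext ((coe_combination a).trans ha)⟩
  obtain ⟨coords, hcoords⟩ := combination.exists_rightInverse_of_surjective range_combination
  refine ⟨fun e => (ContinuousLinearMap.proj e).comp
    ((LinearMap.toContinuousLinearMap coords).comp π), fun f => ?_⟩
  have sum_coords : ∑ e, coords (π f) e • (e : B) = π f := by
    rw [← coe_combination]
    exact congrArg Subtype.val (LinearMap.congr_fun hcoords (π f))
  have lim := hπ f
  rw [← sum_coords] at lim
  exact lim

end IsMarkov

end Markov

/-! ### Cycles of a permutation -/

section Cycles

variable {α : Type*}

theorem exists_sameCycle_representatives [Finite α] (p : Equiv.Perm α) :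
    ∃ (l : ℕ) (x : Fin l → α), ∀ y, ∃! i, p.SameCycle (x i) y := by
  let s := Equiv.Perm.SameCycle.setoid p
  obtain ⟨l, ⟨q⟩⟩ := Finite.exists_equiv_fin (Quotient s)
  refine ⟨l, fun i => (q.symm i).out, fun y => ⟨q ⟦y⟧, ?_, fun i hi => ?_⟩⟩
  · dsimp only
    rw [Equiv.symm_apply_apply]
    exact Quotient.mk_out y
  · rw [← Quotient.sound hi, Quotient.out_eq, Equiv.apply_symm_apply]

theorem bijective_iterate_of_sameCycle_representatives [Finite α] {p : Equiv.Perm α} {l : ℕ}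
    {x : Fin l → α} (hx : ∀ y, ∃! i, p.SameCycle (x i) y) :
    Function.Bijective fun a : Σ i, Fin (Function.minimalPeriod p (x i)) => p^[a.2] (x a.1) := by
  refine ⟨?_, fun y => ?_⟩
  · rintro ⟨i, j⟩ ⟨i', j'⟩ h
    have sameCycle : ∀ i (n : ℕ), p.SameCycle (x i) (p^[n] (x i)) := fun i n => ⟨n, by
      rw [zpow_natCast, Equiv.Perm.iterate_eq_pow]⟩
    obtain rfl : i = i' := (hx (p^[j] (x i))).unique (sameCycle i j) (by
      simpa only [h] using sameCycle i' j')
    rw [Fin.ext (Function.iterate_injOn_Iio_minimalPeriod j.2 j'.2 h)]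
  · obtain ⟨i, hi, -⟩ := hx y
    obtain ⟨n, -, rfl⟩ := hi.exists_pow_eq'
    have period_pos := Function.minimalPeriod_pos_of_mem_periodicPts
      (p.injective.mem_periodicPts (x i))
    refine ⟨⟨i, n % _, Nat.mod_lt _ period_pos⟩, ?_⟩
    rw [← Equiv.Perm.iterate_eq_pow]
    exact Function.iterate_mod_minimalPeriod_eq

theorem iterate_finRotate_minimalPeriod (f : α → α) (x : α)
    (j : Fin (Function.minimalPeriod f x)) : f^[finRotate _ j] x = f (f^[j] x) := by
  have := j.neZero
  rw [finRotate_apply, Fin.val_add, Fin.val_one', Nat.add_mod_mod,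
    Function.iterate_mod_minimalPeriod_eq, Function.iterate_succ_apply']

theorem exists_cycle_enumeration [Finite α] (p : Equiv.Perm α) :
    ∃ (l : ℕ) (r : Fin l → ℕ) (e : (Σ i, Fin (r i)) ≃ α), (∀ i, 0 < r i) ∧
      ∀ i j, e ⟨i, finRotate (r i) j⟩ = p (e ⟨i, j⟩) := by
  obtain ⟨l, x, hx⟩ := exists_sameCycle_representatives p
  exact ⟨l, fun i => Function.minimalPeriod p (x i),
    Equiv.ofBijective _ (bijective_iterate_of_sameCycle_representatives hx),
    fun i => Function.minimalPeriod_pos_of_mem_periodicPts (p.injective.mem_periodicPts (x i)),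
    fun i j => iterate_finRotate_minimalPeriod p (x i) j⟩

end Cycles

/-! ### Asymptotic periodicity -/

section AsymptoticPeriodicity

variable {X : Type*} [MeasurableSpace X] {μ : Measure X}

theorem coeFn_sub_sum_smul {ι : Type*} [Fintype ι] (a : ι → ℝ) (f : Lp ℝ 1 μ)
    {G : ι → Lp ℝ 1 μ} {u : ι → X → ℝ} (hG : ∀ i, G i =ᵐ[μ] u i) :
    ((f - ∑ i, a i • G i : Lp ℝ 1 μ) : X → ℝ) =ᵐ[μ] fun x => f x - ∑ i, a i * u i x := by
  have smul_eq : ∀ᵐ x ∂μ, ∀ i, (a i • G i : Lp ℝ 1 μ) x = a i * u i x := by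
    rw [ae_all_iff]
    intro i
    filter_upwards [Lp.coeFn_smul (a i) (G i), hG i] with x hsmul hu
    rw [hsmul, Pi.smul_apply, hu, smul_eq_mul]
  filter_upwards [Lp.coeFn_sub f (∑ i, a i • G i),
    Lp.coeFn_finsetSum Finset.univ fun i => a i • G i, smul_eq] with x hsub hsum hsmul
  rw [hsub, Pi.sub_apply, hsum, Finset.sum_apply, Finset.sum_congr rfl fun i _ => hsmul i]

theorem mul_ae_eq_zero_of_inf_eq_zero {f g : Lp ℝ 1 μ} (h : f ⊓ g = 0) :
    (fun x => f x * g x) =ᵐ[μ] 0 := by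
  have coeFn_inf := Lp.coeFn_inf f g
  rw [h] at coeFn_inf
  filter_upwards [coeFn_inf, Lp.coeFn_zero ℝ 1 μ] with x hinf hzero
  have min_eq_zero : min (f x) (g x) = 0 := hinf.symm.trans hzero
  rcases min_choice (f x) (g x) with h | h
  · rw [← h, min_eq_zero, zero_mul, Pi.zero_apply]
  · rw [← h, min_eq_zero, mul_zero, Pi.zero_apply]

variable {T : X → X} [IsFiniteMeasure μ]

theorem isMarkov_transferCLM (hT : Measure.QuasiMeasurePreserving T μ μ) :
    IsMarkov (transferCLM hT) where
  norm_add := L1_norm_add_of_nonneg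
  smul_nonneg {t f} ht hf := by
    rw [← Lp.coeFn_nonneg] at hf ⊢
    filter_upwards [hf, Lp.coeFn_smul t f] with x hx hsmul
    rw [hsmul]
    exact mul_nonneg ht hx
  map_nonneg := transferCLM_nonneg hT
  norm_map := norm_transferCLM_of_nonneg hT

theorem eLpNorm_transferOp_iterate (hT : Measure.QuasiMeasurePreserving T μ μ) {f : Lp ℝ 1 μ}
    {u : X → ℝ} (h : f =ᵐ[μ] u) (n : ℕ) :
    eLpNorm ((transferOp T μ)^[n] u) 1 μ = ENNReal.ofReal ‖(transferCLM hT ^ n) f‖ := by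
  rw [← eLpNorm_congr_ae (coeFn_transferCLM_pow hT n h), Lp.norm_def,
    ENNReal.ofReal_toReal (Lp.eLpNorm_ne_top _)]

theorem IsLasotaYorke.exists_asymptoticallyPeriodic (hT : Measure.QuasiMeasurePreserving T μ μ)
    {D : ℝ≥0 → Set (Lp ℝ 1 μ)} (hD : IsLasotaYorke (transferCLM hT) D) :
    ∃ (l : ℕ) (r : Fin l → ℕ) (g : (i : Fin l) → Fin (r i) → X → ℝ)
      (lam : (i : Fin l) → Fin (r i) → (Lp ℝ 1 μ →L[ℝ] ℝ)),
      IsAsymptoticallyPeriodicWith T μ r g lam := by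
  have hM := isMarkov_transferCLM hT
  let E := extremeDensities (transferCLM hT)
  have mapsTo : Set.MapsTo (transferCLM hT) E E := hM.mapsTo_extremeDensities hD
  have : Fintype E := (hM.finite_extremeDensities hD).fintype
  obtain ⟨lam, hlam⟩ := hM.exists_functionals hD
  have injOn : Set.InjOn (transferCLM hT) E :=
    (hD.injOn_recurrentSet hM.norm_map_le).mono fun e he => he.1.1
  let p : Equiv.Perm E := Equiv.ofBijective (mapsTo.restrict _ _ _)
    (Finite.injective_iff_bijective.1 (mapsTo.restrict_inj.2 injOn))
  obtain ⟨l, r, e, r_pos, e_finRotate⟩ := exists_cycle_enumeration p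
  refine ⟨l, r, fun i j => ((e ⟨i, j⟩ : Lp ℝ 1 μ) : X → ℝ), fun i j => lam (e ⟨i, j⟩), r_pos,
    fun i j => L1.integrable_coeFn _, fun i j => (Lp.coeFn_nonneg _).2 (e ⟨i, j⟩).2.1.2.1,
    fun i j => ?_, fun a b hab => ?_, fun i j => ?_, fun f => ?_⟩
  · rw [← L1_norm_eq_integral_of_nonneg (e ⟨i, j⟩).2.1.2.1, (e ⟨i, j⟩).2.1.2.2]
  · exact mul_ae_eq_zero_of_inf_eq_zero (hM.inf_eq_zero_of_extreme hD (e a).2 (e b).2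
      fun h => hab (e.injective (Subtype.ext h)))
  · rw [e_finRotate]
    exact (coeFn_transferCLM hT _).symm
  · have remainder_ae_eq := coeFn_sub_sum_smul (fun a => lam (e a) f) f
      fun a => EventuallyEq.refl (ae μ) ((e a : Lp ℝ 1 μ) : X → ℝ)
    simp only [Fintype.sum_sigma] at remainder_ae_eq
    simp only [eLpNorm_transferOp_iterate hT remainder_ae_eq]
    have remainder_tendsto := hlam f
    rw [← Equiv.sum_comp e, Fintype.sum_sigma] at remainder_tendsto
    simpa only [ENNReal.ofReal_zero] using
      ENNReal.tendsto_ofReal (tendsto_zero_iff_norm_tendsto_zero.1 remainder_tendsto)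

end AsymptoticPeriodicity

/-! ### Exponential decay -/

section Decay

theorem exists_geometric_bound_of_antitone {a : ℕ → ℝ} (ha : Antitone a) {n₀ : ℕ} (hn₀ : 0 < n₀)
    {c : ℝ} (hc : 0 ≤ c) (bound : ∀ k, a (n₀ * k) ≤ c / 2 ^ k) :
    ∃ C ≥ 0, ∃ θ ∈ Set.Ico (0 : ℝ) 1, ∀ n, a n ≤ C * θ ^ n := by
  obtain ⟨θ, hθ, hθ_pow⟩ : ∃ θ ∈ Set.Ico (0 : ℝ) 1, θ ^ n₀ = 1 / 2 :=
    ⟨(1 / 2) ^ (n₀⁻¹ : ℝ),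
      ⟨by positivity, Real.rpow_lt_one (by norm_num) (by norm_num) (by positivity)⟩,
      Real.rpow_inv_natCast_pow (by norm_num) hn₀.ne'⟩
  refine ⟨2 * c, by positivity, θ, hθ, fun n => ?_⟩
  have half_le : 1 / 2 ≤ θ ^ (n % n₀) := by
    rw [← hθ_pow]
    exact pow_le_pow_of_le_one hθ.1 hθ.2.le (Nat.mod_lt _ hn₀).le
  calc a n ≤ a (n₀ * (n / n₀)) := ha (Nat.mul_div_le n n₀)
    _ ≤ c / 2 ^ (n / n₀) := bound _
    _ = 2 * c * ((θ ^ n₀) ^ (n / n₀) * (1 / 2)) := by rw [hθ_pow, one_div_pow]; ring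
    _ ≤ 2 * c * ((θ ^ n₀) ^ (n / n₀) * θ ^ (n % n₀)) := by
      have := hθ.1
      gcongr
    _ = 2 * c * θ ^ n := by rw [← pow_mul, ← pow_add, Nat.div_add_mod]

variable {B : Type*} [NormedAddCommGroup B] [NormedSpace ℝ B] {P : B →L[ℝ] B}

theorem pow_mul_apply_of_pow_apply_eq {R : ℕ} {φ : B} (hφ : (P ^ R) φ = φ) (k : ℕ) :
    (P ^ (R * k)) φ = φ := by
  rw [pow_mul, pow_apply_eq_iterate, Function.iterate_fixed hφ]

theorem tendsto_pow_mul_apply {R : ℕ} (hR : 0 < R) {f φ : B} (hφ : (P ^ R) φ = φ)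
    (hlim : Tendsto (fun n => (P ^ n) (f - φ)) atTop (𝓝 0)) :
    Tendsto (fun k => (P ^ (R * k)) f) atTop (𝓝 φ) := by
  have := (hlim.comp (tendsto_id.const_mul_atTop' hR)).add_const φ
  simpa only [Function.comp_def, id, map_sub, pow_mul_apply_of_pow_apply_eq hφ, sub_add_cancel,
    zero_add] using this

theorem map_sum_pow_apply {R : ℕ} {φ : B} (hφ : (P ^ R) φ = φ) :
    P (∑ i ∈ Finset.range R, (P ^ i) φ) = ∑ i ∈ Finset.range R, (P ^ i) φ := by
  have shift := Finset.sum_range_succ' (fun i => (P ^ i) φ) R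
  rw [Finset.sum_range_succ, hφ, pow_zero, one_apply_eq_self] at shift
  simpa only [map_sum, pow_succ', mul_apply_eq_comp] using (add_right_cancel shift).symm

namespace IsLasotaYorke

variable {D : ℝ≥0 → Set B}

theorem exists_pow_mul_apply_mem_div (hD : IsLasotaYorke P D) (hP : ∀ f, ‖P f‖ ≤ ‖f‖) :
    ∃ n₀, 0 < n₀ ∧ ∀ c, ∀ f ∈ D c, Tendsto (fun n => (P ^ n) f) atTop (𝓝 0) →
      ∀ k, (P ^ (n₀ * k)) f ∈ D (c / 2 ^ k) := by
  obtain ⟨n₀, hn₀, mem_half⟩ := hD.exists_pow_apply_mem_half hP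
  refine ⟨n₀, hn₀, fun c f hf hlim k => ?_⟩
  induction k with
  | zero => simpa using hf
  | succ k ih =>
    have := mem_half _ _ ih (by
      simpa only [pow_add_apply] using (tendsto_add_atTop_iff_nat (n₀ * k)).2 hlim)
    rwa [← pow_add_apply, div_div, ← pow_succ, add_comm n₀, ← mul_add_one] at this

theorem exists_geometric_bound (hD : IsLasotaYorke P D) (hP : ∀ f, ‖P f‖ ≤ ‖f‖)
    {c : ℝ≥0} {f : B} (hf : f ∈ D c) (hlim : Tendsto (fun n => (P ^ n) f) atTop (𝓝 0)) :
    ∃ C ≥ 0, ∃ θ ∈ Set.Ico (0 : ℝ) 1, ∀ n, ‖(P ^ n) f‖ ≤ C * θ ^ n := by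
  obtain ⟨n₀, hn₀, mem_div⟩ := hD.exists_pow_mul_apply_mem_div hP
  refine exists_geometric_bound_of_antitone (antitone_norm_pow_apply hP f) hn₀ c.coe_nonneg
    fun k => ?_
  exact_mod_cast hD.nnnorm_le (mem_div c f hf hlim k)

theorem exists_sub_mem_of_tendsto (hD : IsLasotaYorke P D) (hP : ∀ f, ‖P f‖ ≤ ‖f‖)
    {c : ℝ≥0} {f φ : B} (hf : f ∈ D c) {R : ℕ}
    (hlim : Tendsto (fun k => (P ^ (R * k)) f) atTop (𝓝 φ)) : ∃ c', f - φ ∈ D c' := by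
  obtain ⟨K, orbit_mem⟩ := hD.exists_orbit_subset hP
  have hφ : φ ∈ D (K * c) := (hD.isClosed _).mem_of_tendsto hlim
    (Eventually.of_forall fun k => orbit_mem c f hf (R * k))
  have hsub := hD.add_mem hf (hD.smul_mem (-1) hφ)
  rw [neg_one_smul, ← sub_eq_add_neg] at hsub
  exact ⟨_, hsub⟩

end IsLasotaYorke

end Decay

/-! ### Periodic parts -/

section Periodic

theorem finRotate_iterate_self (n : ℕ) (j : Fin n) : (finRotate n)^[n] j = j := by
  have := j.neZero
  have finRotate_eq : ⇑(finRotate n) = (· + 1) := funext finRotate_apply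
  have n_smul_one : n • (1 : Fin n) = 0 := by simpa using card_nsmul_eq_zero' (x := (1 : Fin n))
  rw [finRotate_eq, add_right_iterate_apply, n_smul_one, add_zero]

theorem iterate_apply_of_map_eq_finRotate {α : Type*} {F : α → α} {n : ℕ} {G : Fin n → α}
    (hG : ∀ j, F (G j) = G (finRotate n j)) {m : ℕ} (hnm : n ∣ m) (j : Fin n) :
    F^[m] (G j) = G j := by
  have semiconj : Function.Semiconj G (finRotate n) F := fun j => (hG j).symm
  have periodic : Function.IsPeriodicPt F n (G j) := by
    rw [Function.IsPeriodicPt, Function.IsFixedPt, ← semiconj.iterate_right n j,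
      finRotate_iterate_self]
  exact periodic.trans_dvd hnm

variable {X : Type*} [MeasurableSpace X] {T : X → X} {μ : Measure X} [IsFiniteMeasure μ]

theorem IsAsymptoticallyPeriodicWith.exists_periodic {l : ℕ} {r : Fin l → ℕ}
    {g : (i : Fin l) → Fin (r i) → X → ℝ} {lam : (i : Fin l) → Fin (r i) → (Lp ℝ 1 μ →L[ℝ] ℝ)}
    (hA : IsAsymptoticallyPeriodicWith T μ r g lam) (hT : Measure.QuasiMeasurePreserving T μ μ)
    (f : Lp ℝ 1 μ) : ∃ φ, (transferCLM hT ^ (∏ i, r i)) φ = φ ∧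
      Tendsto (fun n => (transferCLM hT ^ n) (f - φ)) atTop (𝓝 0) := by
  let G : (i : Fin l) → Fin (r i) → Lp ℝ 1 μ := fun i j => (hA.integrable i j).toL1 _
  have hG : ∀ i j, G i j =ᵐ[μ] g i j := fun i j => (hA.integrable i j).coeFn_toL1
  have map_G : ∀ i j, transferCLM hT (G i j) = G i (finRotate (r i) j) := fun i j => by
    refine Lp.ext ((coeFn_transferCLM hT _).trans ?_)
    rw [transferOp_congr T (hG i j)]
    exact (hA.cyclic i j).trans (hG i _).symm
  refine ⟨∑ p : Σ i, Fin (r i), lam p.1 p.2 f • G p.1 p.2, ?_, ?_⟩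
  · rw [map_sum]
    refine Finset.sum_congr rfl fun p _ => ?_
    rw [map_smul, pow_apply_eq_iterate, iterate_apply_of_map_eq_finRotate (map_G p.1)
      (Finset.dvd_prod_of_mem r (Finset.mem_univ p.1))]
  · have coeFn_sub := coeFn_sub_sum_smul (fun p : Σ i, Fin (r i) => lam p.1 p.2 f) f
      (fun p => hG p.1 p.2)
    simp only [Fintype.sum_sigma] at coeFn_sub ⊢
    have tendsto_ofReal := hA.tendsto f
    simp only [eLpNorm_transferOp_iterate hT coeFn_sub] at tendsto_ofReal
    rw [tendsto_zero_iff_norm_tendsto_zero]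
    simpa only [ENNReal.toReal_ofReal (norm_nonneg _), ENNReal.toReal_zero, Function.comp_def]
      using (ENNReal.tendsto_toReal ENNReal.zero_ne_top).comp tendsto_ofReal

end Periodic

/-! ### Absolutely continuous measures -/

section Density

variable {X : Type*} [MeasurableSpace X] {T : X → X} {μ ν : Measure X} [IsFiniteMeasure μ]
  [IsFiniteMeasure ν]

theorem exists_density_embedding (hνμ : ν ≪ μ) :
    ∃ (J : Lp ℝ 1 ν →ₗᵢ[ℝ] Lp ℝ 1 μ) (ρ : X → ℝ),
      (∀ (f : Lp ℝ 1 ν) (u : X → ℝ), f =ᵐ[ν] u → J f =ᵐ[μ] fun x => ρ x * u x) ∧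
      ∀ (f : Lp ℝ 1 ν) (A : Set X), MeasurableSet A →
        ∫ x in A, J f x ∂μ = ∫ x in A, f x ∂ν := by
  obtain ⟨ρ, hρ, rfl⟩ : ∃ ρ : X → ℝ≥0, Measurable ρ ∧ μ.withDensity (fun x => ρ x) = ν := by
    refine ⟨fun x => (ν.rnDeriv μ x).toNNReal,
      (Measure.measurable_rnDeriv ν μ).ennreal_toNNReal, ?_⟩
    conv_rhs => rw [← Measure.withDensity_rnDeriv_eq ν μ hνμ]
    refine withDensity_congr_ae ?_
    filter_upwards [Measure.rnDeriv_ne_top ν μ] with x hx using ENNReal.coe_toNNReal hx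
  have coeFn_map : ∀ f : Lp ℝ 1 (μ.withDensity fun x => ρ x),
      withDensitySMulLI (E := ℝ) μ hρ f =ᵐ[μ] fun x => ρ x * f x := fun f =>
    (memL1_smul_of_L1_withDensity hρ f).coeFn_toLp
  refine ⟨withDensitySMulLI μ hρ, fun x => ρ x, fun f u hfu => ?_, fun f A hA => ?_⟩
  · filter_upwards [coeFn_map f, (ae_withDensity_iff hρ.coe_nnreal_ennreal).1 hfu]
      with x map_eq apply_eq
    rw [map_eq]
    by_cases hρx : ρ x = 0
    · simp [hρx]
    · rw [apply_eq (by simpa using hρx)]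
  · rw [setIntegral_withDensity_eq_setIntegral_smul hρ _ hA]
    exact integral_congr_ae (ae_restrict_of_ae (coeFn_map f))

theorem map_transferCLM_pow_of_setIntegral (hT : Measure.QuasiMeasurePreserving T μ μ)
    (hTν : Measure.QuasiMeasurePreserving T ν ν) {J : Lp ℝ 1 ν → Lp ℝ 1 μ}
    (hJ : ∀ (f : Lp ℝ 1 ν) (A : Set X), MeasurableSet A →
      ∫ x in A, J f x ∂μ = ∫ x in A, f x ∂ν) (n : ℕ) (f : Lp ℝ 1 ν) :
    J ((transferCLM hTν ^ n) f) = (transferCLM hT ^ n) (J f) := by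
  have semiconj : Function.Semiconj J (transferCLM hTν) (transferCLM hT) := fun f => by
    refine Lp.ext (Integrable.ae_eq_of_forall_setIntegral_eq _ _ (L1.integrable_coeFn _)
      (L1.integrable_coeFn _) fun A hA _ => ?_)
    rw [hJ _ A hA, setIntegral_transferCLM hTν f hA, setIntegral_transferCLM hT _ hA,
      hJ _ _ (hT.measurable hA)]
  simpa only [pow_apply_eq_iterate] using semiconj.iterate_right n f

end Density

/-! ### Integrals over invariant sets -/

section Invariant

variable {X : Type*} [MeasurableSpace X] {T : X → X} {ν : Measure X}

/-- Integration over `A`, as a bounded linear functional on `L¹(ν)`. -/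
def setIntegralCLM (ν : Measure X) (A : Set X) : Lp ℝ 1 ν →L[ℝ] ℝ :=
  (L1.integralCLM' ℝ).comp (LpToLpRestrictCLM X ℝ ℝ ν 1 A)

theorem setIntegralCLM_apply (A : Set X) (f : Lp ℝ 1 ν) :
    setIntegralCLM ν A f = ∫ x in A, f x ∂ν := by
  rw [← integral_congr_ae (LpToLpRestrictCLM_coeFn ℝ A f), ← L1.integral_eq_integral,
    L1.integral_eq]
  rfl

/-- The subspace of all `f` in `L¹(ν)` whose integral over every `ν`-almost invariant set vanishes;
if `ν` is a `T`-invariant probability measure, these are the `f` with `E_ν(f | 𝓘) = 0`. -/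
def zeroInvariantMean (T : X → X) (ν : Measure X) : Submodule ℝ (Lp ℝ 1 ν) :=
  ⨅ (A : Set X) (_ : MeasurableSet A) (_ : T ⁻¹' A =ᵐ[ν] A), (setIntegralCLM ν A).ker

theorem mem_zeroInvariantMean_iff {f : Lp ℝ 1 ν} : f ∈ zeroInvariantMean T ν ↔
    ∀ A, MeasurableSet A → T ⁻¹' A =ᵐ[ν] A → setIntegralCLM ν A f = 0 := by
  simp only [zeroInvariantMean, Submodule.mem_iInf, LinearMap.mem_ker, ContinuousLinearMap.coe_coe]

theorem nonpos_of_setIntegral_pos_eq_zero {u : Lp ℝ 1 ν}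
    (hu : ∫ x in {x | 0 < u x}, u x ∂ν = 0) : u ≤ 0 := by
  have hA : MeasurableSet {x | 0 < u x} :=
    measurableSet_lt measurable_const (Lp.stronglyMeasurable u).measurable
  rw [setIntegral_eq_zero_iff_of_nonneg_ae
    ((ae_restrict_iff' hA).2 (Eventually.of_forall fun x (hx : 0 < u x) => hx.le))
    (L1.integrable_coeFn u).integrableOn, Filter.EventuallyEq, ae_restrict_iff' hA] at hu
  rw [← Lp.coeFn_le]
  filter_upwards [hu, Lp.coeFn_zero ℝ 1 ν] with x hx zero_apply
  rw [zero_apply]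
  by_contra hpos
  exact hpos (hx (not_le.1 hpos)).le

variable [IsFiniteMeasure ν]

theorem setIntegralCLM_transferCLM_pow (hT : Measure.QuasiMeasurePreserving T ν ν) {A : Set X}
    (hA : MeasurableSet A) (hTA : T ⁻¹' A =ᵐ[ν] A) (n : ℕ) (f : Lp ℝ 1 ν) :
    setIntegralCLM ν A ((transferCLM hT ^ n) f) = setIntegralCLM ν A f := by
  induction n with
  | zero => rw [pow_zero, one_apply_eq_self]
  | succ n ih =>
    rw [pow_succ', mul_apply_eq_comp, setIntegralCLM_apply, setIntegral_transferCLM hT _ hA,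
      setIntegral_congr_set hTA, ← setIntegralCLM_apply, ih]

theorem mem_zeroInvariantMean_of_tendsto (hT : Measure.QuasiMeasurePreserving T ν ν)
    {f : Lp ℝ 1 ν} (hlim : Tendsto (fun n => (transferCLM hT ^ n) f) atTop (𝓝 0)) :
    f ∈ zeroInvariantMean T ν := by
  refine mem_zeroInvariantMean_iff.2 fun A hA hTA => ?_
  have tendsto_integral := ((setIntegralCLM ν A).continuous.tendsto 0).comp hlim
  simp only [Function.comp_def, setIntegralCLM_transferCLM_pow hT hA hTA, map_zero]
    at tendsto_integral
  exact tendsto_nhds_unique tendsto_const_nhds tendsto_integral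

theorem toL1_mem_zeroInvariantMean (hν : MeasurePreserving T ν ν) {h : X → ℝ}
    (hh : Integrable h ν) (hcond : ν[h | MeasurableSpace.invariants T] =ᵐ[ν] 0) :
    hh.toL1 h ∈ zeroInvariantMean T ν := by
  refine mem_zeroInvariantMean_iff.2 fun A hA hTA => ?_
  obtain ⟨A', hA', hA'A, invariant⟩ :=
    hν.quasiMeasurePreserving.exists_preimage_eq_of_preimage_ae hA.nullMeasurableSet hTA
  calc setIntegralCLM ν A (hh.toL1 h)
    _ = ∫ x in A, h x ∂ν := by
      rw [setIntegralCLM_apply]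
      exact integral_congr_ae (ae_restrict_of_ae hh.coeFn_toL1)
    _ = ∫ x in A', (ν[h | MeasurableSpace.invariants T]) x ∂ν := by
      rw [← setIntegral_congr_set hA'A, setIntegral_condExp (MeasurableSpace.invariants_le T) hh
        (MeasurableSpace.measurableSet_invariants.2 ⟨hA', invariant⟩)]
    _ = 0 := setIntegral_eq_zero_of_ae_eq_zero (hcond.mono fun x hx _ => hx)

theorem preimage_pos_ae_eq_of_fixed (hν : MeasurePreserving T ν ν) {v : Lp ℝ 1 ν}
    (v_nonneg : 0 ≤ v) (hv : transferCLM hν.quasiMeasurePreserving v = v) :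
    T ⁻¹' {x | 0 < v x} =ᵐ[ν] {x | 0 < v x} := by
  rw [← Lp.coeFn_nonneg] at v_nonneg
  set A : Set X := {x | 0 < v x}
  have hA : MeasurableSet A :=
    measurableSet_lt measurable_const (Lp.stronglyMeasurable v).measurable
  have integral_eq_zero : ∫ x in T ⁻¹' Aᶜ, v x ∂ν = 0 := by
    rw [← setIntegral_transferCLM hν.quasiMeasurePreserving v hA.compl, hv]
    refine setIntegral_eq_zero_of_ae_eq_zero ?_
    filter_upwards [v_nonneg] with x hx hxA
    exact le_antisymm (not_lt.1 (show ¬0 < v x from hxA)) hx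
  have ae_eq_zero := (setIntegral_eq_zero_iff_of_nonneg_ae (ae_restrict_of_ae v_nonneg)
    (L1.integrable_coeFn v).integrableOn).1 integral_eq_zero
  rw [Filter.EventuallyEq, ae_restrict_iff' (hν.measurable hA.compl)] at ae_eq_zero
  have ae_subset : A ≤ᵐ[ν] T ⁻¹' A := by
    filter_upwards [ae_eq_zero] with x hx hxA
    by_contra hTx
    exact hxA.ne' (hx hTx)
  exact (ae_eq_of_ae_subset_of_measure_ge ae_subset
    (hν.measure_preimage hA.nullMeasurableSet).le hA.nullMeasurableSet (measure_ne_top _ _)).symm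

theorem nonpos_of_fixed_of_mem_zeroInvariantMean (hν : MeasurePreserving T ν ν) {u : Lp ℝ 1 ν}
    (hu : transferCLM hν.quasiMeasurePreserving u = u) (hmem : u ∈ zeroInvariantMean T ν) :
    u ≤ 0 := by
  have map_abs : transferCLM hν.quasiMeasurePreserving |u| = |u| := by
    rw [(isMarkov_transferCLM hν.quasiMeasurePreserving).map_abs_of_norm_map_eq (congrArg norm hu),
      hu]
  have invariant := preimage_pos_ae_eq_of_fixed hν (neg_le_iff_add_nonneg.1 (neg_le_abs u))
    (by rw [map_add, map_abs, hu])
  have pos_iff : {x | 0 < (|u| + u : Lp ℝ 1 ν) x} =ᵐ[ν] {x | 0 < u x} := by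
    filter_upwards [Lp.coeFn_add |u| u, Lp.coeFn_abs u] with x coeFn_add coeFn_abs
    refine propext ?_
    change 0 < (|u| + u : Lp ℝ 1 ν) x ↔ 0 < u x
    rw [coeFn_add, Pi.add_apply, coeFn_abs]
    rcases abs_cases (u x) with h | h <;> constructor <;> intro <;> linarith
  refine nonpos_of_setIntegral_pos_eq_zero ?_
  rw [← setIntegral_congr_set pos_iff, ← setIntegralCLM_apply]
  exact mem_zeroInvariantMean_iff.1 hmem _
    (measurableSet_lt measurable_const (Lp.stronglyMeasurable _).measurable) invariant

theorem eq_zero_of_fixed_of_mem_zeroInvariantMean (hν : MeasurePreserving T ν ν) {u : Lp ℝ 1 ν}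
    (hu : transferCLM hν.quasiMeasurePreserving u = u) (hmem : u ∈ zeroInvariantMean T ν) :
    u = 0 :=
  (nonpos_of_fixed_of_mem_zeroInvariantMean hν hu hmem).antisymm <| neg_nonpos.1 <|
    nonpos_of_fixed_of_mem_zeroInvariantMean hν (by rw [map_neg, hu]) (neg_mem hmem)

theorem sum_transferCLM_pow_eq_zero (hν : MeasurePreserving T ν ν) {H w : Lp ℝ 1 ν}
    (hH : H ∈ zeroInvariantMean T ν) {R : ℕ}
    (hw : (transferCLM hν.quasiMeasurePreserving ^ R) w = w)
    (hlim : Tendsto (fun n => (transferCLM hν.quasiMeasurePreserving ^ n) (H - w)) atTop (𝓝 0)) :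
    ∑ i ∈ Finset.range R, (transferCLM hν.quasiMeasurePreserving ^ i) w = 0 := by
  have w_mem : w ∈ zeroInvariantMean T ν := by
    simpa only [sub_sub_cancel] using sub_mem hH (mem_zeroInvariantMean_of_tendsto _ hlim)
  refine eq_zero_of_fixed_of_mem_zeroInvariantMean hν (map_sum_pow_apply hw)
    (sum_mem fun i _ => mem_zeroInvariantMean_iff.2 fun A hA hTA => ?_)
  rw [setIntegralCLM_transferCLM_pow hν.quasiMeasurePreserving hA hTA]
  exact mem_zeroInvariantMean_iff.1 w_mem A hA hTA

end Invariant

/-! ### Block sums -/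

section BlockSum

theorem abs_blockSum_le {X : Type*} (T : X → X) {h : X → ℝ} {b : ℝ} (hb : ∀ x, |h x| ≤ b) (R : ℕ)
    (x : X) : |blockSum T h R x| ≤ (1 / √R) * (R * b) := by
  rw [blockSum, abs_mul, abs_of_nonneg (by positivity : (0 : ℝ) ≤ 1 / √R)]
  gcongr
  refine (Finset.abs_sum_le_sum_abs _ _).trans ?_
  simpa using Finset.sum_le_card_nsmul (Finset.range R) _ b fun k _ => hb (T^[k] x)

variable {X : Type*} [MeasurableSpace X] {T : X → X} {ν : Measure X}

theorem integrable_blockSum (hν : MeasurePreserving T ν ν) {h : X → ℝ} (hh : Integrable h ν)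
    (R : ℕ) : Integrable (blockSum T h R) ν :=
  (integrable_finsetSum _ fun k _ =>
    (hν.iterate k).integrable_comp_of_integrable hh).const_mul _

variable [IsFiniteMeasure ν]

theorem transferOp_comp (hν : MeasurePreserving T ν ν) {φ : X → ℝ} (hφ : Integrable φ ν) :
    transferOp T ν (φ ∘ T) =ᵐ[ν] φ := by
  refine transferOp_ae_eq_of_setIntegral hν.quasiMeasurePreserving
    (hν.integrable_comp_of_integrable hφ) hφ fun A hA => ?_
  conv_lhs => rw [← hν.map_eq]
  exact setIntegral_map hA (by rw [hν.map_eq]; exact hφ.1) hν.aemeasurable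

theorem transferOp_iterate_comp_iterate (hν : MeasurePreserving T ν ν) {φ : X → ℝ}
    (hφ : Integrable φ ν) (k : ℕ) : (transferOp T ν)^[k] (φ ∘ T^[k]) =ᵐ[ν] φ := by
  induction k with
  | zero => rfl
  | succ k ih =>
    rw [Function.iterate_succ_apply, Function.iterate_succ, ← Function.comp_assoc]
    refine (transferOp_iterate_congr T (transferOp_comp hν ?_) k).trans ih
    exact (hν.iterate k).integrable_comp_of_integrable hφ

theorem transferCLM_pow_blockSum (hν : MeasurePreserving T ν ν) {h : X → ℝ}
    (hh : Integrable h ν) (R : ℕ) :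
    (transferCLM hν.quasiMeasurePreserving ^ R) ((integrable_blockSum hν hh R).toL1 _)
      = (1 / √R) • ∑ i ∈ Finset.range R,
        (transferCLM hν.quasiMeasurePreserving ^ (i + 1)) (hh.toL1 h) := by
  set Q := transferCLM hν.quasiMeasurePreserving
  have integrable_comp : ∀ k, Integrable (h ∘ T^[k]) ν := fun k =>
    (hν.iterate k).integrable_comp_of_integrable hh
  have pow_comp : ∀ k, (Q ^ k) ((integrable_comp k).toL1 _) = hh.toL1 h := fun k =>
    Lp.ext <| ((coeFn_transferCLM_pow hν.quasiMeasurePreserving k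
      (integrable_comp k).coeFn_toL1).trans (transferOp_iterate_comp_iterate hν hh k)).trans
        hh.coeFn_toL1.symm
  have toL1_blockSum : (integrable_blockSum hν hh R).toL1 _
      = (1 / √R) • ∑ k ∈ Finset.range R, (integrable_comp k).toL1 _ := by
    refine Lp.ext ((integrable_blockSum hν hh R).coeFn_toL1.trans ?_)
    have coeFn_comp : ∀ᵐ x ∂ν, ∀ k, (integrable_comp k).toL1 _ x = h (T^[k] x) :=
      ae_all_iff.2 fun k => (integrable_comp k).coeFn_toL1
    filter_upwards [Lp.coeFn_smul (1 / √R) (∑ k ∈ Finset.range R, (integrable_comp k).toL1 _),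
      Lp.coeFn_finsetSum (Finset.range R) fun k => (integrable_comp k).toL1 _, coeFn_comp]
      with x coeFn_smul coeFn_sum coeFn_comp
    simp only [coeFn_smul, Pi.smul_apply, coeFn_sum, Finset.sum_apply, smul_eq_mul, blockSum,
      coeFn_comp]
  rw [toL1_blockSum, map_smul, map_sum, ← Finset.sum_range_reflect]
  refine congrArg _ (Finset.sum_congr rfl fun i hi => ?_)
  have exponent : R = (i + 1) + (R - 1 - i) := by have := Finset.mem_range.1 hi; omega
  calc (Q ^ R) ((integrable_comp (R - 1 - i)).toL1 _)
    _ = (Q ^ ((i + 1) + (R - 1 - i))) ((integrable_comp (R - 1 - i)).toL1 _) := by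
      rw [← exponent]
    _ = (Q ^ (i + 1)) (hh.toL1 h) := by rw [pow_add_apply, pow_comp]

theorem norm_transferCLM_pow_blockSum_le (hν : MeasurePreserving T ν ν) {h : X → ℝ}
    (hh : Integrable h ν) {R : ℕ} {w : Lp ℝ 1 ν}
    (hw : ∑ i ∈ Finset.range R, (transferCLM hν.quasiMeasurePreserving ^ i) w = 0) (n : ℕ) :
    ‖(transferCLM hν.quasiMeasurePreserving ^ (n + R)) ((integrable_blockSum hν hh R).toL1 _)‖
      ≤ (1 / √R) * (R * ‖(transferCLM hν.quasiMeasurePreserving ^ n) (hh.toL1 h - w)‖) := by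
  set Q := transferCLM hν.quasiMeasurePreserving
  have norm_pow_le := norm_pow_apply_le (isMarkov_transferCLM hν.quasiMeasurePreserving).norm_map_le
  have sum_eq_zero : ∑ i ∈ Finset.range R, (Q ^ (i + 1)) w = 0 := by
    simpa only [map_sum, map_zero, pow_succ', mul_apply_eq_comp] using congrArg Q hw
  have sum_eq : ∑ i ∈ Finset.range R, (Q ^ (i + 1)) (hh.toL1 h)
      = ∑ i ∈ Finset.range R, (Q ^ (i + 1)) (hh.toL1 h - w) := by
    simp only [map_sub, Finset.sum_sub_distrib, sum_eq_zero, sub_zero]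
  have pow_comm : ∀ i f, (Q ^ n) ((Q ^ i) f) = (Q ^ i) ((Q ^ n) f) := fun i f => by
    rw [← pow_add_apply, add_comm, pow_add_apply]
  rw [pow_add_apply, transferCLM_pow_blockSum hν hh, sum_eq, map_smul, map_sum, norm_smul,
    Real.norm_of_nonneg (by positivity)]
  simp only [pow_comm]
  gcongr
  refine (norm_sum_le _ _).trans ?_
  simpa using Finset.sum_le_card_nsmul (Finset.range R) _ _ fun i _ =>
    norm_pow_le (i + 1) ((Q ^ n) (hh.toL1 h - w))

theorem abs_transferOp_iterate_le (hν : MeasurePreserving T ν ν) {u : X → ℝ} {b : ℝ}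
    (hu : Integrable u ν) (hb : ∀ᵐ x ∂ν, |u x| ≤ b) (n : ℕ) :
    ∀ᵐ x ∂ν, |(transferOp T ν)^[n] u x| ≤ b := by
  induction n generalizing u with
  | zero => exact hb
  | succ n ih =>
    rw [Function.iterate_succ_apply]
    refine ih (transferOp_integrable T ν u) ?_
    filter_upwards [abs_transferOp_le hν.quasiMeasurePreserving hu,
      transferOp_mono hν.quasiMeasurePreserving hu.abs (integrable_const b) hb,
      transferOp_comp hν (integrable_const b)] with x abs_le mono const_eq
    exact (abs_le.trans mono).trans_eq const_eq

end BlockSum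

/-! ### Summability in `L²` -/

section Summability

variable {X : Type*} [MeasurableSpace X] {T : X → X} {ν : Measure X}

theorem eLpNorm_two_le_of_abs_le {u : X → ℝ} {b : ℝ} (hb : ∀ᵐ x ∂ν, |u x| ≤ b) :
    eLpNorm u 2 ν ≤ (ENNReal.ofReal b * eLpNorm u 1 ν) ^ (1 / 2 : ℝ) := by
  rw [eLpNorm_eq_lintegral_rpow_enorm_toReal two_ne_zero ENNReal.ofNat_ne_top,
    eLpNorm_one_eq_lintegral_enorm, ← lintegral_const_mul' _ _ ENNReal.ofReal_ne_top,
    ENNReal.toReal_ofNat]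
  refine ENNReal.rpow_le_rpow (lintegral_mono_ae ?_) (by norm_num)
  filter_upwards [hb] with x hx
  rw [ENNReal.rpow_two, sq]
  gcongr
  rw [Real.enorm_eq_ofReal_abs]
  exact ENNReal.ofReal_le_ofReal hx

theorem tsum_mul_eLpNorm_sum_lt_top {a : ℕ → X → ℝ} (ha : ∀ k, AEStronglyMeasurable (a k) ν)
    (hsum : ∑' k, eLpNorm (a k) 2 ν ≠ ⊤) :
    ∑' n : ℕ, ENNReal.ofReal (((n : ℝ) + 1) ^ (-(3 / 2) : ℝ)) *
      eLpNorm (∑ k ∈ Finset.range (n + 1), a k) 2 ν < ⊤ := by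
  have summable_weight : Summable fun n : ℕ => ((n : ℝ) + 1) ^ (-(3 / 2) : ℝ) := by
    simpa only [Nat.cast_add, Nat.cast_one] using (summable_nat_add_iff 1).2
      (Real.summable_nat_rpow (p := (-(3 / 2) : ℝ)).2 (by norm_num))
  calc ∑' n : ℕ, ENNReal.ofReal (((n : ℝ) + 1) ^ (-(3 / 2) : ℝ)) *
        eLpNorm (∑ k ∈ Finset.range (n + 1), a k) 2 ν
    _ ≤ ∑' n : ℕ, ENNReal.ofReal (((n : ℝ) + 1) ^ (-(3 / 2) : ℝ)) *
        ∑' k, eLpNorm (a k) 2 ν := by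
      gcongr with n
      exact (eLpNorm_sum_le (fun k _ => ha k) one_le_two).trans (ENNReal.sum_le_tsum _)
    _ < ⊤ := by
      rw [ENNReal.tsum_mul_right]
      exact ENNReal.mul_lt_top summable_weight.tsum_ofReal_lt_top hsum.lt_top

theorem tsum_rpow_mul_ofReal_mul_pow_ne_top {b C θ p : ℝ} (hC : 0 ≤ C)
    (hθ : θ ∈ Set.Ico (0 : ℝ) 1) (hp : 0 < p) :
    ∑' k : ℕ, (ENNReal.ofReal b * ENNReal.ofReal (C * θ ^ k)) ^ p ≠ ⊤ := by
  have term_eq : ∀ k : ℕ, (ENNReal.ofReal b * ENNReal.ofReal (C * θ ^ k)) ^ p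
      = (ENNReal.ofReal b * ENNReal.ofReal C) ^ p * (ENNReal.ofReal θ ^ p) ^ k := fun k => by
    rw [ENNReal.ofReal_mul hC, ENNReal.ofReal_pow hθ.1, ← mul_assoc,
      ENNReal.mul_rpow_of_nonneg _ _ hp.le, ← ENNReal.rpow_natCast, ← ENNReal.rpow_natCast,
      ← ENNReal.rpow_mul, ← ENNReal.rpow_mul, mul_comm p]
  have ratio_lt_one : ENNReal.ofReal θ ^ p < 1 :=
    ENNReal.rpow_lt_one (by simpa using hθ.2) hp
  simp only [term_eq]
  rw [ENNReal.tsum_mul_left, ENNReal.tsum_geometric]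
  exact ENNReal.mul_ne_top (ENNReal.rpow_ne_top_of_nonneg hp.le
    (ENNReal.mul_ne_top ENNReal.ofReal_ne_top ENNReal.ofReal_ne_top))
    (ENNReal.inv_ne_top.2 (tsub_pos_of_lt ratio_lt_one).ne')

theorem tsum_eLpNorm_two_ne_top [IsFiniteMeasure ν] (hν : MeasurePreserving T ν ν) {u : X → ℝ}
    (hu : Integrable u ν) {b : ℝ} (hb : ∀ x, |u x| ≤ b) {R : ℕ} {C θ : ℝ} (hC : 0 ≤ C)
    (hθ : θ ∈ Set.Ico (0 : ℝ) 1)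
    (bound : ∀ k, ‖(transferCLM hν.quasiMeasurePreserving ^ (R * (k + 1))) (hu.toL1 u)‖
      ≤ C * θ ^ k) :
    ∑' k, eLpNorm ((transferOp T ν)^[R * k] u) 2 ν ≠ ⊤ := by
  have eLpNorm_le : ∀ n, eLpNorm ((transferOp T ν)^[n] u) 2 ν ≤ (ENNReal.ofReal b *
      ENNReal.ofReal ‖(transferCLM hν.quasiMeasurePreserving ^ n) (hu.toL1 u)‖) ^ (1 / 2 : ℝ) := by
    intro n
    rw [← eLpNorm_transferOp_iterate hν.quasiMeasurePreserving hu.coeFn_toL1]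
    exact eLpNorm_two_le_of_abs_le
      (abs_transferOp_iterate_le hν hu (Eventually.of_forall hb) n)
  rw [tsum_eq_zero_add' ENNReal.summable]
  refine ENNReal.add_ne_top.2 ⟨ne_top_of_le_ne_top (ENNReal.rpow_ne_top_of_nonneg (by norm_num)
    (ENNReal.mul_ne_top ENNReal.ofReal_ne_top ENNReal.ofReal_ne_top)) (eLpNorm_le _), ?_⟩
  refine ne_top_of_le_ne_top (tsum_rpow_mul_ofReal_mul_pow_ne_top (b := b) hC hθ one_half_pos)
    (ENNReal.tsum_le_tsum fun k => (eLpNorm_le _).trans ?_)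
  gcongr
  exact bound k

theorem aestronglyMeasurable_transferOp_iterate {u : X → ℝ} (hu : AEStronglyMeasurable u ν)
    (n : ℕ) : AEStronglyMeasurable ((transferOp T ν)^[n] u) ν := by
  cases n with
  | zero => exact hu
  | succ n =>
    rw [Function.iterate_succ_apply']
    exact (transferOp_integrable T ν _).1

end Summability

section Main

variable {X : Type*} [MeasurableSpace X] {T : X → X} {μ ν : Measure X} [IsFiniteMeasure μ]
  [IsProbabilityMeasure ν]

theorem exists_map_toL1_one_mem (hT : Measure.QuasiMeasurePreserving T μ μ)
    (hν : MeasurePreserving T ν ν) {D : ℝ≥0 → Set (Lp ℝ 1 μ)}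
    (hD : IsLasotaYorke (transferCLM hT) D) {J : Lp ℝ 1 ν →ₗᵢ[ℝ] Lp ℝ 1 μ}
    (hJ : ∀ n f, J ((transferCLM hν.quasiMeasurePreserving ^ n) f) = (transferCLM hT ^ n) (J f)) :
    ∃ c, J ((integrable_const (1 : ℝ)).toL1 _) ∈ D c := by
  obtain ⟨c, ball_subset⟩ := hD.exists_recurrent_ball_subset (isMarkov_transferCLM hT).norm_map_le
  have hone : Integrable (fun _ : X => (1 : ℝ)) ν := integrable_const 1
  have pow_one : ∀ n, (transferCLM hν.quasiMeasurePreserving ^ n) (hone.toL1 _) = hone.toL1 _ :=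
    fun n => Lp.ext <| ((coeFn_transferCLM_pow hν.quasiMeasurePreserving n hone.coeFn_toL1).trans
      (transferOp_iterate_comp_iterate hν hone n)).trans hone.coeFn_toL1.symm
  refine ⟨c, ball_subset _ (mem_recurrentSet_iff.2 fun ε hε n₀ => ⟨n₀, le_rfl, ?_⟩) ?_⟩
  · rwa [← hJ, pow_one, sub_self, norm_zero]
  · rw [J.norm_map, L1.norm_eq_integral_norm]
    refine (integral_congr_ae (hone.coeFn_toL1.fun_comp norm)).trans_le ?_
    simp

variable [LinearOrder X] [TopologicalSpace X] [OrderTopology X] [BorelSpace X]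

theorem exists_periodic_part (hT : Measure.QuasiMeasurePreserving T μ μ)
    (hν : MeasurePreserving T ν ν) (hνμ : ν ≪ μ)
    (hD : IsLasotaYorke (transferCLM hT) fun c => closure (bvSet μ c)) {R : ℕ} (hR : 0 < R)
    (hper : ∀ f : Lp ℝ 1 μ, ∃ φ, (transferCLM hT ^ R) φ = φ ∧
      Tendsto (fun n => (transferCLM hT ^ n) (f - φ)) atTop (𝓝 0))
    {h : X → ℝ} (hvar : zeroEndVar h < ⊤) (hh : Integrable h ν) :
    ∃ w : Lp ℝ 1 ν, (transferCLM hν.quasiMeasurePreserving ^ R) w = w ∧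
      ∃ C ≥ 0, ∃ θ ∈ Set.Ico (0 : ℝ) 1,
        ∀ n, ‖(transferCLM hν.quasiMeasurePreserving ^ n) (hh.toL1 h - w)‖ ≤ C * θ ^ n := by
  have hP := (isMarkov_transferCLM hT).norm_map_le
  obtain ⟨J, ρ, coeFn_J, setIntegral_J⟩ := exists_density_embedding hνμ
  have J_pow := map_transferCLM_pow_of_setIntegral hT hν.quasiMeasurePreserving setIntegral_J
  obtain ⟨c, density_mem⟩ := exists_map_toL1_one_mem hT hν hD J_pow
  have Jh_mem : J (hh.toL1 h) ∈ closure (bvSet μ ((2 * zeroEndVar h).toNNReal * c)) := by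
    refine mem_closure_bvSet_of_ae_eq_mul hvar density_mem ?_
    filter_upwards [coeFn_J _ _ hh.coeFn_toL1, coeFn_J _ _ (integrable_const 1).coeFn_toL1]
      with x Jh_apply density_apply
    rw [Jh_apply, density_apply, mul_one, mul_comm]
  obtain ⟨φ, hφ, hlim⟩ := hper (J (hh.toL1 h))
  have tendsto_φ := tendsto_pow_mul_apply hR hφ hlim
  obtain ⟨c', sub_mem⟩ := hD.exists_sub_mem_of_tendsto hP Jh_mem tendsto_φ
  obtain ⟨w, rfl⟩ : φ ∈ Set.range J :=
    J.isometry.isClosedEmbedding.isClosed_range.mem_of_tendsto tendsto_φ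
      (Eventually.of_forall fun k => ⟨_, J_pow (R * k) (hh.toL1 h)⟩)
  obtain ⟨C, hC, θ, hθ, bound⟩ := hD.exists_geometric_bound hP sub_mem hlim
  refine ⟨w, J.injective (by rw [J_pow, hφ]), C, hC, θ, hθ, fun n => ?_⟩
  rw [← J.norm_map, J_pow, map_sub]
  exact bound n

theorem blockSummability_of_isLasotaYorke (hT : Measure.QuasiMeasurePreserving T μ μ)
    (hν : MeasurePreserving T ν ν) (hνμ : ν ≪ μ)
    (hD : IsLasotaYorke (transferCLM hT) fun c => closure (bvSet μ c)) {R : ℕ} (hR : 0 < R)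
    (hper : ∀ f : Lp ℝ 1 μ, ∃ φ, (transferCLM hT ^ R) φ = φ ∧
      Tendsto (fun n => (transferCLM hT ^ n) (f - φ)) atTop (𝓝 0))
    {h : X → ℝ} (hvar : zeroEndVar h < ⊤)
    (hcond : ν[h | MeasurableSpace.invariants T] =ᵐ[ν] 0) :
    BlockSummability T ν h R := by
  have hh : Integrable h ν := integrable_of_zeroEndVar_lt_top hvar ν
  obtain ⟨w, hw, C, hC, θ, hθ, bound⟩ := exists_periodic_part hT hν hνμ hD hR hper hvar hh
  have hlim : Tendsto (fun n => (transferCLM hν.quasiMeasurePreserving ^ n) (hh.toL1 h - w))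
      atTop (𝓝 0) := squeeze_zero_norm bound <| by
    simpa only [mul_zero] using (tendsto_pow_atTop_nhds_zero_of_lt_one hθ.1 hθ.2).const_mul C
  have sum_eq_zero :=
    sum_transferCLM_pow_eq_zero hν (toL1_mem_zeroInvariantMean hν hh hcond) hw hlim
  have hint := integrable_blockSum hν hh R
  refine tsum_mul_eLpNorm_sum_lt_top
    (fun k => aestronglyMeasurable_transferOp_iterate hint.1 (R * k)) ?_
  refine tsum_eLpNorm_two_ne_top hν hint (abs_blockSum_le T (abs_le_toReal_zeroEndVar hvar) R)
    (C := 1 / √R * (R * C)) (θ := θ ^ R) (by positivity)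
    ⟨pow_nonneg hθ.1 R, pow_lt_one₀ hθ.1 hθ.2 hR.ne'⟩ fun k => ?_
  calc ‖(transferCLM hν.quasiMeasurePreserving ^ (R * (k + 1))) (hint.toL1 _)‖
    _ ≤ 1 / √R * (R * ‖(transferCLM hν.quasiMeasurePreserving ^ (R * k)) (hh.toL1 h - w)‖) :=
      norm_transferCLM_pow_blockSum_le hν hh sum_eq_zero (R * k)
    _ ≤ 1 / √R * (R * (C * θ ^ (R * k))) := by gcongr; exact bound _
    _ = 1 / √R * (R * C) * (θ ^ R) ^ k := by rw [pow_mul]; ring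

end Main

end

theorem mainTheorem8 {X : Type*} [ConditionallyCompleteLinearOrder X] [TopologicalSpace X]
    [OrderTopology X] [MeasurableSpace X] [BorelSpace X]
    (μ : Measure X) [IsProbabilityMeasure μ] [μ.Regular] (T : X → X) (V : Set X)
    (hT : IsPiecewiseUniformlyExpanding T μ V)
    (ν : Measure X) [IsProbabilityMeasure ν] (hν : MeasurePreserving T ν ν) (hνμ : ν ≪ μ)
    (h : X → ℝ) (hBV : BoundedVariationOn h Set.univ)
    (hcond : ν[h | MeasurableSpace.invariants T] =ᵐ[ν] 0) :
    (∃ (l : ℕ) (r : Fin l → ℕ) (g : (i : Fin l) → Fin (r i) → X → ℝ)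
      (lam : (i : Fin l) → Fin (r i) → (Lp ℝ 1 μ →L[ℝ] ℝ)),
      IsAsymptoticallyPeriodicWith T μ r g lam) ∧
    ∀ (l : ℕ) (r : Fin l → ℕ) (g : (i : Fin l) → Fin (r i) → X → ℝ)
      (lam : (i : Fin l) → Fin (r i) → (Lp ℝ 1 μ →L[ℝ] ℝ)),
      IsAsymptoticallyPeriodicWith T μ r g lam →
        BlockSummability T ν h (∏ i, r i) := by
  obtain ⟨𝒵, w, c, hI⟩ := hT.exists_weightedBranchSystem
  have hD := hI.isLasotaYorke hT.nonsingular
  refine ⟨hD.exists_asymptoticallyPeriodic hT.nonsingular, fun l r g lam hA => ?_⟩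
  exact blockSummability_of_isLasotaYorke hT.nonsingular hν hνμ hD
    (Finset.prod_pos fun i _ => hA.length_pos i) (hA.exists_periodic hT.nonsingular)
    (zeroEndVar_lt_top_iff.2 hBV) hcond
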